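/- An instance of the node-weighted Steiner tree augmentation problem (NW-STAP) consists of a finite simple graph $G=(V,E)$, a set of terminals $R\subseteq V$, a subgraph $T=(R,E(T))$ of $G$ that is a tree with vertex set exactly $R$, and a non-negative rational cost $c_v$ for every Steiner node $v\in V\setminus R$. A set $S\subseteq V\setminus R$ is feasible if the induced subgraph $G[R\cup S]$ is 2-edge-connected, i.e. remains connected after the deletion of any single edge (a one-vertex graph counts as 2-edge-connected); its cost is $c(S)=\sum_{v\in S}c_v$. There are an absolute constant $C$ and an algorithm (a program for a unit-cost random access machine with addition, subtraction and halving) that, for every instance of NW-STAP, halts after a number of steps polynomial in the bit length of the instance (with costs written in binary as fractions) and outputs a set $A\subseteq V$ such that, whenever the instance has a feasible set, $A$ is feasible and $$c(A)\le C\,(\log|R|)^2\,c(S)\qquad\text{for every feasible set } S .$$ That is, NW-STAP has a polynomial-time $O(\log^2|R|)$-approximation algorithm. -/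

import Mathlib

/-! ### A random access machine with unit-cost steps

The machine has registers and arrays, all of whose cells hold natural numbers of arbitrary size.
Its arithmetic consists of addition, truncated subtraction and halving; there is no multiplication,
so a number grows by at most one bit per operation and the number of steps is polynomially related
to the running time of a Turing machine. Programs are finite and structured. -/

namespace RAM

/-- Expressions. The names of registers and arrays are fixed in the program, the index into an
array is computed. -/
inductive Expr where
  | lit (n : ℕ)
  | reg (r : ℕ)
  | get (a : ℕ) (i : Expr)
  | add (e₁ e₂ : Expr)
  | sub (e₁ e₂ : Expr)
  | half (e : Expr)

/-- Programs: doing nothing, assignment to a register, assignment to an array cell, composition,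
branching on whether an expression is nonzero, and iteration while an expression is nonzero. -/
inductive Prog where
  | skip
  | assign (r : ℕ) (e : Expr)
  | store (a : ℕ) (i e : Expr)
  | seq (p q : Prog)
  | branch (e : Expr) (p q : Prog)
  | loop (e : Expr) (p : Prog)

/-- The contents of the registers and of the arrays. -/
@[ext]
structure State where
  reg : ℕ → ℕ
  arr : ℕ → ℕ → ℕ

namespace Expr

/-- The value of an expression. -/
def eval (s : State) : Expr → ℕ
  | lit n => n
  | reg r => s.reg r
  | get a i => s.arr a (i.eval s)
  | add e₁ e₂ => e₁.eval s + e₂.eval s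
  | sub e₁ e₂ => e₁.eval s - e₂.eval s
  | half e => e.eval s / 2

/-- The number of elementary operations in the evaluation of an expression. -/
def cost : Expr → ℕ
  | lit _ => 1
  | reg _ => 1
  | get _ i => i.cost + 1
  | add e₁ e₂ => e₁.cost + e₂.cost + 1
  | sub e₁ e₂ => e₁.cost + e₂.cost + 1
  | half e => e.cost + 1

end Expr

namespace State

/-- Overwrite the register `r`. -/
def setReg (s : State) (r v : ℕ) : State :=
  { s with reg := Function.update s.reg r v }

/-- Overwrite the cell `i` of the array `a`. -/
def setArr (s : State) (a i v : ℕ) : State :=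
  { s with arr := Function.update s.arr a (Function.update (s.arr a) i v) }

/-- The initial state on the input `x`: the entries of `x` are in array `0`, the length of `x` is in
register `0`, and everything else is `0`. -/
def init (x : List ℕ) : State where
  reg r := if r = 0 then x.length else 0
  arr a i := if a = 0 then x.getD i 0 else 0

/-- The output in a final state: the list whose length is in register `0` and whose entries are in
array `0`. -/
def output (s : State) : List ℕ :=
  (List.range (s.reg 0)).map (s.arr 0)

end State

/-- `Exec p s t s'` says that the program `p`, started in the state `s`, halts after exactly `t`
steps in the state `s'`. -/
inductive Exec : Prog → State → ℕ → State → Prop where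
  | skip (s : State) : Exec .skip s 1 s
  | assign (r : ℕ) (e : Expr) (s : State) :
      Exec (.assign r e) s (e.cost + 1) (s.setReg r (e.eval s))
  | store (a : ℕ) (i e : Expr) (s : State) :
      Exec (.store a i e) s (i.cost + e.cost + 1) (s.setArr a (i.eval s) (e.eval s))
  | seq {p q : Prog} {s s' s'' : State} {t t' : ℕ} :
      Exec p s t s' → Exec q s' t' s'' → Exec (.seq p q) s (t + t') s''
  | branch_true {e : Expr} {p q : Prog} {s s' : State} {t : ℕ} :
      e.eval s ≠ 0 → Exec p s t s' → Exec (.branch e p q) s (e.cost + 1 + t) s'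
  | branch_false {e : Expr} {p q : Prog} {s s' : State} {t : ℕ} :
      e.eval s = 0 → Exec q s t s' → Exec (.branch e p q) s (e.cost + 1 + t) s'
  | loop_true {e : Expr} {p : Prog} {s s' s'' : State} {t t' : ℕ} :
      e.eval s ≠ 0 → Exec p s t s' → Exec (.loop e p) s' t' s'' →
        Exec (.loop e p) s (e.cost + 1 + t + t') s''
  | loop_false {e : Expr} {p : Prog} {s : State} :
      e.eval s = 0 → Exec (.loop e p) s (e.cost + 1) s

/-- The size of a list of natural numbers written in binary, with one separator per entry. -/
def bitLength (x : List ℕ) : ℕ :=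
  (x.map fun k => Nat.size k + 1).sum

/-- One fixed program produces the output `out a` on the input `inp a`, for every `a`, in a number
of steps that is bounded by a polynomial in the bit length of the input. -/
def PolyTimeComputable {α : Type*} (inp out : α → List ℕ) : Prop :=
  ∃ (P : Prog) (p : Polynomial ℕ), ∀ a : α, ∃ (t : ℕ) (s : State),
    Exec P (State.init (inp a)) t s ∧ t ≤ p.eval (bitLength (inp a)) ∧ s.output = out a

end RAM

/-! ### Node-weighted Steiner tree augmentation -/

/-- An instance of the node-weighted Steiner tree augmentation problem: a graph `G` on the vertices
`0, …, n - 1`, a set `R` of terminals, a subgraph `T` of `G` that is a tree with vertex set `R`, and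
nonnegative rational costs of the Steiner nodes, i.e. the vertices outside `R` (terminals carry the
value `0`). -/
structure NWSTAP where
  n : ℕ
  G : SimpleGraph (Fin n)
  R : Finset (Fin n)
  T : G.Subgraph
  verts_T : T.verts = (R : Set (Fin n))
  isTree_T : T.coe.IsTree
  c : Fin n → ℚ≥0
  c_terminal : ∀ v ∈ R, c v = 0

namespace NWSTAP

/-- A set `S` of Steiner nodes is feasible if `G[R ∪ S]` is 2-edge-connected. -/
def Feasible (I : NWSTAP) (S : Finset (Fin I.n)) : Prop :=
  Disjoint S I.R ∧ (I.G.induce ((I.R ∪ S : Finset (Fin I.n)) : Set (Fin I.n))).IsEdgeConnected 2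

/-- The cost of a set of Steiner nodes. -/
def cost (I : NWSTAP) (S : Finset (Fin I.n)) : ℚ≥0 :=
  ∑ v ∈ S, I.c v

open Classical in
/-- A set of vertices as the list of its `n` indicator bits. -/
noncomputable def encodeSet (I : NWSTAP) (S : Finset (Fin I.n)) : List ℕ :=
  List.ofFn fun v => if v ∈ S then 1 else 0

open Classical in
/-- A binary relation on the vertices as the list, row by row, of the entries of its matrix. -/
noncomputable def encodeRel (I : NWSTAP) (r : Fin I.n → Fin I.n → Prop) : List ℕ :=
  (List.finRange I.n).flatMap fun u => (List.finRange I.n).map fun v => if r u v then 1 else 0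

/-- The encoding of an instance: the number of vertices, the adjacency matrices of `G` and of `T`,
the indicator bits of `R`, and the numerator and denominator of the cost of every vertex. -/
noncomputable def encode (I : NWSTAP) : List ℕ :=
  [I.n] ++ I.encodeRel I.G.Adj ++ I.encodeRel I.T.Adj ++ I.encodeSet I.R ++
    (List.finRange I.n).flatMap fun v => [(I.c v).num, (I.c v).den]

end NWSTAP

/-! The algorithm keeps a set `M` that contains the terminals and enlarges it until no edge of the
tree is a bridge of `G[M]`; a tree edge that is not a bridge is *covered*. It adds *spiders*, which
consist of a center and shortest paths, in `G` without the tree edges, to some terminals. Round `k`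
adds spiders that cost at most `2 * 2 ^ k` per newly covered edge, until none of them is left.

Let `S` be feasible and let `K` be a component of `R ∪ S` in `G` without the tree edges. Remove a
vertex `u` from `K`. By induction, every piece that contains terminals has a light path from a
neighbor of `u` to a terminal, and these paths are the legs of a spider with center `u`, which is
not cheap after round `k`. The leg in a piece is paid for by the weight of the piece, and the path
in the piece with the fewest terminals, extended to `u`, is the light path of `K`: if there are two
pieces, it has been charged once more, but the logarithm of the number of terminals drops by one.
Therefore at most `(log #R + 2) * w K / 2 ^ k` uncovered edges are crossed by `K`. Every uncovered
edge is crossed by some `K`, so at most `(log #R + 2) * w S / 2 ^ k` edges are uncovered after round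
`k`. Hence the next round costs at most a multiple of `(log #R + 2) * w S` times the drop of the
harmonic number of the number of uncovered edges, and the sum over the rounds contributes a second
logarithm. -/

/-! ### Spiders in connected sets -/

namespace Steiner

open Finset SimpleGraph

section ConnectedSets

variable {V : Type*}

/-- The edges of a graph with both ends in `M`, as a graph on all vertices. -/
def within (H : SimpleGraph V) (M : Finset V) : SimpleGraph V where
  Adj a b := H.Adj a b ∧ a ∈ M ∧ b ∈ M
  symm := ⟨fun _ _ h => ⟨h.1.symm, h.2.2, h.2.1⟩⟩
  loopless := ⟨fun _ h => H.loopless.irrefl _ h.1⟩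

theorem within_mono {H H' : SimpleGraph V} {M M' : Finset V} (hH : H ≤ H') (hM : M ⊆ M') :
    within H M ≤ within H' M' :=
  fun _ _ h => ⟨hH h.1, hM h.2.1, hM h.2.2⟩

theorem within_le (H : SimpleGraph V) (M : Finset V) : within H M ≤ H := fun _ _ h => h.1

theorem mem_of_reachable_within {H : SimpleGraph V} {M : Finset V} {x y : V}
    (h : (within H M).Reachable x y) (hx : x ∈ M) : y ∈ M := by
  obtain ⟨p⟩ := h
  induction p with
  | nil => exact hx
  | cons h _ ih => exact ih h.2.2

theorem reachable_within_of_support {H : SimpleGraph V} {M B : Finset V} {x y : V}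
    (p : (within H M).Walk x y) (hp : ∀ z ∈ p.support, z ∈ B) : (within H B).Reachable x y := by
  induction p with
  | nil => rfl
  | @cons x z y h p ih =>
    have hadj : (within H B).Adj x z := ⟨h.1, hp x (by simp), hp z (by simp)⟩
    exact hadj.reachable.trans (ih fun t ht => hp t (by simp [ht]))

/-- The set `K` is empty or induces a connected subgraph. -/
def ConnectedOn (H : SimpleGraph V) (K : Finset V) : Prop :=
  ∀ x ∈ K, ∀ y ∈ K, (within H K).Reachable x y

theorem ConnectedOn.of_root {H : SimpleGraph V} {K : Finset V} (u : V)
    (h : ∀ x ∈ K, (within H K).Reachable u x) : ConnectedOn H K :=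
  fun x hx y hy => (h x hx).symm.trans (h y hy)

theorem connectedOn_singleton (H : SimpleGraph V) (u : V) : ConnectedOn H {u} :=
  .of_root u fun x hx => by rw [mem_singleton.1 hx]

theorem ConnectedOn.insert [DecidableEq V] {H : SimpleGraph V} {P : Finset V}
    (hP : ConnectedOn H P) {u z : V} (hz : z ∈ P) (huz : H.Adj u z) :
    ConnectedOn H (insert u P) := by
  refine .of_root z fun x hx => ?_
  rcases mem_insert.1 hx with rfl | hx
  · exact Adj.reachable ⟨huz.symm, by simp [hz], by simp⟩
  · exact (hP z hz x hx).mono (within_mono le_rfl (subset_insert _ _))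

open Classical in
/-- The vertices of `M` that are connected to `x` inside `M`. -/
noncomputable def component (H : SimpleGraph V) (M : Finset V) (x : V) : Finset V :=
  M.filter fun z => (within H M).Reachable x z

theorem mem_component {H : SimpleGraph V} {M : Finset V} {x z : V} :
    z ∈ component H M x ↔ z ∈ M ∧ (within H M).Reachable x z := by
  simp [component]

theorem mem_component_self {H : SimpleGraph V} {M : Finset V} {x : V} (hx : x ∈ M) :
    x ∈ component H M x :=
  mem_component.2 ⟨hx, .rfl⟩

theorem component_subset (H : SimpleGraph V) (M : Finset V) (x : V) : component H M x ⊆ M :=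
  fun _ h => (mem_component.1 h).1

theorem connectedOn_component (H : SimpleGraph V) (M : Finset V) (x : V) :
    ConnectedOn H (component H M x) := by
  classical
  refine .of_root x fun y hy => ?_
  obtain ⟨hyM, ⟨p⟩⟩ := mem_component.1 hy
  refine reachable_within_of_support p fun z hz =>
    mem_component.2 ⟨?_, (p.takeUntil z hz).reachable⟩
  exact mem_of_reachable_within (p.dropUntil z hz).reachable.symm hyM

theorem component_eq_of_mem {H : SimpleGraph V} {M : Finset V} {x y z : V}
    (hx : z ∈ component H M x) (hy : z ∈ component H M y) : component H M x = component H M y := by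
  have hxy := (mem_component.1 hx).2.trans (mem_component.1 hy).2.symm
  ext t
  simp only [mem_component]
  exact and_congr_right fun _ => ⟨hxy.symm.trans, hxy.trans⟩

theorem exists_adj_mem_component_erase [DecidableEq V] {H : SimpleGraph V} {K : Finset V} {x u : V}
    (h : (within H K).Reachable x u) (hx : x ≠ u) :
    ∃ z ∈ component H (K.erase u) x, H.Adj u z := by
  obtain ⟨p⟩ := h
  induction p with
  | nil => exact absurd rfl hx
  | @cons a b c h _ ih =>
    have ha : a ∈ K.erase c := mem_erase.2 ⟨hx, h.2.1⟩
    rcases eq_or_ne b c with rfl | hb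
    · exact ⟨a, mem_component_self ha, h.1.symm⟩
    · obtain ⟨z, hz, hzc⟩ := ih hb
      obtain ⟨hz, hr⟩ := mem_component.1 hz
      have hadj : (within H (K.erase c)).Adj a b := ⟨h.1, ha, mem_erase.2 ⟨hb, h.2.2⟩⟩
      exact ⟨z, mem_component.2 ⟨hz, hadj.reachable.trans hr⟩, hzc⟩

end ConnectedSets

section Spiders

variable {V : Type*} [DecidableEq V]

/-- A subadditive measure `h` of sets of terminals that is bounded, on the feet of every spider, by
the weight `w v` of the center and the lengths `d v y` of the legs; `d v y` does not exceed the
weight, without `v`, of a connected set that contains `v` and `y`. -/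
structure SpiderBound (H : SimpleGraph V) (R : Finset V) (w : V → ℕ) (d : V → V → ℕ)
    (h : Finset V → ℕ) : Prop where
  weight_terminal : ∀ v ∈ R, w v = 0
  dist_le : ∀ v y P, ConnectedOn H P → v ∈ P → y ∈ P → w v + d v y ≤ ∑ x ∈ P, w x
  union_le : ∀ X Y, (X ∩ Y).Nonempty → h (X ∪ Y) ≤ h X + h Y
  spider_le : ∀ v, ∀ Y ⊆ R, Y.Nonempty → (∀ y ∈ Y, H.Reachable v y) → h Y ≤ w v + ∑ y ∈ Y, d v y

/-- A path `P` in `K` that ends in a terminal `x` and is so light that the weight of `K` pays for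
the terminals of `K` and for many further copies of `P`, the more the fewer terminals `K` has. The
parameter `L` bounds the logarithm of the number of terminals. -/
structure LightPath (R : Finset V) (w : V → ℕ) (h : Finset V → ℕ) (L : ℕ) (K : Finset V) (x : V)
    (P : Finset V) : Prop where
  terminal_mem : x ∈ K ∩ R
  subset : P ⊆ K
  mem : x ∈ P
  bound : h (K ∩ R) + (L + 1 - Nat.log 2 (K ∩ R).card) * ∑ v ∈ P, w v ≤ (L + 2) * ∑ v ∈ K, w v

/-- The pieces `C` of a set `K` after the removal of its root `u`, each with a light path that can
be extended to `u`. -/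
structure Branching (H : SimpleGraph V) (R : Finset V) (w : V → ℕ) (h : Finset V → ℕ) (L : ℕ)
    (K : Finset V) (u : V) (C : Finset (Finset V)) (x : Finset V → V)
    (P : Finset V → Finset V) : Prop where
  subset : ∀ c ∈ C, c ⊆ K.erase u
  disjoint : (C : Set (Finset V)).PairwiseDisjoint id
  cover : ∀ z ∈ K ∩ R, z ≠ u → ∃ c ∈ C, z ∈ c
  lightPath : ∀ c ∈ C, LightPath R w h L c (x c) (P c)
  connected : ∀ c ∈ C, ConnectedOn H (insert u (P c))

variable {H : SimpleGraph V} {R : Finset V} {w : V → ℕ} {d : V → V → ℕ} {h : Finset V → ℕ} {L : ℕ}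
  {K : Finset V} {u : V} {C : Finset (Finset V)} {x : Finset V → V} {P : Finset V → Finset V}

theorem SpiderBound.dist_self (hs : SpiderBound H R w d h) (u : V) : d u u = 0 := by
  simpa using hs.dist_le u u {u} (connectedOn_singleton H u) (by simp) (by simp)

theorem SpiderBound.union_biUnion_le {ι : Type*} (hs : SpiderBound H R w d h) (Y : Finset V)
    (C : Finset ι) (f : ι → Finset V) (hC : ∀ c ∈ C, (Y ∩ f c).Nonempty) :
    h (Y ∪ C.biUnion f) ≤ h Y + ∑ c ∈ C, h (f c) := by
  classical
  induction C using Finset.induction_on with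
  | empty => simp
  | insert c C hc ih =>
    have hrest := ih fun c' hc' => hC c' (mem_insert_of_mem hc')
    have hunion : Y ∪ (insert c C).biUnion f = (Y ∪ C.biUnion f) ∪ f c := by
      rw [biUnion_insert, union_comm (f c), union_assoc]
    have hmeet := hs.union_le (Y ∪ C.biUnion f) (f c)
      ((hC c (mem_insert_self _ _)).mono (inter_subset_inter_right subset_union_left))
    rw [hunion, sum_insert hc]
    omega

namespace Branching

theorem inter_subset (hb : Branching H R w h L K u C x P) {c : Finset V} (hc : c ∈ C) :
    c ∩ R ⊆ K ∩ R :=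
  inter_subset_inter_right ((hb.subset c hc).trans (erase_subset _ _))

theorem mem_inter (hb : Branching H R w h L K u C x P) {c : Finset V} (hc : c ∈ C) :
    x c ∈ K ∩ R :=
  hb.inter_subset hc (hb.lightPath c hc).terminal_mem

theorem notMem_path (hb : Branching H R w h L K u C x P) {c : Finset V} (hc : c ∈ C) : u ∉ P c :=
  fun hu => notMem_erase u K (hb.subset c hc ((hb.lightPath c hc).subset hu))

theorem dist_le (hb : Branching H R w h L K u C x P) (hs : SpiderBound H R w d h) {c : Finset V}
    (hc : c ∈ C) : d u (x c) ≤ ∑ v ∈ P c, w v := by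
  have hdist := hs.dist_le u (x c) (insert u (P c)) (hb.connected c hc) (mem_insert_self _ _)
    (mem_insert_of_mem (hb.lightPath c hc).mem)
  rw [sum_insert (hb.notMem_path hc)] at hdist
  omega

theorem injOn (hb : Branching H R w h L K u C x P) : Set.InjOn x C := by
  intro c hc c' hc' he
  by_contra hne
  have hx := (Finset.mem_inter.1 (hb.lightPath c hc).terminal_mem).1
  have hx' := (Finset.mem_inter.1 (hb.lightPath c' hc').terminal_mem).1
  exact Finset.disjoint_left.1 (hb.disjoint hc hc' hne) hx (he ▸ hx')

theorem sum_weight_le (hb : Branching H R w h L K u C x P) (hu : u ∈ K) :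
    w u + ∑ c ∈ C, ∑ v ∈ c, w v ≤ ∑ v ∈ K, w v := by
  have hsum : ∑ c ∈ C, ∑ v ∈ c, w v = ∑ v ∈ C.biUnion id, w v := (sum_biUnion hb.disjoint).symm
  rw [← add_sum_erase K w hu, hsum]
  exact Nat.add_le_add_left (sum_le_sum_of_subset (biUnion_subset.2 hb.subset)) _

theorem log_card_le (hb : Branching H R w h L K u C x P) (hL : Nat.log 2 (K ∩ R).card ≤ L)
    {c : Finset V} (hc : c ∈ C) : Nat.log 2 (c ∩ R).card ≤ L :=
  (Nat.log_mono_right (card_le_card (hb.inter_subset hc))).trans hL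

theorem measure_add_path_le (hb : Branching H R w h L K u C x P)
    (hL : Nat.log 2 (K ∩ R).card ≤ L) {c : Finset V} (hc : c ∈ C) :
    h (c ∩ R) + ∑ v ∈ P c, w v ≤ (L + 2) * ∑ v ∈ c, w v := by
  have hlog := hb.log_card_le hL hc
  have hone : 1 * ∑ v ∈ P c, w v ≤ (L + 1 - Nat.log 2 (c ∩ R).card) * ∑ v ∈ P c, w v :=
    Nat.mul_le_mul_right _ (by omega)
  have := (hb.lightPath c hc).bound
  omega

theorem image_union_biUnion (hb : Branching H R w h L K u C x P) (hu : u ∈ K) :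
    (C.image x ∪ {u} ∩ R) ∪ C.biUnion (fun c => c ∩ R) = K ∩ R := by
  refine Subset.antisymm (union_subset (union_subset (image_subset_iff.2 fun c hc => ?_) ?_)
    (biUnion_subset.2 fun c hc => hb.inter_subset hc)) fun z hz => ?_
  · exact hb.mem_inter hc
  · exact inter_subset_inter_right (singleton_subset_iff.2 hu)
  · have hzR := (Finset.mem_inter.1 hz).2
    rcases eq_or_ne z u with rfl | hzu
    · simp [hzR]
    · obtain ⟨c, hc, hzc⟩ := hb.cover z hz hzu
      exact mem_union_right _ (mem_biUnion.2 ⟨c, hc, Finset.mem_inter.2 ⟨hzc, hzR⟩⟩)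

/-- The spider has its center in the root, one foot in every piece and, if the root is a terminal,
one more foot in the root. -/
theorem measure_le (hb : Branching H R w h L K u C x P) (hs : SpiderBound H R w d h)
    (hK : ConnectedOn H K) (hu : u ∈ K) (hKR : (K ∩ R).Nonempty) :
    h (K ∩ R) ≤ w u + ∑ c ∈ C, (h (c ∩ R) + ∑ v ∈ P c, w v) := by
  set Y := C.image x ∪ {u} ∩ R with hY
  have hunion : Y ∪ C.biUnion (fun c => c ∩ R) = K ∩ R := hb.image_union_biUnion hu
  have hYK : Y ⊆ K ∩ R := hunion ▸ subset_union_left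
  have hYne : Y.Nonempty := by
    by_contra hempty
    rw [not_nonempty_iff_eq_empty, hY, union_eq_empty, image_eq_empty] at hempty
    simp [hY, hempty.1, hempty.2] at hunion
    exact hKR.ne_empty hunion.symm
  have hspider : h Y ≤ w u + ∑ y ∈ Y, d u y :=
    hs.spider_le u Y (hYK.trans inter_subset_right) hYne fun y hy =>
      (hK u hu y (Finset.mem_inter.1 (hYK hy)).1).mono (within_le _ _)
  have hlegs : ∑ y ∈ Y, d u y ≤ ∑ c ∈ C, ∑ v ∈ P c, w v := calc
    ∑ y ∈ Y, d u y ≤ ∑ y ∈ C.image x, d u y + ∑ y ∈ {u} ∩ R, d u y := by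
      rw [hY, ← sum_union_inter]
      exact Nat.le_add_right _ _
    _ = ∑ c ∈ C, d u (x c) := by
      rw [sum_image hb.injOn, sum_eq_zero (s := {u} ∩ R), add_zero]
      exact fun y hy => mem_singleton.1 (Finset.mem_inter.1 hy).1 ▸ hs.dist_self u
    _ ≤ ∑ c ∈ C, ∑ v ∈ P c, w v := sum_le_sum fun c hc => hb.dist_le hs hc
  have hjoin := hs.union_biUnion_le Y C (fun c => c ∩ R) fun c hc =>
    ⟨x c, Finset.mem_inter.2 ⟨mem_union_left _ (mem_image_of_mem _ hc),
      (hb.lightPath c hc).terminal_mem⟩⟩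
  rw [hunion] at hjoin
  rw [sum_add_distrib]
  omega

theorem inter_eq_of_eq_singleton {c : Finset V} (hb : Branching H R w h L K u {c} x P)
    (hu : u ∉ R) : K ∩ R = c ∩ R := by
  refine Subset.antisymm (fun z hz => ?_) (hb.inter_subset (mem_singleton_self c))
  have hzR := (Finset.mem_inter.1 hz).2
  obtain ⟨c', hc', hzc⟩ := hb.cover z hz fun e => hu (e ▸ hzR)
  exact Finset.mem_inter.2 ⟨mem_singleton.1 hc' ▸ hzc, hzR⟩

theorem log_card_lt (hb : Branching H R w h L K u C x P) {c c' : Finset V} (hc : c ∈ C)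
    (hc' : c' ∈ C) (hne : c ≠ c') (hle : (c ∩ R).card ≤ (c' ∩ R).card) :
    Nat.log 2 (c ∩ R).card < Nat.log 2 (K ∩ R).card := by
  have hdisj : Disjoint (c ∩ R) (c' ∩ R) :=
    Disjoint.mono inter_subset_left inter_subset_left (hb.disjoint hc hc' hne)
  have hcard := card_le_card (union_subset (hb.inter_subset hc) (hb.inter_subset hc'))
  rw [card_union_of_disjoint hdisj] at hcard
  rw [Nat.lt_iff_add_one_le,
    ← Nat.log_mul_base one_lt_two (card_pos.2 ⟨_, (hb.lightPath c hc).terminal_mem⟩).ne']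
  exact Nat.log_mono_right (by omega)

theorem lightPath_root (hb : Branching H R w h L K u C x P) (hs : SpiderBound H R w d h)
    (hK : ConnectedOn H K) (hu : u ∈ K) (huR : u ∈ R) (hL : Nat.log 2 (K ∩ R).card ≤ L) :
    LightPath R w h L K u {u} where
  terminal_mem := Finset.mem_inter.2 ⟨hu, huR⟩
  subset := singleton_subset_iff.2 hu
  mem := mem_singleton_self u
  bound := by
    have hzero := hs.weight_terminal u huR
    rw [sum_singleton, hzero, mul_zero, add_zero]
    calc h (K ∩ R) ≤ w u + ∑ c ∈ C, (h (c ∩ R) + ∑ v ∈ P c, w v) :=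
          hb.measure_le hs hK hu ⟨u, Finset.mem_inter.2 ⟨hu, huR⟩⟩
      _ ≤ 0 + ∑ c ∈ C, (L + 2) * ∑ v ∈ c, w v :=
          add_le_add hzero.le (sum_le_sum fun c hc => hb.measure_add_path_le hL hc)
      _ ≤ (L + 2) * ∑ v ∈ K, w v := by
          rw [zero_add, ← mul_sum]
          exact Nat.mul_le_mul_left _ (le_of_add_le_right (hb.sum_weight_le hu))

theorem lightPath_single {c : Finset V} (hb : Branching H R w h L K u {c} x P) (hu : u ∈ K)
    (huR : u ∉ R) : LightPath R w h L K (x c) (insert u (P c)) where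
  terminal_mem := hb.mem_inter (mem_singleton_self c)
  subset := insert_subset hu ((hb.lightPath c (mem_singleton_self c)).subset.trans
    ((hb.subset c (mem_singleton_self c)).trans (erase_subset _ _)))
  mem := mem_insert_of_mem (hb.lightPath c (mem_singleton_self c)).mem
  bound := by
    have hbound := (hb.lightPath c (mem_singleton_self c)).bound
    have hweight := Nat.mul_le_mul_left (L + 2) (hb.sum_weight_le hu)
    have hroot : (L + 1 - Nat.log 2 (c ∩ R).card) * w u ≤ (L + 2) * w u :=
      Nat.mul_le_mul_right _ (by omega)
    rw [hb.inter_eq_of_eq_singleton huR, sum_insert (hb.notMem_path (mem_singleton_self c))]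
    rw [sum_singleton] at hweight
    simp only [mul_add] at hweight ⊢
    omega

/-- The logarithm of the number of terminals drops by one from `K` to the piece `c`, so that the
light path of `c` is available once more: it is the leg of the spider in `c`. -/
theorem lightPath_of_log_card_lt (hb : Branching H R w h L K u C x P) (hs : SpiderBound H R w d h)
    (hK : ConnectedOn H K) (hu : u ∈ K) (hL : Nat.log 2 (K ∩ R).card ≤ L) {c : Finset V}
    (hc : c ∈ C) (hlog : Nat.log 2 (c ∩ R).card < Nat.log 2 (K ∩ R).card) :
    LightPath R w h L K (x c) (insert u (P c)) where
  terminal_mem := hb.mem_inter hc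
  subset := insert_subset hu
    ((hb.lightPath c hc).subset.trans ((hb.subset c hc).trans (erase_subset _ _)))
  mem := mem_insert_of_mem (hb.lightPath c hc).mem
  bound := by
    have hmeasure := hb.measure_le hs hK hu ⟨_, hb.mem_inter hc⟩
    have hrest : ∑ b ∈ C.erase c, (h (b ∩ R) + ∑ v ∈ P b, w v) ≤
        ∑ b ∈ C.erase c, (L + 2) * ∑ v ∈ b, w v :=
      sum_le_sum fun b hb' => hb.measure_add_path_le hL (mem_of_mem_erase hb')
    have hpiece := (hb.lightPath c hc).bound
    have hweight := Nat.mul_le_mul_left (L + 2) (hb.sum_weight_le hu)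
    have hpath : (L + 1 - Nat.log 2 (K ∩ R).card + 1) * ∑ v ∈ P c, w v ≤
        (L + 1 - Nat.log 2 (c ∩ R).card) * ∑ v ∈ P c, w v :=
      Nat.mul_le_mul_right _ (by omega)
    have hroot : (L + 1 - Nat.log 2 (K ∩ R).card + 1) * w u ≤ (L + 2) * w u :=
      Nat.mul_le_mul_right _ (by omega)
    rw [sum_insert (hb.notMem_path hc)]
    rw [← mul_sum] at hrest
    rw [← add_sum_erase C _ hc] at hmeasure hweight
    generalize L + 1 - Nat.log 2 (K ∩ R).card = k at *
    simp only [mul_add, add_mul, one_mul] at *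
    omega

theorem exists_lightPath (hb : Branching H R w h L K u C x P) (hs : SpiderBound H R w d h)
    (hK : ConnectedOn H K) (hu : u ∈ K) (hKR : (K ∩ R).Nonempty)
    (hL : Nat.log 2 (K ∩ R).card ≤ L) :
    ∃ x P, LightPath R w h L K x P ∧ ConnectedOn H P ∧ u ∈ P := by
  by_cases huR : u ∈ R
  · exact ⟨u, {u}, hb.lightPath_root hs hK hu huR hL, connectedOn_singleton H u, by simp⟩
  obtain ⟨z, hz⟩ := hKR
  obtain ⟨b, hbC, -⟩ := hb.cover z hz fun e => huR (e ▸ (Finset.mem_inter.1 hz).2)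
  obtain ⟨c, hc, hmin⟩ := exists_min_image C (fun c => (c ∩ R).card) ⟨b, hbC⟩
  refine ⟨x c, insert u (P c), ?_, hb.connected c hc, mem_insert_self _ _⟩
  by_cases hother : ∃ c' ∈ C, c ≠ c'
  · obtain ⟨c', hc', hne⟩ := hother
    exact hb.lightPath_of_log_card_lt hs hK hu hL hc (hb.log_card_lt hc hc' hne (hmin c' hc'))
  · push Not at hother
    obtain rfl := eq_singleton_iff_unique_mem.2 ⟨hc, fun c' hc' => (hother c' hc').symm⟩
    exact hb.lightPath_single hu huR

end Branching

theorem pairwiseDisjoint_image_component (H : SimpleGraph V) (M A : Finset V) :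
    (A.image (component H M) : Set (Finset V)).PairwiseDisjoint id := by
  intro c hc c' hc' hne
  obtain ⟨x, -, rfl⟩ := mem_image.1 hc
  obtain ⟨x', -, rfl⟩ := mem_image.1 hc'
  exact Finset.disjoint_left.2 fun z hz hz' => hne (component_eq_of_mem hz hz')

/-- The path descends from `u` to a component of the rest of `K` with the fewest terminals. -/
theorem SpiderBound.exists_lightPath (hs : SpiderBound H R w d h) (hK : ConnectedOn H K)
    (hu : u ∈ K) (hKR : (K ∩ R).Nonempty) (hL : Nat.log 2 (K ∩ R).card ≤ L) :
    ∃ x P, LightPath R w h L K x P ∧ ConnectedOn H P ∧ u ∈ P := by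
  induction hn : K.card using Nat.strong_induction_on generalizing K u with
  | _ n ih =>
  subst hn
  set C := (K.erase u ∩ R).image (component H (K.erase u))
  have hCsub : ∀ c ∈ C, c ⊆ K.erase u :=
    forall_mem_image.2 fun _ _ => component_subset _ _ _
  have hchild : ∀ c ∈ C, ∃ x P, LightPath R w h L c x P ∧ ConnectedOn H (insert u P) := by
    refine forall_mem_image.2 fun x hx => ?_
    obtain ⟨hxM, hxR⟩ := mem_inter.1 hx
    obtain ⟨hxu, hxK⟩ := mem_erase.1 hxM
    obtain ⟨z, hz, huz⟩ := exists_adj_mem_component_erase (hK x hxK u hu) hxu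
    have hsub := component_subset H (K.erase u) x
    obtain ⟨y, P, hP, hPc, hzP⟩ := ih _ ((card_le_card hsub).trans_lt (card_erase_lt_of_mem hu))
      (connectedOn_component H _ x) hz ⟨x, mem_inter.2 ⟨mem_component_self hxM, hxR⟩⟩
      ((Nat.log_mono_right (card_le_card (inter_subset_inter_right
        (hsub.trans (erase_subset _ _))))).trans hL) rfl
    exact ⟨y, P, hP, hPc.insert hzP huz⟩
  have : Nonempty V := ⟨u⟩
  choose! x P hP hconn using hchild
  have hb : Branching H R w h L K u C x P :=
    { subset := hCsub
      disjoint := pairwiseDisjoint_image_component _ _ _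
      cover := fun z hz hzu => by
        obtain ⟨hzK, hzR⟩ := mem_inter.1 hz
        have hzM := mem_erase.2 ⟨hzu, hzK⟩
        exact ⟨_, mem_image_of_mem _ (mem_inter.2 ⟨hzM, hzR⟩), mem_component_self hzM⟩
      lightPath := hP
      connected := hconn }
  exact hb.exists_lightPath hs hK hu hKR hL

theorem SpiderBound.measure_le_log_mul (hs : SpiderBound H R w d h) (hK : ConnectedOn H K)
    (hKR : (K ∩ R).Nonempty) (hL : Nat.log 2 R.card ≤ L) :
    h (K ∩ R) ≤ (L + 2) * ∑ v ∈ K, w v := by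
  obtain ⟨u, hu⟩ := id hKR
  obtain ⟨x, P, hP, -⟩ := hs.exists_lightPath hK (mem_inter.1 hu).1 hKR
    ((Nat.log_mono_right (card_le_card inter_subset_right)).trans hL)
  exact le_of_add_le_left hP.bound

end Spiders

section NodeDistance

variable {V : Type*} {H : SimpleGraph V} {w : V → ℕ} {v y : V} {P : Finset V}

/-- The least weight of a connected set containing `v` and `y`, without the weight of `v`; it is `0`
if there is no such set. -/
noncomputable def nodeDist (H : SimpleGraph V) (w : V → ℕ) (v y : V) : ℕ :=
  sInf {k | ∃ P, ConnectedOn H P ∧ v ∈ P ∧ y ∈ P ∧ ∑ x ∈ P, w x = w v + k}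

theorem add_nodeDist_le (hP : ConnectedOn H P) (hv : v ∈ P) (hy : y ∈ P) :
    w v + nodeDist H w v y ≤ ∑ x ∈ P, w x := by
  have hle : w v ≤ ∑ x ∈ P, w x := single_le_sum (fun _ _ => Nat.zero_le _) hv
  have hdist : nodeDist H w v y ≤ ∑ x ∈ P, w x - w v :=
    Nat.sInf_le ⟨P, hP, hv, hy, by omega⟩
  omega

theorem eq_nodeDist_of_le {k : ℕ} (hP : ConnectedOn H P) (hv : v ∈ P) (hy : y ∈ P)
    (hk : ∑ x ∈ P, w x ≤ w v + k)
    (hmin : ∀ Q, ConnectedOn H Q → v ∈ Q → y ∈ Q → w v + k ≤ ∑ x ∈ Q, w x) :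
    k = nodeDist H w v y := by
  have hle := add_nodeDist_le (w := w) hP hv hy
  obtain ⟨Q, hQ, hvQ, hyQ, he⟩ :=
    Nat.sInf_mem (s := {k | ∃ P, ConnectedOn H P ∧ v ∈ P ∧ y ∈ P ∧ ∑ x ∈ P, w x = w v + k})
      ⟨_, P, hP, hv, hy, (Nat.add_sub_of_le (by omega)).symm⟩
  have hQk := hmin Q hQ hvQ hyQ
  change ∑ x ∈ Q, w x = w v + nodeDist H w v y at he
  omega

end NodeDistance

section EdgeDeletion

variable {V : Type*} {G H : SimpleGraph V} {M R B : Finset V} {x y a b : V}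

theorem reachable_deleteEdges_or (h : H.Reachable a y) :
    (H.deleteEdges {s(a, b)}).Reachable a y ∨ (H.deleteEdges {s(a, b)}).Reachable b y := by
  obtain ⟨p⟩ := h.symm
  clear h
  induction p with
  | nil => exact .inl .rfl
  | @cons y z c hyz _ ih =>
    by_cases he : s(y, z) = s(c, b)
    · rcases Sym2.eq_iff.1 he with ⟨rfl, -⟩ | ⟨rfl, -⟩
      · exact .inl .rfl
      · exact .inr .rfl
    · have hzy : (H.deleteEdges {s(c, b)}).Reachable z y :=
        (deleteEdges_adj.2 ⟨hyz, he⟩ : (H.deleteEdges {s(c, b)}).Adj y z).symm.reachable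
      exact ih.imp (·.trans hzy) (·.trans hzy)

theorem reachable_within_deleteEdges {e : Sym2 V} (hH : H ≤ G) (p : (within H M).Walk x y)
    (hp : e ∉ p.edges) : (within (G.deleteEdges {e}) M).Reachable x y := by
  induction p with
  | nil => rfl
  | @cons x z y h p ih =>
    simp only [Walk.edges_cons, List.mem_cons, not_or] at hp
    have hadj : (within (G.deleteEdges {e}) M).Adj x z :=
      ⟨deleteEdges_adj.2 ⟨hH h.1, fun h' => hp.1 h'.symm⟩, h.2⟩
    exact hadj.reachable.trans (ih hp.2)

/-- A path to `x` that avoids one edge stays among the vertices with property `hB`: if deleting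
another edge cuts one of its vertices off from the start, then that edge lies on the first part of
the path, and the vertex is still connected to `x` by the second part. -/
theorem reachable_within_of_forall_reachable
    (hB : ∀ x, x ∈ B ↔ ∀ a b, ∀ r ∈ R, (within (G.deleteEdges {s(a, b)}) M).Reachable r x)
    (hRB : R ⊆ B) {r : V} (hr : r ∈ R) (hx : x ∈ B) (a b : V) :
    (within (G.deleteEdges {s(a, b)}) B).Reachable r x := by
  classical
  obtain ⟨p, hp⟩ := ((hB x).1 hx a b r hr).exists_isPath
  refine reachable_within_of_support p fun z hz => (hB z).2 fun a' b' r' hr' => ?_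
  refine ((hB r).1 (hRB hr) a' b' r' hr').trans ?_
  have hle : G.deleteEdges {s(a, b)} ≤ G := deleteEdges_le _
  have hnodup := hp.isTrail.edges_nodup
  rw [← p.take_spec hz, Walk.edges_append] at hnodup
  by_cases htake : s(a', b') ∈ (p.takeUntil z hz).edges
  · have hdrop : s(a', b') ∉ (p.dropUntil z hz).edges := fun hdrop =>
      (List.nodup_append.1 hnodup).2.2 _ htake _ hdrop rfl
    exact ((hB x).1 hx a' b' r hr).trans
      (reachable_within_deleteEdges hle (p.dropUntil z hz) hdrop).symm
  · exact reachable_within_deleteEdges hle (p.takeUntil z hz) htake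

theorem reachable_induce_iff {K : Finset V} {x y : (K : Set V)} :
    (H.induce (K : Set V)).Reachable x y ↔ (within H K).Reachable x y := by
  constructor
  · exact fun h => h.map (G' := within H K) ⟨Subtype.val, fun {a b} h => ⟨h, a.2, b.2⟩⟩
  · suffices key : ∀ x y : V, (within H K).Walk x y → ∀ (hx : x ∈ (K : Set V))
        (hy : y ∈ (K : Set V)), (H.induce (K : Set V)).Reachable ⟨x, hx⟩ ⟨y, hy⟩ from
      fun ⟨p⟩ => key x y p x.2 y.2
    intro x y p hx hy
    induction p with
    | nil => rfl
    | @cons x z y h _ ih =>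
      have hadj : (H.induce (K : Set V)).Adj ⟨x, hx⟩ ⟨z, h.2.2⟩ := h.1
      exact hadj.reachable.trans (ih h.2.2 hy)

theorem isEdgeConnected_two_induce_iff {K : Finset V} :
    (G.induce (K : Set V)).IsEdgeConnected 2 ↔
      ∀ a ∈ K, ∀ b ∈ K, ConnectedOn (G.deleteEdges {s(a, b)}) K := by
  have hdelete : ∀ a b : (K : Set V), (G.induce (K : Set V)).deleteEdges {s(a, b)} =
      (G.deleteEdges {s(a.1, b.1)}).induce (K : Set V) := by
    intro a b
    ext x y
    simp only [deleteEdges_adj, comap_adj, Function.Embedding.subtype_apply,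
      Set.mem_singleton_iff, Sym2.eq_iff, Subtype.ext_iff]
  rw [isEdgeConnected_two]
  constructor
  · intro h a ha b hb x hx y hy
    have hxy := h s(⟨a, ha⟩, ⟨b, hb⟩) ⟨x, hx⟩ ⟨y, hy⟩
    rwa [hdelete, reachable_induce_iff] at hxy
  · intro h e
    induction e using Sym2.ind with
    | _ a b =>
      intro x y
      rw [hdelete, reachable_induce_iff]
      exact h a a.2 b b.2 x x.2 y y.2

end EdgeDeletion

end Steiner

/-! ### Coverage of tree edges -/

namespace NWSTAP

open Finset SimpleGraph Steiner

section Coverage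

variable (I : NWSTAP)

/-- The graph without the edges of the tree. -/
def links : SimpleGraph (Fin I.n) := I.G \ I.T.spanningCoe

/-- The ends of the edge `ab` are connected in `G[M]` without it. For a tree edge and `R ⊆ M` this
says that `ab` is not a bridge of `G[M]`. -/
def Covers (M : Finset (Fin I.n)) (a b : Fin I.n) : Prop :=
  (within (I.G.deleteEdges {s(a, b)}) M).Reachable a b

/-- The vertex `y` is on the side of `a` when the edge `ab` is removed from the tree. -/
def Side (a b y : Fin I.n) : Prop :=
  (I.T.spanningCoe.deleteEdges {s(a, b)}).Reachable a y

/-- The set `Y` has vertices on both sides of the edge `ab` of the tree. -/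
def Crosses (a b : Fin I.n) (Y : Finset (Fin I.n)) : Prop :=
  (∃ y ∈ Y, I.Side a b y) ∧ ∃ y ∈ Y, ¬ I.Side a b y

open Classical in
/-- The tree edges covered by `M`; every edge occurs in both orientations. -/
noncomputable def covered (M : Finset (Fin I.n)) : Finset (Fin I.n × Fin I.n) :=
  {p | I.T.Adj p.1 p.2 ∧ I.Covers M p.1 p.2}

open Classical in
/-- The tree edges not covered by `M`; every edge occurs in both orientations. -/
noncomputable def uncovered (M : Finset (Fin I.n)) : Finset (Fin I.n × Fin I.n) :=
  {p | I.T.Adj p.1 p.2 ∧ ¬ I.Covers M p.1 p.2}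

open Classical in
/-- The tree edges that are crossed by `Y` and not covered by `M`. -/
noncomputable def crossed (M Y : Finset (Fin I.n)) : Finset (Fin I.n × Fin I.n) :=
  {p ∈ I.uncovered M | I.Crosses p.1 p.2 Y}

variable {I} {M M' Q Y : Finset (Fin I.n)} {a b r y z : Fin I.n} {p : Fin I.n × Fin I.n}

theorem links_adj : I.links.Adj a b ↔ I.G.Adj a b ∧ ¬ I.T.Adj a b := by
  simp [links]

theorem mem_covered : p ∈ I.covered M ↔ I.T.Adj p.1 p.2 ∧ I.Covers M p.1 p.2 := by
  simp [covered]

theorem mem_uncovered : p ∈ I.uncovered M ↔ I.T.Adj p.1 p.2 ∧ ¬ I.Covers M p.1 p.2 := by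
  simp [uncovered]

theorem mem_crossed : p ∈ I.crossed M Y ↔ p ∈ I.uncovered M ∧ I.Crosses p.1 p.2 Y := by
  simp [crossed]

theorem mem_R_of_adj (h : I.T.Adj a b) : a ∈ I.R := by
  rw [← mem_coe, ← I.verts_T]
  exact h.fst_mem

theorem reachable_tree (ha : a ∈ I.R) (hb : b ∈ I.R) : I.T.spanningCoe.Reachable a b := by
  rw [← mem_coe, ← I.verts_T] at ha hb
  exact (I.isTree_T.connected.preconnected ⟨a, ha⟩ ⟨b, hb⟩).map ⟨Subtype.val, fun h => h⟩

theorem R_nonempty : I.R.Nonempty := by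
  obtain ⟨⟨x, hx⟩⟩ := I.isTree_T.connected.nonempty
  rw [I.verts_T] at hx
  exact ⟨x, hx⟩

theorem side_or (hab : I.T.Adj a b) (hy : y ∈ I.R) : I.Side a b y ∨ I.Side b a y := by
  have := reachable_deleteEdges_or (b := b) (reachable_tree (mem_R_of_adj hab) hy)
  rwa [Side, Side, Sym2.eq_swap (a := b)]

theorem not_side_self (hab : I.T.Adj a b) : ¬ I.Side a b b := by
  have hbridge : I.T.coe.IsBridge s(⟨a, hab.fst_mem⟩, ⟨b, hab.snd_mem⟩) :=
    isAcyclic_iff_forall_adj_isBridge.1 I.isTree_T.isAcyclic hab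
  suffices key : ∀ x y : Fin I.n, (I.T.spanningCoe.deleteEdges {s(a, b)}).Walk x y →
      ∀ (hx : x ∈ I.T.verts) (hy : y ∈ I.T.verts), (I.T.coe.deleteEdges
        {s(⟨a, hab.fst_mem⟩, ⟨b, hab.snd_mem⟩)}).Reachable ⟨x, hx⟩ ⟨y, hy⟩ from
    fun ⟨p⟩ => hbridge (key a b p hab.fst_mem hab.snd_mem)
  intro x y p hx hy
  induction p with
  | nil => rfl
  | @cons x z y h _ ih =>
    obtain ⟨hT, he⟩ := deleteEdges_adj.1 h
    rw [Subgraph.spanningCoe_adj] at hT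
    refine Reachable.trans (Adj.reachable (deleteEdges_adj.2 ⟨?_, fun h' => he ?_⟩))
      (ih hT.snd_mem hy)
    · exact hT
    · simpa [Sym2.eq_iff, Subtype.ext_iff] using h'

theorem tree_le_within (hM : I.R ⊆ M) (a b : Fin I.n) :
    I.T.spanningCoe.deleteEdges {s(a, b)} ≤ within (I.G.deleteEdges {s(a, b)}) M := by
  intro x y h
  obtain ⟨hT, he⟩ := deleteEdges_adj.1 h
  rw [Subgraph.spanningCoe_adj] at hT
  exact ⟨deleteEdges_adj.2 ⟨hT.adj_sub, he⟩, hM (mem_R_of_adj hT), hM (mem_R_of_adj hT.symm)⟩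

theorem links_le_deleteEdges (hab : I.T.Adj a b) : I.links ≤ I.G.deleteEdges {s(a, b)} := by
  intro x y h
  obtain ⟨hG, hT⟩ := links_adj.1 h
  refine deleteEdges_adj.2 ⟨hG, fun he => hT ?_⟩
  rcases Sym2.eq_iff.1 he with ⟨rfl, rfl⟩ | ⟨rfl, rfl⟩
  · exact hab
  · exact hab.symm

theorem covers_of_side (hab : I.T.Adj a b) (hM : I.R ⊆ M) (hr : I.Side a b r)
    (hy : I.Side b a y) (h : (within I.links M).Reachable r y) : I.Covers M a b := by
  have har := hr.mono (tree_le_within hM a b)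
  have hby := hy.mono (tree_le_within hM b a)
  rw [Sym2.eq_swap (a := b)] at hby
  exact (har.trans (h.mono (within_mono (links_le_deleteEdges hab) subset_rfl))).trans hby.symm

theorem covers_of_crosses (hab : I.T.Adj a b) (hM : I.R ⊆ M) (hr : r ∈ I.R) (hy : y ∈ I.R)
    (hc : I.Crosses a b {r, y}) (h : (within I.links M).Reachable r y) : I.Covers M a b := by
  have hside : ∀ z ∈ I.R, ¬ I.Side a b z → I.Side b a z := fun z hz =>
    (side_or hab hz).resolve_left
  obtain ⟨⟨y₁, hy₁, hs₁⟩, y₂, hy₂, hs₂⟩ := hc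
  simp only [mem_insert, mem_singleton] at hy₁ hy₂
  rcases hy₁ with rfl | rfl <;> rcases hy₂ with rfl | rfl
  · exact absurd hs₁ hs₂
  · exact covers_of_side hab hM hs₁ (hside _ hy hs₂) h
  · exact covers_of_side hab hM hs₁ (hside _ hr hs₂) h.symm
  · exact absurd hs₁ hs₂

theorem Covers.mono (h : I.Covers M a b) (hM : M ⊆ M') : I.Covers M' a b :=
  Reachable.mono (within_mono le_rfl hM) h

theorem covered_mono (hM : M ⊆ M') : I.covered M ⊆ I.covered M' := fun p hp => by
  rw [mem_covered] at hp ⊢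
  exact ⟨hp.1, hp.2.mono hM⟩

theorem uncovered_anti (hM : M ⊆ M') : I.uncovered M' ⊆ I.uncovered M := fun p hp => by
  rw [mem_uncovered] at hp ⊢
  exact ⟨hp.1, fun h => hp.2 (h.mono hM)⟩

theorem crossed_anti (hM : M ⊆ M') : I.crossed M' Y ⊆ I.crossed M Y := fun p hp => by
  rw [mem_crossed] at hp ⊢
  exact ⟨uncovered_anti hM hp.1, hp.2⟩

theorem card_crossed_le_add (hM : M ⊆ Q) :
    #(I.crossed M Y) ≤ #(I.crossed Q Y) + (#(I.covered Q) - #(I.covered M)) := by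
  have hsub : I.crossed M Y ⊆ I.crossed Q Y ∪ (I.covered Q \ I.covered M) := fun p hp => by
    simp only [mem_union, mem_sdiff, mem_crossed, mem_covered, mem_uncovered] at hp ⊢
    tauto
  rw [← card_sdiff_of_subset (covered_mono hM)]
  exact (card_le_card hsub).trans (card_union_le _ _)

theorem crossed_pair_eq_empty (hM : I.R ⊆ M) (hr : r ∈ I.R) (hy : y ∈ I.R)
    (h : (within I.links M).Reachable r y) : I.crossed M {r, y} = ∅ := by
  refine eq_empty_of_forall_notMem fun p hp => ?_
  obtain ⟨hp, hc⟩ := mem_crossed.1 hp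
  obtain ⟨hab, hn⟩ := mem_uncovered.1 hp
  exact hn (covers_of_crosses hab hM hr hy hc h)

theorem card_crossed_pair_le (hMQ : M ⊆ Q) (hM : I.R ⊆ M) (hr : r ∈ I.R) (hy : y ∈ I.R)
    (h : (within I.links Q).Reachable r y) :
    #(I.crossed M {r, y}) ≤ #(I.covered Q) - #(I.covered M) := by
  have hle := card_crossed_le_add (Y := {r, y}) hMQ
  rwa [crossed_pair_eq_empty (hM.trans hMQ) hr hy h, card_empty, zero_add] at hle

theorem Crosses.exists_pair (h : I.Crosses a b Y) (z : Fin I.n) :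
    ∃ y ∈ Y, y ≠ z ∧ I.Crosses a b {z, y} := by
  obtain ⟨⟨y₁, hy₁, hs₁⟩, y₂, hy₂, hs₂⟩ := h
  by_cases hz : I.Side a b z
  · exact ⟨y₂, hy₂, fun e => hs₂ (e ▸ hz), ⟨z, by simp, hz⟩, y₂, by simp, hs₂⟩
  · exact ⟨y₁, hy₁, fun e => hz (e ▸ hs₁), ⟨y₁, by simp, hs₁⟩, z, by simp, hz⟩

theorem Crosses.superset {X : Finset (Fin I.n)} (h : I.Crosses a b X) (hXY : X ⊆ Y) :
    I.Crosses a b Y :=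
  ⟨h.1.imp fun _ hy => ⟨hXY hy.1, hy.2⟩, h.2.imp fun _ hy => ⟨hXY hy.1, hy.2⟩⟩

theorem card_crossed_le_sum (M Y : Finset (Fin I.n)) (r : Fin I.n) :
    #(I.crossed M Y) ≤ ∑ y ∈ Y.erase r, #(I.crossed M {r, y}) := by
  have hsub : I.crossed M Y ⊆ (Y.erase r).biUnion fun y => I.crossed M {r, y} := fun p hp => by
    obtain ⟨hp, hc⟩ := mem_crossed.1 hp
    obtain ⟨y, hy, hne, hcy⟩ := hc.exists_pair r
    exact mem_biUnion.2 ⟨y, mem_erase.2 ⟨hne, hy⟩, mem_crossed.2 ⟨hp, hcy⟩⟩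
  exact (card_le_card hsub).trans card_biUnion_le

theorem card_crossed_union_le (M X Y : Finset (Fin I.n)) (h : (X ∩ Y).Nonempty) :
    #(I.crossed M (X ∪ Y)) ≤ #(I.crossed M X) + #(I.crossed M Y) := by
  obtain ⟨z, hz⟩ := h
  obtain ⟨hzX, hzY⟩ := mem_inter.1 hz
  have hsub : I.crossed M (X ∪ Y) ⊆ I.crossed M X ∪ I.crossed M Y := fun p hp => by
    obtain ⟨hp, hc⟩ := mem_crossed.1 hp
    obtain ⟨y, hy, -, hcy⟩ := hc.exists_pair z
    rcases mem_union.1 hy with hy | hy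
    · exact mem_union_left _ (mem_crossed.2 ⟨hp, hcy.superset (by simp [insert_subset_iff, *])⟩)
    · exact mem_union_right _ (mem_crossed.2 ⟨hp, hcy.superset (by simp [insert_subset_iff, *])⟩)
  exact (card_le_card hsub).trans (card_union_le _ _)

/-- Along a walk from `a` to `b` in `G[M]` without the edge `ab`, the last terminal joined to the
current vertex by links stays on the side of `a` as long as no crossing occurs. -/
theorem Covers.exists_crossing (hab : I.T.Adj a b) (hc : I.Covers M a b) :
    ∃ y ∈ I.R, ∃ y' ∈ I.R, I.Side a b y ∧ ¬ I.Side a b y' ∧ (within I.links M).Reachable y y' := by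
  by_contra! hcon
  obtain ⟨p⟩ := hc
  suffices key : ∀ x z : Fin I.n, (within (I.G.deleteEdges {s(a, b)}) M).Walk x z →
      (∃ y ∈ I.R, I.Side a b y ∧ (within I.links M).Reachable y x) →
      ∃ y ∈ I.R, I.Side a b y ∧ (within I.links M).Reachable y z by
    obtain ⟨y, hy, hs, h⟩ := key a b p ⟨a, mem_R_of_adj hab, .rfl, .rfl⟩
    exact hcon y hy b (mem_R_of_adj hab.symm) hs (not_side_self hab) h
  intro x z p
  induction p with
  | nil => exact id
  | @cons x t z h _ ih =>
    rintro ⟨y, hy, hs, hyx⟩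
    refine ih ?_
    obtain ⟨hG, he⟩ := deleteEdges_adj.1 h.1
    by_cases hT : I.T.Adj x t
    · have hx : I.Side a b x := by
        by_contra hx
        exact hcon y hy x (mem_R_of_adj hT) hs hx hyx
      have hadj : (I.T.spanningCoe.deleteEdges {s(a, b)}).Adj x t := deleteEdges_adj.2 ⟨hT, he⟩
      exact ⟨t, mem_R_of_adj hT.symm, hx.trans hadj.reachable, .rfl⟩
    · have hadj : (within I.links M).Adj x t := ⟨links_adj.2 ⟨hG, hT⟩, h.2⟩
      exact ⟨y, hy, hs, hyx.trans hadj.reachable⟩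

theorem not_covers_empty (hab : I.T.Adj a b) : ¬ I.Covers ∅ a b := by
  rintro ⟨p⟩
  cases p with
  | nil => exact I.T.loopless.irrefl _ hab
  | cons h _ => exact notMem_empty _ h.2.1

theorem card_covered_add_card_uncovered (M : Finset (Fin I.n)) :
    #(I.covered M) + #(I.uncovered M) = #(I.uncovered ∅) := by
  rw [← card_union_of_disjoint]
  · congr 1
    ext p
    simp only [mem_union, mem_covered, mem_uncovered]
    have := @not_covers_empty I p.1 p.2
    tauto
  · refine Finset.disjoint_left.2 fun p hp hp' => ?_
    exact (mem_uncovered.1 hp').2 (mem_covered.1 hp).2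

theorem card_uncovered_le (M : Finset (Fin I.n)) : #(I.uncovered M) ≤ #I.R ^ 2 := by
  rw [sq, ← card_product]
  refine card_le_card fun p hp => ?_
  obtain ⟨hab, -⟩ := mem_uncovered.1 hp
  exact mem_product.2 ⟨mem_R_of_adj hab, mem_R_of_adj hab.symm⟩

theorem uncovered_eq_empty_of_card_le_one (hR : #I.R ≤ 1) : I.uncovered M = ∅ := by
  refine eq_empty_of_forall_notMem fun p hp => ?_
  obtain ⟨hab, -⟩ := mem_uncovered.1 hp
  exact hab.ne (card_le_one.1 hR _ (mem_R_of_adj hab) _ (mem_R_of_adj hab.symm))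

theorem covers_of_uncovered_eq_empty (h : I.uncovered M = ∅) (hab : I.T.Adj a b) :
    I.Covers M a b := by
  by_contra hc
  exact notMem_empty (a, b) (h ▸ mem_uncovered.2 ⟨hab, hc⟩)

end Coverage

section Feasibility

variable {I : NWSTAP} {M S A : Finset (Fin I.n)} {a b : Fin I.n}

theorem Feasible.covers (hS : I.Feasible S) (hab : I.T.Adj a b) : I.Covers (I.R ∪ S) a b :=
  have ha := mem_union_left S (mem_R_of_adj hab)
  have hb := mem_union_left S (mem_R_of_adj hab.symm)
  isEdgeConnected_two_induce_iff.1 hS.2 a ha b hb a ha b hb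

theorem reachable_within_of_covers (hM : I.R ⊆ M) (hcov : ∀ a b, I.T.Adj a b → I.Covers M a b)
    (a b : Fin I.n) {r x : Fin I.n} (hr : r ∈ I.R) (hx : x ∈ I.R) :
    (within (I.G.deleteEdges {s(a, b)}) M).Reachable r x := by
  obtain ⟨p⟩ := reachable_tree hr hx
  induction p with
  | nil => rfl
  | @cons x z y h p ih =>
    rw [Subgraph.spanningCoe_adj] at h
    refine Reachable.trans ?_ (ih (mem_R_of_adj h.symm) hx)
    by_cases he : s(x, z) = s(a, b)
    · exact he ▸ hcov x z h
    · exact Adj.reachable ⟨deleteEdges_adj.2 ⟨h.adj_sub, he⟩, hM (mem_R_of_adj h),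
        hM (mem_R_of_adj h.symm)⟩

theorem feasible_of_covers (hM : I.R ⊆ M) (hcov : ∀ a b, I.T.Adj a b → I.Covers M a b)
    (hA : ∀ x, x ∈ A ↔ x ∉ I.R ∧
      ∀ a b, ∀ r ∈ I.R, (within (I.G.deleteEdges {s(a, b)}) M).Reachable r x) :
    I.Feasible A := by
  have hB : ∀ x, x ∈ I.R ∪ A ↔
      ∀ a b, ∀ r ∈ I.R, (within (I.G.deleteEdges {s(a, b)}) M).Reachable r x := by
    intro x
    have hR : x ∈ I.R → ∀ a b, ∀ r ∈ I.R, (within (I.G.deleteEdges {s(a, b)}) M).Reachable r x :=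
      fun hx a b r hr => reachable_within_of_covers hM hcov a b hr hx
    rw [mem_union, hA]
    tauto
  obtain ⟨r, hr⟩ := I.R_nonempty
  refine ⟨Finset.disjoint_left.2 fun x hx => ((hA x).1 hx).1,
    isEdgeConnected_two_induce_iff.2 fun a _ b _ => .of_root r fun x hx => ?_⟩
  exact reachable_within_of_forall_reachable hB subset_union_left hr hx a b

end Feasibility

end NWSTAP

/-! ### Rounds with doubling thresholds -/

namespace Steiner

open Finset

section Thresholds

theorem harmonic_mono : Monotone harmonic :=
  monotone_nat_of_le_succ fun n => by
    rw [harmonic_succ]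
    exact le_add_of_nonneg_right (by positivity)

theorem sub_le_mul_harmonic_sub {a b : ℕ} (h : b ≤ a) :
    (a : ℚ) - b ≤ a * (harmonic a - harmonic b) := by
  induction a, h using Nat.le_induction with
  | base => simp
  | succ a hab ih =>
    have hmono : 0 ≤ harmonic a - harmonic b := sub_nonneg.2 (harmonic_mono hab)
    have hcancel : ((a : ℚ) + 1) * ((a : ℚ) + 1)⁻¹ = 1 := mul_inv_cancel₀ (by positivity)
    rw [harmonic_succ]
    push_cast
    linarith

/-- Rounds with thresholds `1, 2, 4, …, 2 ^ (B - 1)`. Round `k` starts with `u k` uncovered elements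
and accumulated cost `W k`, pays at most twice the threshold per newly covered element, and leaves
at most `β` divided by the threshold uncovered. -/
structure DoublingRounds (u W : ℕ → ℕ) (β B : ℕ) : Prop where
  uncovered_le : ∀ k < B, u (k + 1) ≤ u k
  cost_zero : W 0 = 0
  cost_le : ∀ k < B, W (k + 1) ≤ W k + 2 * 2 ^ k * (u k - u (k + 1))
  mul_uncovered_le : ∀ k < B, 2 ^ k * u (k + 1) ≤ β

variable {u W : ℕ → ℕ} {β B : ℕ}

theorem DoublingRounds.uncovered_eq_zero (h : DoublingRounds u W β (B + 1)) (hβ : β < 2 ^ B) :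
    u (B + 1) = 0 := by
  by_contra hne
  have hle := h.mul_uncovered_le B (Nat.lt_succ_self B)
  have hone : 2 ^ B * 1 ≤ 2 ^ B * u (B + 1) := Nat.mul_le_mul_left _ (by omega)
  omega

/-- The elements covered in round `k + 1` number at most `u (k + 1)` times the drop of the harmonic
number, and they cost at most `4 * 2 ^ k` each, while `2 ^ k * u (k + 1) ≤ β`. -/
theorem DoublingRounds.cost_le_harmonic_sub (h : DoublingRounds u W β B) {k : ℕ} (hk : k < B) :
    (W (k + 1) : ℚ) ≤ 2 * u 0 + 4 * β * (harmonic (u 0) - harmonic (u (k + 1))) := by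
  induction k with
  | zero =>
    have hcost := h.cost_le 0 hk
    have hnonneg : (0 : ℚ) ≤ 4 * β * (harmonic (u 0) - harmonic (u 1)) :=
      mul_nonneg (by positivity) (sub_nonneg.2 (harmonic_mono (h.uncovered_le 0 hk)))
    have hfirst : W 1 ≤ 2 * u 0 := by
      simp only [zero_add, h.cost_zero, pow_zero] at hcost
      omega
    exact le_add_of_le_of_nonneg (mod_cast hfirst) hnonneg
  | succ k ih =>
    have hu := h.uncovered_le (k + 1) hk
    have hcost : (W (k + 2) : ℚ) ≤ W (k + 1) + 2 * 2 ^ (k + 1) * (u (k + 1) - u (k + 2)) := by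
      rw [← Nat.cast_sub hu]
      exact mod_cast h.cost_le (k + 1) hk
    have hdrop := mul_le_mul_of_nonneg_left (sub_le_mul_harmonic_sub hu)
      (show (0 : ℚ) ≤ 4 * 2 ^ k by positivity)
    have hβ : (2 : ℚ) ^ k * u (k + 1) ≤ β := mod_cast h.mul_uncovered_le k (by omega)
    have hpay := mul_le_mul_of_nonneg_right hβ (sub_nonneg.2 (harmonic_mono hu))
    rw [pow_succ] at hcost
    linarith [ih (by omega)]

theorem DoublingRounds.cost_le_harmonic (h : DoublingRounds u W β B) (hB : B ≠ 0)
    (hu : u B = 0) : (W B : ℝ) ≤ 2 * u 0 + 4 * β * harmonic (u 0) := by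
  obtain ⟨B, rfl⟩ := Nat.exists_eq_succ_of_ne_zero hB
  have hle := h.cost_le_harmonic_sub (Nat.lt_succ_self B)
  rw [hu, harmonic_zero, sub_zero] at hle
  exact mod_cast hle

theorem half_le_log {r : ℕ} (hr : 2 ≤ r) : 1 / 2 ≤ Real.log r := by
  have hlog : (1 : ℝ) / 2 ≤ Real.log 2 := by linarith [Real.log_two_gt_d9]
  exact hlog.trans (Real.log_le_log (by norm_num) (mod_cast hr))

theorem natLog_two_le_two_mul_log {r : ℕ} (hr : r ≠ 0) : (Nat.log 2 r : ℝ) ≤ 2 * Real.log r := by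
  have hpow : (2 : ℝ) ^ Nat.log 2 r ≤ r := mod_cast Nat.pow_log_le_self 2 hr
  have hlog := Real.log_le_log (by positivity) hpow
  rw [Real.log_pow] at hlog
  have hmul := mul_le_mul_of_nonneg_left (half_le_log le_rfl) (Nat.cast_nonneg (Nat.log 2 r))
  push_cast at hmul
  linarith

theorem harmonic_le_four_mul_log {u r : ℕ} (hr : 2 ≤ r) (hu : u ≤ r ^ 2) :
    (harmonic u : ℝ) ≤ 4 * Real.log r := by
  have hhalf := half_le_log hr
  refine (harmonic_le_one_add_log u).trans ?_
  rcases Nat.eq_zero_or_pos u with rfl | hpos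
  · rw [Nat.cast_zero, Real.log_zero]
    linarith
  · have hlog : Real.log u ≤ Real.log ((r : ℝ) ^ 2) :=
      Real.log_le_log (mod_cast hpos) (mod_cast hu)
    rw [Real.log_pow] at hlog
    push_cast at hlog
    linarith

theorem DoublingRounds.cost_le_log_sq {r c : ℕ}
    (h : DoublingRounds u W ((Nat.log 2 r + 2) * c) B) (hB : B ≠ 0) (hu : u B = 0) (hr : 2 ≤ r)
    (hr' : u 0 ≤ r ^ 2) (hc : 2 * u 0 ≤ c) : (W B : ℝ) ≤ 100 * Real.log r ^ 2 * c := by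
  set l := Real.log r
  have hhalf : 1 / 2 ≤ l := half_le_log hr
  have hc0 : (0 : ℝ) ≤ c := Nat.cast_nonneg c
  have hinit : (2 : ℝ) * u 0 ≤ c := mod_cast hc
  have hβ : ((Nat.log 2 r : ℝ) + 2) * c ≤ 6 * l * c :=
    mul_le_mul_of_nonneg_right (by linarith [natLog_two_le_two_mul_log (r := r) (by omega)]) hc0
  have hsq : 1 * (c : ℝ) ≤ 4 * l ^ 2 * c := mul_le_mul_of_nonneg_right (by nlinarith) hc0
  calc (W B : ℝ) ≤ 2 * u 0 + 4 * ((Nat.log 2 r + 2) * c) * harmonic (u 0) :=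
        mod_cast h.cost_le_harmonic hB hu
    _ ≤ c + 4 * (6 * l * c) * (4 * l) := by
        have hharm := harmonic_le_four_mul_log hr hr'
        have hpos : (0 : ℝ) ≤ harmonic (u 0) :=
          mod_cast harmonic_zero ▸ harmonic_mono (Nat.zero_le (u 0))
        gcongr
    _ ≤ 100 * l ^ 2 * c := by linarith

end Thresholds

end Steiner

namespace NWSTAP

open Finset SimpleGraph Steiner

section Rounds

variable {I : NWSTAP} {w : Fin I.n → ℕ} {lam : ℕ} {M M' S : Finset (Fin I.n)}

/-- The requirements on a round with threshold `lam` that enlarges `M` to `M'`. -/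
structure Round (I : NWSTAP) (w : Fin I.n → ℕ) (lam : ℕ) (M M' : Finset (Fin I.n)) : Prop where
  subset : M ⊆ M'
  weight_le : ∑ x ∈ M', w x ≤ ∑ x ∈ M, w x + 2 * lam * (#(I.covered M') - #(I.covered M))
  spider_le : ∀ v, ∀ Y ⊆ I.R, Y.Nonempty → (∀ y ∈ Y, I.links.Reachable v y) →
    lam * #(I.crossed M' Y) ≤ w v + ∑ y ∈ Y, nodeDist I.links w v y

theorem Round.spiderBound (hr : I.Round w lam M M') (hw : ∀ v ∈ I.R, w v = 0) :
    SpiderBound I.links I.R w (nodeDist I.links w) fun Y => lam * #(I.crossed M' Y) where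
  weight_terminal := hw
  dist_le _ _ _ := add_nodeDist_le
  union_le X Y h := by
    rw [← mul_add]
    exact Nat.mul_le_mul_left _ (card_crossed_union_le M' X Y h)
  spider_le := hr.spider_le

theorem card_uncovered_le_sum (hS : I.R ⊆ S) (hcov : ∀ a b, I.T.Adj a b → I.Covers S a b) :
    #(I.uncovered M) ≤ ∑ K ∈ I.R.image (component I.links S), #(I.crossed M (K ∩ I.R)) := by
  refine (card_le_card fun p hp => ?_).trans card_biUnion_le
  obtain ⟨hab, -⟩ := mem_uncovered.1 hp
  obtain ⟨y, hy, y', hy', hs, hs', h⟩ := (hcov p.1 p.2 hab).exists_crossing hab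
  have hmem : ∀ z ∈ I.R, (within I.links S).Reachable y z → z ∈ component I.links S y ∩ I.R :=
    fun z hz h => mem_inter.2 ⟨mem_component.2 ⟨hS hz, h⟩, hz⟩
  exact mem_biUnion.2 ⟨_, mem_image_of_mem _ hy, mem_crossed.2
    ⟨hp, ⟨y, hmem y hy .rfl, hs⟩, y', hmem y' hy' h, hs'⟩⟩

theorem Round.mul_card_uncovered_le (hr : I.Round w lam M M') (hw : ∀ v ∈ I.R, w v = 0)
    (hS : I.R ⊆ S) (hcov : ∀ a b, I.T.Adj a b → I.Covers S a b) :
    lam * #(I.uncovered M') ≤ (Nat.log 2 #I.R + 2) * ∑ x ∈ S, w x := by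
  set C := I.R.image (component I.links S)
  have hpiece : ∀ K ∈ C, lam * #(I.crossed M' (K ∩ I.R)) ≤
      (Nat.log 2 #I.R + 2) * ∑ x ∈ K, w x := by
    refine forall_mem_image.2 fun x hx => ?_
    exact (hr.spiderBound hw).measure_le_log_mul (connectedOn_component _ _ _)
      ⟨x, mem_inter.2 ⟨mem_component_self (hS hx), hx⟩⟩ le_rfl
  have hsub : C.biUnion id ⊆ S :=
    biUnion_subset.2 (forall_mem_image.2 fun _ _ => component_subset _ _ _)
  calc lam * #(I.uncovered M') ≤ ∑ K ∈ C, lam * #(I.crossed M' (K ∩ I.R)) := by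
        rw [← mul_sum]
        exact Nat.mul_le_mul_left _ (card_uncovered_le_sum hS hcov)
    _ ≤ ∑ K ∈ C, (Nat.log 2 #I.R + 2) * ∑ x ∈ K, w x := sum_le_sum hpiece
    _ = (Nat.log 2 #I.R + 2) * ∑ x ∈ C.biUnion id, w x := by
        rw [← mul_sum, sum_biUnion (pairwiseDisjoint_image_component _ _ _)]
        rfl
    _ ≤ (Nat.log 2 #I.R + 2) * ∑ x ∈ S, w x :=
        Nat.mul_le_mul_left _ (sum_le_sum_of_subset hsub)

theorem doublingRounds {B : ℕ} {Ms : ℕ → Finset (Fin I.n)} (hw : ∀ v ∈ I.R, w v = 0)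
    (h0 : Ms 0 = I.R) (hr : ∀ k < B, I.Round w (2 ^ k) (Ms k) (Ms (k + 1)))
    (hS : I.Feasible S) :
    DoublingRounds (fun k => #(I.uncovered (Ms k))) (fun k => ∑ x ∈ Ms k, w x)
      ((Nat.log 2 #I.R + 2) * ∑ x ∈ S, w x) B where
  uncovered_le k hk := card_le_card (uncovered_anti (hr k hk).subset)
  cost_zero := by simpa only [h0] using sum_eq_zero hw
  cost_le k hk := by
    have hle := (hr k hk).weight_le
    have hdiff : #(I.covered (Ms (k + 1))) - #(I.covered (Ms k)) =
        #(I.uncovered (Ms k)) - #(I.uncovered (Ms (k + 1))) := by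
      have h := card_covered_add_card_uncovered (Ms k)
      have h' := card_covered_add_card_uncovered (Ms (k + 1))
      omega
    rwa [hdiff] at hle
  mul_uncovered_le k hk := by
    have hle := (hr k hk).mul_card_uncovered_le hw subset_union_left fun a b => hS.covers
    rwa [sum_union hS.1.symm, sum_eq_zero hw, zero_add] at hle

/-- All weights are multiples of a number that exceeds `2 * #R ^ 2`. Hence the cost `2 * u 0` of the
first round, which is not bounded in terms of the optimum by the harmonic sum, is negligible. -/
theorem covers_and_weight_le_of_rounds {scale B : ℕ} {Ms : ℕ → Finset (Fin I.n)} (hB0 : B ≠ 0)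
    (hw : ∀ v ∈ I.R, w v = 0) (hdvd : ∀ v, scale ∣ w v) (hscale : 2 * #I.R ^ 2 < scale)
    (h0 : Ms 0 = I.R) (hr : ∀ k < B, I.Round w (2 ^ k) (Ms k) (Ms (k + 1)))
    (hS : I.Feasible S) (hB : (Nat.log 2 #I.R + 2) * (∑ x, w x) * 2 < 2 ^ B) :
    (∀ a b, I.T.Adj a b → I.Covers (Ms B) a b) ∧
      ((∑ x ∈ Ms B, w x : ℕ) : ℝ) ≤ 100 * Real.log #I.R ^ 2 * ((∑ x ∈ S, w x : ℕ) : ℝ) := by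
  have hrounds := doublingRounds hw h0 hr hS
  have hu : #(I.uncovered (Ms B)) = 0 := by
    obtain ⟨B, rfl⟩ := Nat.exists_eq_succ_of_ne_zero hB0
    refine hrounds.uncovered_eq_zero ((Nat.mul_le_mul_left _
      (sum_le_sum_of_subset (subset_univ S))).trans_lt ?_)
    rwa [pow_succ, Nat.mul_lt_mul_right two_pos] at hB
  refine ⟨fun a b => covers_of_uncovered_eq_empty (card_eq_zero.1 hu), ?_⟩
  rcases Nat.lt_or_ge #I.R 2 with hR | hR
  · have hzero := hrounds.cost_le_harmonic hB0 hu
    rw [uncovered_eq_empty_of_card_le_one (by omega)] at hzero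
    simp only [card_empty, Nat.cast_zero, mul_zero, harmonic_zero, Rat.cast_zero, add_zero] at hzero
    exact hzero.trans (by positivity)
  have hu0 : #(I.uncovered (Ms 0)) ≤ #I.R ^ 2 := card_uncovered_le _
  rcases Nat.eq_zero_or_pos (∑ x ∈ S, w x) with hS0 | hSpos
  · have hfree := hrounds.cost_le_harmonic hB0 hu
    rw [hS0] at hfree ⊢
    simp only [mul_zero, Nat.cast_zero, zero_mul, add_zero] at hfree ⊢
    have hlt : ∑ x ∈ Ms B, w x ≤ 2 * #(I.uncovered (Ms 0)) := mod_cast hfree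
    rw [Nat.eq_zero_of_dvd_of_lt (dvd_sum fun x _ => hdvd x) (hlt.trans_lt (by omega)),
      Nat.cast_zero]
  · have hle := Nat.le_of_dvd hSpos (dvd_sum fun x _ => hdvd x)
    exact hrounds.cost_le_log_sq hB0 hu hR hu0 (by omega)

end Rounds

end NWSTAP

/-! ### Programs with counting loops -/

namespace RAM

namespace Expr

instance instZero : Zero Expr := ⟨.lit 0⟩

instance instOne : One Expr := ⟨.lit 1⟩

instance instAdd : Add Expr := ⟨.add⟩

instance instSub : Sub Expr := ⟨.sub⟩

/-- Negation, where nonzero means true. -/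
def not (e : Expr) : Expr := 1 - e

/-- Conjunction, where nonzero means true. -/
def and (e f : Expr) : Expr := not (e.not + f.not)

/-- Disjunction, where nonzero means true. -/
def or (e f : Expr) : Expr := e + f

/-- The test `e < f`. -/
def lt (e f : Expr) : Expr := f - e

/-- The test `e ≤ f`. -/
def le (e f : Expr) : Expr := not (e - f)

/-- The test `e = f`. -/
def eq (e f : Expr) : Expr := not ((e - f) + (f - e))

variable {s : State} {e f : Expr}

@[simp] theorem eval_zero : (0 : Expr).eval s = 0 := rfl

@[simp] theorem eval_one : (1 : Expr).eval s = 1 := rfl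

@[simp] theorem eval_reg (r : ℕ) : (reg r).eval s = s.reg r := rfl

@[simp] theorem eval_get (a : ℕ) : (get a e).eval s = s.arr a (e.eval s) := rfl

@[simp] theorem eval_add : (e + f).eval s = e.eval s + f.eval s := rfl

@[simp] theorem eval_sub : (e - f).eval s = e.eval s - f.eval s := rfl

@[simp] theorem eval_half : (half e).eval s = e.eval s / 2 := rfl

@[simp] theorem cost_zero : (0 : Expr).cost = 1 := rfl

@[simp] theorem cost_one : (1 : Expr).cost = 1 := rfl

@[simp] theorem cost_reg (r : ℕ) : (reg r).cost = 1 := rfl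

@[simp] theorem cost_add : (e + f).cost = e.cost + f.cost + 1 := rfl

@[simp] theorem cost_sub : (e - f).cost = e.cost + f.cost + 1 := rfl

@[simp] theorem eval_not_ne_zero : e.not.eval s ≠ 0 ↔ ¬ e.eval s ≠ 0 := by
  simp only [not, eval_sub, eval_one]; omega

@[simp] theorem eval_and_ne_zero : (e.and f).eval s ≠ 0 ↔ e.eval s ≠ 0 ∧ f.eval s ≠ 0 := by
  simp only [and, not, eval_sub, eval_add, eval_one]; omega

@[simp] theorem eval_or_ne_zero : (e.or f).eval s ≠ 0 ↔ e.eval s ≠ 0 ∨ f.eval s ≠ 0 := by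
  simp only [or, eval_add]; omega

@[simp] theorem eval_lt_ne_zero : (e.lt f).eval s ≠ 0 ↔ e.eval s < f.eval s := by
  simp only [lt, eval_sub]; omega

@[simp] theorem eval_le_ne_zero : (e.le f).eval s ≠ 0 ↔ e.eval s ≤ f.eval s := by
  simp only [le, not, eval_sub, eval_one]; omega

@[simp] theorem eval_eq_ne_zero : (e.eq f).eval s ≠ 0 ↔ e.eval s = f.eval s := by
  simp only [eq, not, eval_sub, eval_add, eval_one]; omega

end Expr

namespace State

@[simp] theorem setReg_reg (s : State) (r v r' : ℕ) :
    (s.setReg r v).reg r' = if r' = r then v else s.reg r' := by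
  simp only [setReg, Function.update_apply]

@[simp] theorem setReg_arr (s : State) (r v : ℕ) : (s.setReg r v).arr = s.arr := rfl

@[simp] theorem setArr_reg (s : State) (a i v : ℕ) : (s.setArr a i v).reg = s.reg := rfl

@[simp] theorem setArr_arr_self (s : State) (a i v : ℕ) :
    (s.setArr a i v).arr a = Function.update (s.arr a) i v := by
  simp only [setArr, Function.update_self]

theorem setArr_arr_of_ne (s : State) {a i v a' : ℕ} (h : a' ≠ a) :
    (s.setArr a i v).arr a' = s.arr a' := by
  simp only [setArr, Function.update_of_ne h]

/-- The states agree on all registers outside `rs` and all arrays outside `as`. -/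
structure Agree (rs as : List ℕ) (s t : State) : Prop where
  reg (r : ℕ) (h : r ∉ rs := by decide) : t.reg r = s.reg r
  arr (a : ℕ) (h : a ∉ as := by decide) : t.arr a = s.arr a

variable {rs as rs' as' : List ℕ} {s t u : State}

theorem Agree.refl (rs as : List ℕ) (s : State) : Agree rs as s s :=
  ⟨fun _ _ => rfl, fun _ _ => rfl⟩

theorem Agree.trans (h : Agree rs as s t) (h' : Agree rs as t u) : Agree rs as s u :=
  ⟨fun r hr => (h'.reg r hr).trans (h.reg r hr), fun a ha => (h'.arr a ha).trans (h.arr a ha)⟩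

theorem Agree.mono (h : Agree rs as s t) (hr : rs ⊆ rs' := by decide)
    (ha : as ⊆ as' := by decide) : Agree rs' as' s t :=
  ⟨fun r h' => h.reg r fun h'' => h' (hr h''), fun a h' => h.arr a fun h'' => h' (ha h'')⟩

theorem agree_setReg (s : State) (r v : ℕ) : Agree [r] [] s (s.setReg r v) where
  reg r' hr' := by rw [setReg_reg, if_neg (List.ne_of_not_mem_cons hr')]
  arr _ _ := rfl

theorem agree_setArr (s : State) (a i v : ℕ) : Agree [] [a] s (s.setArr a i v) where
  reg _ _ := rfl
  arr _ ha' := setArr_arr_of_ne s (List.ne_of_not_mem_cons ha')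

end State

/-- Programs whose only loops are counting loops: `loopTo r b p` runs `p` with the register `r` set
to `0, 1, …` up to the value of the register `b`. -/
inductive Cmd where
  | skip
  | assign (r : ℕ) (e : Expr)
  | store (a : ℕ) (i e : Expr)
  | seq (p q : Cmd)
  | ite (e : Expr) (p q : Cmd)
  | loopTo (r b : ℕ) (p : Cmd)

namespace Cmd

notation:60 p:61 ";;" q:60 => Cmd.seq p q

/-- Translation of a counting loop, after its counter has been initialized. -/
def countingLoop (r b : ℕ) (p : Prog) : Prog :=
  .loop (.reg b - .reg r) (.seq p (.assign r (.reg r + 1)))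

/-- The translation into programs of the machine. -/
def compile : Cmd → Prog
  | skip => .skip
  | assign r e => .assign r e
  | store a i e => .store a i e
  | p ;; q => .seq p.compile q.compile
  | ite e p q => .branch e p.compile q.compile
  | loopTo r b p => .seq (.assign r 0) (countingLoop r b p.compile)

/-- `k` rounds of a counting loop with counter `r` and body `f`. -/
def iter (f : State → State) (r : ℕ) (s : State) : ℕ → State
  | 0 => s
  | k + 1 => f ((iter f r s k).setReg r k)

/-- The final state of a command, computed without reference to execution steps. -/
def run : Cmd → State → State
  | skip, s => s
  | assign r e, s => s.setReg r (e.eval s)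
  | store a i e, s => s.setArr a (i.eval s) (e.eval s)
  | p ;; q, s => q.run (p.run s)
  | ite e p q, s => if e.eval s ≠ 0 then p.run s else q.run s
  | loopTo r b p, s => (iter p.run r s (s.reg b)).setReg r (s.reg b)

/-- The registers that a command may write. -/
def regs : Cmd → List ℕ
  | skip => []
  | assign r _ => [r]
  | store _ _ _ => []
  | p ;; q => p.regs ++ q.regs
  | ite _ p q => p.regs ++ q.regs
  | loopTo r _ p => r :: p.regs

/-- The arrays that a command may write. -/
def arrs : Cmd → List ℕ
  | skip => []
  | assign _ _ => []
  | store a _ _ => [a]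
  | p ;; q => p.arrs ++ q.arrs
  | ite _ p q => p.arrs ++ q.arrs
  | loopTo _ _ p => p.arrs

/-- All loops are bounded by registers from `bs`, and no bound and no counter is overwritten. -/
def WF (bs : List ℕ) : Cmd → Prop
  | skip => True
  | assign r _ => r ∉ bs
  | store _ _ _ => True
  | p ;; q => p.WF bs ∧ q.WF bs
  | ite _ p q => p.WF bs ∧ q.WF bs
  | loopTo r b p => b ∈ bs ∧ r ∉ bs ∧ r ∉ p.regs ∧ p.WF bs

instance decidableWF (bs : List ℕ) : (p : Cmd) → Decidable (p.WF bs)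
  | skip => .isTrue trivial
  | assign r _ => inferInstanceAs (Decidable (r ∉ bs))
  | store _ _ _ => .isTrue trivial
  | p ;; q => @instDecidableAnd _ _ (decidableWF bs p) (decidableWF bs q)
  | ite _ p q => @instDecidableAnd _ _ (decidableWF bs p) (decidableWF bs q)
  | loopTo r b p =>
    have := decidableWF bs p
    inferInstanceAs (Decidable (b ∈ bs ∧ r ∉ bs ∧ r ∉ p.regs ∧ p.WF bs))

/-- A bound for the running time when all loops have at most `X` rounds. -/
noncomputable def timeBound : Cmd → Polynomial ℕ
  | skip => 1
  | assign _ e => Polynomial.C (e.cost + 1)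
  | store _ i e => Polynomial.C (i.cost + e.cost + 1)
  | p ;; q => p.timeBound + q.timeBound
  | ite e p q => Polynomial.C (e.cost + 1) + p.timeBound + q.timeBound
  | loopTo _ _ p => 6 + Polynomial.X * (p.timeBound + 8)

open State

section Run

variable {p q : Cmd} {e : Expr} {r b a : ℕ} {s : State}

theorem agree_iter {rs as : List ℕ} {f : State → State} (hr : r ∈ rs)
    (hf : ∀ s, Agree rs as s (f s)) (s : State) (k : ℕ) : Agree rs as s (iter f r s k) := by
  induction k with
  | zero => exact .refl _ _ _
  | succ k ih =>
    exact (ih.trans ((agree_setReg _ _ _).mono (List.cons_subset.2 ⟨hr, List.nil_subset _⟩)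
      (List.nil_subset _))).trans (hf _)

theorem agree_run (p : Cmd) (s : State) : Agree p.regs p.arrs s (p.run s) := by
  induction p generalizing s with
  | skip => exact .refl _ _ _
  | assign r e => exact agree_setReg _ _ _
  | store a i e => exact agree_setArr _ _ _ _
  | seq p q hp hq =>
    exact ((hp s).mono (List.subset_append_left _ _) (List.subset_append_left _ _)).trans
      ((hq _).mono (List.subset_append_right _ _) (List.subset_append_right _ _))
  | ite e p q hp hq =>
    simp only [run]
    split
    · exact (hp s).mono (List.subset_append_left _ _) (List.subset_append_left _ _)
    · exact (hq s).mono (List.subset_append_right _ _) (List.subset_append_right _ _)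
  | loopTo r b p hp =>
    exact (agree_iter List.mem_cons_self
      (fun s => (hp s).mono (List.subset_cons_self _ _) (List.Subset.refl _)) s _).trans
      ((agree_setReg _ _ _).mono (List.cons_subset_cons _ (List.nil_subset _)) (List.nil_subset _))

theorem agree_loop (p : Cmd) (r : ℕ) (s : State) (k : ℕ) :
    Agree (r :: p.regs) p.arrs s ((iter p.run r s k).setReg r k) :=
  (agree_iter List.mem_cons_self
    (fun s => (agree_run p s).mono (List.subset_cons_self _ _) (List.Subset.refl _)) s k).trans
    ((agree_setReg _ _ _).mono (List.cons_subset_cons _ (List.nil_subset _)) (List.nil_subset _))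

theorem run_reg (p : Cmd) (s : State) (r : ℕ) (h : r ∉ p.regs := by decide) :
    (p.run s).reg r = s.reg r := (agree_run p s).reg r h

theorem run_arr (p : Cmd) (s : State) (a : ℕ) (h : a ∉ p.arrs := by decide) :
    (p.run s).arr a = s.arr a := (agree_run p s).arr a h

@[simp] theorem run_skip : skip.run s = s := rfl

@[simp] theorem run_assign : (assign r e).run s = s.setReg r (e.eval s) := rfl

@[simp] theorem run_store (i : Expr) : (store a i e).run s = s.setArr a (i.eval s) (e.eval s) := rfl

@[simp] theorem run_seq : (p ;; q).run s = q.run (p.run s) := rfl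

theorem run_ite_pos (h : e.eval s ≠ 0) : (ite e p q).run s = p.run s := if_pos h

theorem run_ite_neg (h : ¬ e.eval s ≠ 0) : (ite e p q).run s = q.run s := if_neg h

theorem loopTo_induction (P : ℕ → State → Prop) (hP : ∀ k t v, P k t → P k (t.setReg r v))
    (zero : P 0 s)
    (step : ∀ k < s.reg b, ∀ t, Agree (r :: p.regs) p.arrs s t → t.reg r = k → P k t →
      P (k + 1) (p.run t)) :
    P (s.reg b) ((loopTo r b p).run s) := by
  have hiter : ∀ k ≤ s.reg b, P k (iter p.run r s k) := by
    intro k hk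
    induction k with
    | zero => exact zero
    | succ k ih =>
      exact step k hk _ (agree_loop p r s k) (by simp) (hP _ _ _ (ih (Nat.le_of_succ_le hk)))
  exact hP _ _ _ (hiter _ le_rfl)

end Run

section Exec

variable {p : Cmd} {bs : List ℕ} {X T r b : ℕ} {s : State}

theorem WF.notMem_regs (h : p.WF bs) (hb : b ∈ bs) : b ∉ p.regs := by
  induction p with
  | skip => exact List.not_mem_nil
  | assign r e =>
    intro hr
    exact h (List.mem_singleton.1 hr ▸ hb)
  | store a i e => exact List.not_mem_nil
  | seq p q hp hq => exact List.mem_append.not.2 (not_or.2 ⟨hp h.1, hq h.2⟩)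
  | ite e p q hp hq => exact List.mem_append.not.2 (not_or.2 ⟨hp h.1, hq h.2⟩)
  | loopTo r c p hp =>
    obtain ⟨-, hr, -, hwf⟩ := h
    exact List.mem_cons.not.2 (not_or.2 ⟨fun hbr => hr (hbr ▸ hb), hp hwf⟩)

theorem exec_countingLoop (h : (loopTo r b p).WF bs)
    (hp : ∀ s : State, (∀ b ∈ bs, s.reg b ≤ X) → ∃ t, Exec p.compile s t (p.run s) ∧ t ≤ T)
    (hs : ∀ b ∈ bs, s.reg b ≤ X) (j k : ℕ) (hjk : j + k = s.reg b) :
    ∃ t, Exec (countingLoop r b p.compile) ((iter p.run r s k).setReg r k) t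
      ((loopTo r b p).run s) ∧ t ≤ 4 + j * (T + 8) := by
  have hwf := h
  obtain ⟨hb, -, hrp, -⟩ := h
  have hreg : ∀ k, ∀ b ∈ bs, ((iter p.run r s k).setReg r k).reg b = s.reg b := fun k b hb =>
    (agree_loop p r s k).reg b (hwf.notMem_regs hb)
  have heval : ∀ k, (Expr.reg b - Expr.reg r).eval ((iter p.run r s k).setReg r k) =
      s.reg b - k := fun k => by
    rw [Expr.eval_sub, Expr.eval_reg, Expr.eval_reg, hreg k b hb, setReg_reg, if_pos rfl]
  induction j generalizing k with
  | zero =>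
    obtain rfl : k = s.reg b := by omega
    exact ⟨_, .loop_false (by rw [heval, Nat.sub_self]), by simp⟩
  | succ j ih =>
    obtain ⟨t, ht, htT⟩ := hp ((iter p.run r s k).setReg r k) fun b' hb' =>
      (hreg k b' hb').trans_le (hs b' hb')
    obtain ⟨t', ht', htT'⟩ := ih (k + 1) (by omega)
    have hcounter : (Expr.reg r + 1).eval (p.run ((iter p.run r s k).setReg r k)) = k + 1 := by
      simp [run_reg p _ r hrp]
    have hassign := Exec.assign r (Expr.reg r + 1) (p.run ((iter p.run r s k).setReg r k))
    rw [hcounter] at hassign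
    refine ⟨_, .loop_true (by rw [heval]; omega) (.seq ht hassign) ht', ?_⟩
    simp only [Expr.cost_sub, Expr.cost_add, Expr.cost_reg, Expr.cost_one]
    linarith [Nat.succ_mul j (T + 8)]

theorem exec_compile (h : p.WF bs) (hs : ∀ b ∈ bs, s.reg b ≤ X) :
    ∃ t, Exec p.compile s t (p.run s) ∧ t ≤ p.timeBound.eval X := by
  induction p generalizing s with
  | skip => exact ⟨_, .skip s, by simp [timeBound]⟩
  | assign r e => exact ⟨_, .assign r e s, by simp [timeBound]⟩
  | store a i e => exact ⟨_, .store a i e s, by simp [timeBound]⟩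
  | seq p q hp hq =>
    obtain ⟨t, ht, htT⟩ := hp h.1 hs
    obtain ⟨t', ht', htT'⟩ := hq h.2 (s := p.run s) fun b hb => by
      rw [run_reg p s b (h.1.notMem_regs hb)]
      exact hs b hb
    exact ⟨_, .seq ht ht', by simpa [timeBound] using add_le_add htT htT'⟩
  | ite e p q hp hq =>
    by_cases he : e.eval s ≠ 0
    · obtain ⟨t, ht, htT⟩ := hp h.1 hs
      rw [run_ite_pos he]
      exact ⟨_, .branch_true he ht, by simp [timeBound]; omega⟩
    · obtain ⟨t, ht, htT⟩ := hq h.2 hs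
      rw [run_ite_neg he]
      exact ⟨_, .branch_false (not_not.1 he) ht, by simp [timeBound]; omega⟩
  | loopTo r b p hp =>
    obtain ⟨t, ht, htT⟩ := exec_countingLoop (T := p.timeBound.eval X) h
      (fun s hs => hp h.2.2.2 hs) hs (s.reg b) 0 (Nat.add_zero _)
    have hrounds := Nat.mul_le_mul_right (p.timeBound.eval X + 8) (hs b h.1)
    exact ⟨_, .seq (.assign r 0 s) ht, by simp [timeBound]; omega⟩

end Exec

end Cmd

end RAM

/-! ### Shortest paths -/

namespace Steiner

open Finset SimpleGraph

/-- The labels of a shortest path computation from a source. A vertex `x` that has not been reached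
has `dist x = 0`; for the others `dist x` is the distance plus one, and `path x` is the vertex set
of a path to `x`. -/
structure Labelling (V : Type*) where
  dist : V → ℕ
  path : V → Finset V

namespace Labelling

variable {V : Type*} {H : SimpleGraph V} {w : V → ℕ} {src a x : V}
  {E E' : V → V → Prop} {L L' L'' : Labelling V}

/-- The labels when only the source has been reached. -/
def IsInitial [DecidableEq V] (src : V) (L : Labelling V) : Prop :=
  (∀ x, L.dist x = if x = src then 1 else 0) ∧ L.path src = {src}

/-- Every reached vertex has a path whose weight, not counting the source, is at most its
distance. -/
structure Sound (H : SimpleGraph V) (w : V → ℕ) (src : V) (L : Labelling V) : Prop where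
  connectedOn (x : V) (hx : L.dist x ≠ 0) : ConnectedOn H (L.path x)
  src_mem (x : V) (hx : L.dist x ≠ 0) : src ∈ L.path x
  self_mem (x : V) (hx : L.dist x ≠ 0) : x ∈ L.path x
  weight_le (x : V) (hx : L.dist x ≠ 0) : ∑ z ∈ L.path x, w z + 1 ≤ w src + L.dist x

/-- `L'` arises from `L` by improvements that cover all edges of `H` in the relation `E`. -/
structure RelaxedOn (H : SimpleGraph V) (w : V → ℕ) (src : V) (E : V → V → Prop)
    (L L' : Labelling V) : Prop where
  sound : Sound H w src L → Sound H w src L'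
  le (x : V) (hx : L.dist x ≠ 0) : L'.dist x ≠ 0 ∧ L'.dist x ≤ L.dist x
  relaxed (a x : V) (hE : E a x) (hax : H.Adj a x) (ha : L.dist a ≠ 0) :
    L'.dist x ≠ 0 ∧ L'.dist x ≤ L.dist a + w x

/-- The labels are those of shortest paths. -/
structure IsShortest (H : SimpleGraph V) (w : V → ℕ) (src : V) (L : Labelling V) : Prop
    extends Sound H w src L where
  dist_ne_zero_iff (x : V) : L.dist x ≠ 0 ↔ H.Reachable src x
  dist_sub_one (x : V) (hx : L.dist x ≠ 0) : L.dist x - 1 = nodeDist H w src x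

open Classical in
/-- The relaxation of the pair `(a, x)`. -/
noncomputable def relax [DecidableEq V] (H : SimpleGraph V) (w : V → ℕ) (L : Labelling V)
    (a x : V) : Labelling V :=
  if L.dist a ≠ 0 ∧ H.Adj a x ∧ (¬ L.dist x ≠ 0 ∨ L.dist a + w x < L.dist x) then
    ⟨Function.update L.dist x (L.dist a + w x), Function.update L.path x (insert x (L.path a))⟩
  else L

theorem IsInitial.sound [DecidableEq V] (h : IsInitial src L) : Sound H w src L := by
  have hsrc : ∀ x, L.dist x ≠ 0 → x = src := fun x hx => by
    by_contra hne
    exact hx ((h.1 x).trans (if_neg hne))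
  constructor <;> intro x hx <;> obtain rfl := hsrc x hx <;> rw [h.2]
  · exact connectedOn_singleton _ _
  · exact mem_singleton_self x
  · exact mem_singleton_self x
  · rw [sum_singleton, h.1, if_pos rfl]

theorem RelaxedOn.refl (L : Labelling V) : RelaxedOn H w src (fun _ _ => False) L L :=
  ⟨id, fun _ hx => ⟨hx, le_rfl⟩, fun _ _ => False.elim⟩

theorem RelaxedOn.trans (h : RelaxedOn H w src E L L') (h' : RelaxedOn H w src E' L' L'') :
    RelaxedOn H w src (fun a x => E a x ∨ E' a x) L L'' where
  sound := h'.sound ∘ h.sound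
  le x hx := ⟨(h'.le x (h.le x hx).1).1, (h'.le x (h.le x hx).1).2.trans (h.le x hx).2⟩
  relaxed a x hE hax ha := by
    rcases hE with hE | hE
    · obtain ⟨hx, hle⟩ := h.relaxed a x hE hax ha
      exact ⟨(h'.le x hx).1, (h'.le x hx).2.trans hle⟩
    · obtain ⟨ha', hle⟩ := h.le a ha
      obtain ⟨hx, hle'⟩ := h'.relaxed a x hE hax ha'
      exact ⟨hx, hle'.trans (Nat.add_le_add_right hle _)⟩

theorem RelaxedOn.mono (h : RelaxedOn H w src E L L')
    (hE : ∀ a x, E' a x → E a x) : RelaxedOn H w src E' L L' :=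
  ⟨h.sound, h.le, fun a x hE' => h.relaxed a x (hE a x hE')⟩

theorem Sound.relax [DecidableEq V] (h : Sound H w src L) (a x : V) :
    Sound H w src (L.relax H w a x) := by
  rw [Labelling.relax]
  split_ifs with hif
  swap
  · exact h
  obtain ⟨ha, hax, -⟩ := hif
  have hweight : ∑ z ∈ insert x (L.path a), w z ≤ w x + ∑ z ∈ L.path a, w z := by
    by_cases hx : x ∈ L.path a
    · rw [insert_eq_of_mem hx]
      exact Nat.le_add_left _ _
    · rw [sum_insert hx]
  have hpath := h.weight_le a ha
  constructor <;> intro z hz <;> by_cases hzx : z = x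
  all_goals
    simp only [hzx, Function.update_self, Function.update_of_ne, ne_eq, not_false_eq_true] at hz ⊢
  · exact (h.connectedOn a ha).insert (h.self_mem a ha) hax.symm
  · exact h.connectedOn z hz
  · exact mem_insert_of_mem (h.src_mem a ha)
  · exact h.src_mem z hz
  · exact mem_insert_self x _
  · exact h.self_mem z hz
  · omega
  · exact h.weight_le z hz

theorem relaxedOn_relax [DecidableEq V] (L : Labelling V) (a x : V) :
    RelaxedOn H w src (fun a' x' => a' = a ∧ x' = x) L (L.relax H w a x) := by
  refine ⟨fun h => h.relax a x, fun z hz => ?_, ?_⟩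
  · rw [Labelling.relax]
    split_ifs with hif
    · by_cases hzx : z = x
      · simp only [hzx, Function.update_self] at hz ⊢
        omega
      · simp only [Function.update_of_ne hzx]
        exact ⟨hz, le_rfl⟩
    · exact ⟨hz, le_rfl⟩
  · rintro _ _ ⟨rfl, rfl⟩ hax ha
    rw [Labelling.relax]
    split_ifs with hif
    · simp only [Function.update_self]
      omega
    · simp only [hax, true_and, not_and_or, not_or] at hif
      omega

theorem RelaxedOn.le_walk {k : ℕ} (h : RelaxedOn H w src (fun _ _ => True) L L')
    (hL : ∀ x (p : H.Walk x src), p.length ≤ k →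
      L.dist x ≠ 0 ∧ w src + L.dist x ≤ (p.support.map w).sum + 1)
    (x : V) (p : H.Walk x src) (hp : p.length ≤ k + 1) :
    L'.dist x ≠ 0 ∧ w src + L'.dist x ≤ (p.support.map w).sum + 1 := by
  cases p with
  | nil =>
    obtain ⟨hne, hle⟩ := hL src .nil (Nat.zero_le _)
    exact ⟨(h.le src hne).1, (Nat.add_le_add_left (h.le src hne).2 _).trans hle⟩
  | @cons _ a _ hxa p =>
    obtain ⟨ha, hle⟩ := hL a p (Nat.le_of_succ_le_succ hp)
    obtain ⟨hx, hle'⟩ := h.relaxed a x trivial hxa.symm ha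
    refine ⟨hx, ?_⟩
    rw [Walk.support_cons, List.map_cons, List.sum_cons]
    omega

theorem IsInitial.le_walk [DecidableEq V] (h : IsInitial src L) (x : V) (p : H.Walk x src)
    (hp : p.length ≤ 0) :
    L.dist x ≠ 0 ∧ w src + L.dist x ≤ (p.support.map w).sum + 1 := by
  cases p with
  | nil => simp [h.1]
  | cons hxa p => exact absurd hp (Nat.not_succ_le_zero _)

theorem Sound.isShortest [Fintype V] (h : Sound H w src L)
    (hwalk : ∀ x (p : H.Walk x src), p.length ≤ Fintype.card V →
      L.dist x ≠ 0 ∧ w src + L.dist x ≤ (p.support.map w).sum + 1) :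
    IsShortest H w src L := by
  classical
  refine ⟨h, fun x => ⟨fun hx => ?_, fun hx => ?_⟩, fun x hx => ?_⟩
  · exact (h.connectedOn x hx src (h.src_mem x hx) x (h.self_mem x hx)).mono (within_le _ _)
  · obtain ⟨p, hp⟩ := hx.symm.exists_isPath
    exact (hwalk x p hp.length_lt.le).1
  · have hweight := h.weight_le x hx
    refine eq_nodeDist_of_le (h.connectedOn x hx) (h.src_mem x hx) (h.self_mem x hx) (by omega)
      fun Q hQ hsrc hxQ => ?_
    obtain ⟨p, hp⟩ := (hQ x hxQ src hsrc).exists_isPath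
    have hle := (hwalk x (p.mapLe (within_le H Q)) (by simpa using hp.length_lt.le)).2
    have hsum : (p.support.map w).sum ≤ ∑ z ∈ Q, w z := by
      rw [← List.sum_toFinset w hp.support_nodup]
      exact sum_le_sum_of_subset fun z hz =>
        mem_of_reachable_within (p.takeUntil z (List.mem_toFinset.1 hz)).reachable hxQ
    rw [Walk.support_mapLe_eq_support] at hle
    omega

end Labelling

end Steiner

/-! ### Matrices in memory -/

namespace RAM

open Finset

namespace Reg

abbrev outputLength : ℕ := 0
abbrev n : ℕ := 1
abbrev bits : ℕ := 2
abbrev square : ℕ := 3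
abbrev source : ℕ := 20
abbrev pass : ℕ := 21
abbrev tail : ℕ := 22
abbrev head : ℕ := 23
abbrev column : ℕ := 24

end Reg

namespace Arr

abbrev input : ℕ := 0
abbrev offset : ℕ := 1
abbrev weight : ℕ := 2

end Arr

namespace Expr

/-- The position of the entry `(i, j)` in a square matrix that is stored row by row from the cell
`o` on. -/
def index (o i j : Expr) : Expr := o + .get Arr.offset i + j

/-- The entry `(i, j)` of the matrix that starts at the cell `o` of the array `a`. -/
def entry (a : ℕ) (o i j : Expr) : Expr := .get a (index o i j)

end Expr

variable {n : ℕ} {s : State} {a : ℕ}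

/-- The set of vertices whose cells in the array `a` are nonzero. -/
def mask (n : ℕ) (s : State) (a : ℕ) : Finset (Fin n) := {x | s.arr a x ≠ 0}

/-- The set of vertices whose cells in row `y` of the matrix in the array `a` are nonzero. -/
def rowMask (n : ℕ) (s : State) (a y : ℕ) : Finset (Fin n) := {x | s.arr a (y * n + x) ≠ 0}

theorem mem_mask {x : Fin n} : x ∈ mask n s a ↔ s.arr a x ≠ 0 := by
  simp only [mask, mem_filter_univ]

theorem mem_rowMask {y : ℕ} {x : Fin n} : x ∈ rowMask n s a y ↔ s.arr a (y * n + x) ≠ 0 := by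
  simp only [rowMask, mem_filter_univ]

theorem mask_congr {t : State} (h : t.arr a = s.arr a) : mask n t a = mask n s a := by
  simp only [mask, h]

theorem row_index_inj {y y' z z' : ℕ} (hz : z < n) (hz' : z' < n) :
    y * n + z = y' * n + z' ↔ y = y' ∧ z = z' := by
  refine ⟨fun h => ?_, by rintro ⟨rfl, rfl⟩; rfl⟩
  have hn : 0 < n := Nat.zero_lt_of_lt hz
  have hdiv := congrArg (· / n) h
  have hmod := congrArg (· % n) h
  simp only [mul_comm _ n, Nat.mul_add_div hn, Nat.mul_add_mod, Nat.div_eq_of_lt,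
    Nat.mod_eq_of_lt, hz, hz', add_zero] at hdiv hmod
  exact ⟨hdiv, hmod⟩

/-- The registers that are read by the main part of the program but not written. -/
abbrev fixedRegs : List ℕ := [Reg.n, Reg.bits, Reg.square]

/-- The arrays that are read by the main part of the program but not written. -/
abbrev fixedArrs : List ℕ := [Arr.input, Arr.offset, Arr.weight]

/-- The memory holds the number `n` of vertices, the offsets `u * n` of the rows of matrices, and
the weights of the vertices. -/
structure Layout (w : Fin n → ℕ) (s : State) : Prop where
  reg_n : s.reg Reg.n = n
  offset (u : Fin n) : s.arr Arr.offset u = u * n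
  weight (u : Fin n) : s.arr Arr.weight u = w u

namespace Layout

variable {w : Fin n → ℕ} {t : State} {rs as : List ℕ}

theorem agree (h : Layout w s) (hst : s.Agree rs as t)
    (hr : ∀ r ∈ fixedRegs, r ∉ rs := by decide) (ha : ∀ a ∈ fixedArrs, a ∉ as := by decide) :
    Layout w t where
  reg_n := (hst.reg _ (hr _ (by decide))).trans h.reg_n
  offset u := by rw [hst.arr _ (ha _ (by decide)), h.offset]
  weight u := by rw [hst.arr _ (ha _ (by decide)), h.weight]

theorem eval_index (h : Layout w s) {i : Expr} {u : Fin n} (hu : i.eval s = u) (o j : Expr) :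
    (Expr.index o i j).eval s = o.eval s + u * n + j.eval s := by
  simp only [Expr.index, Expr.eval_add, Expr.eval_get, hu, h.offset]

end Layout

namespace Cmd

theorem loopTo_induction_univ {r b : ℕ} {p : Cmd} (hb : s.reg b = n)
    (P : Finset (Fin n) → State → Prop) (hP : ∀ K t v, P K t → P K (t.setReg r v)) (empty : P ∅ s)
    (insert : ∀ (x : Fin n) K t, x ∉ K → State.Agree (r :: p.regs) p.arrs s t → t.reg r = x →
      P K t → P (insert x K) (p.run t)) :
    P univ ((loopTo r b p).run s) := by
  have hloop := loopTo_induction (s := s) (r := r) (b := b) (p := p)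
    (fun k t => P {x | (x : ℕ) < k} t) (fun k => hP _) (by simpa using empty) ?_
  · simpa [hb] using hloop
  · intro k hk t hst hkt h
    have hsplit : ({x : Fin n | (x : ℕ) < k + 1} : Finset (Fin n)) =
        Insert.insert ⟨k, hb ▸ hk⟩ ({x : Fin n | (x : ℕ) < k} : Finset (Fin n)) := by
      ext x
      simp only [mem_insert, mem_filter_univ, Fin.ext_iff]
      omega
    exact hsplit ▸ insert ⟨k, hb ▸ hk⟩ _ t (by simp) hst hkt h

/-- Set the first `n` cells of the array `a` to the values of `e`. -/
def fillArr (a : ℕ) (e : Expr) : Cmd :=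
  loopTo Reg.column Reg.n (store a (.reg Reg.column) e)

/-- Set the row in the register `r` of the matrix in the array `a` to the values of `e`. -/
def fillRow (a r : ℕ) (e : Expr) : Cmd :=
  loopTo Reg.column Reg.n (store a (.index 0 (.reg r) (.reg Reg.column)) e)

theorem fillArr_arr {e : Expr} (f : ℕ → ℕ)
    (he : ∀ t, State.Agree [Reg.column] [a] s t → t.reg Reg.column < s.reg Reg.n →
      e.eval t = f (t.reg Reg.column)) {z : ℕ} (hz : z < s.reg Reg.n) :
    ((fillArr a e).run s).arr a z = f z := by
  have hloop := loopTo_induction (s := s) (r := Reg.column) (b := Reg.n)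
    (p := store a (.reg Reg.column) e) (fun k t => ∀ z < k, t.arr a z = f z)
    (fun _ _ _ h => h) (fun _ h => absurd h (Nat.not_lt_zero _)) ?_
  · exact hloop z hz
  · intro k hk t hst hkt hdone z hz
    rw [run_store, Expr.eval_reg, he t hst (hkt ▸ hk), hkt, State.setArr_arr_self,
      Function.update_apply]
    split_ifs with hzk
    · rw [hzk]
    · exact hdone z (by omega)

theorem fillRow_arr {w : Fin n → ℕ} (hs : Layout w s) (ha : a ∉ fixedArrs) {r : ℕ}
    (hr : r ≠ Reg.column) {y : Fin n} (hy : s.reg r = y) {e : Expr} (f : ℕ → ℕ)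
    (he : ∀ t, State.Agree [Reg.column] [a] s t →
      (∀ y' : Fin n, y' ≠ y → ∀ z < n, t.arr a (y' * n + z) = s.arr a (y' * n + z)) →
      t.reg Reg.column < n → e.eval t = f (t.reg Reg.column))
    (y' : Fin n) (z : ℕ) (hz : z < n) :
    ((fillRow a r e).run s).arr a (y' * n + z) = if y' = y then f z else s.arr a (y' * n + z) := by
  have hloop := loopTo_induction (s := s) (r := Reg.column) (b := Reg.n)
    (p := store a (.index 0 (.reg r) (.reg Reg.column)) e)
    (fun k t => (∀ z < k, t.arr a (y * n + z) = f z) ∧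
      ∀ y' : Fin n, y' ≠ y → ∀ z < n, t.arr a (y' * n + z) = s.arr a (y' * n + z))
    (fun _ _ _ h => h) ⟨fun _ h => absurd h (Nat.not_lt_zero _), fun _ _ _ _ => rfl⟩ ?_
  · rw [hs.reg_n] at hloop
    split_ifs with hyy
    · rw [hyy]
      exact hloop.1 z hz
    · exact hloop.2 y' hyy z hz
  · intro k hk t hst hkt ⟨hdone, hother⟩
    rw [hs.reg_n] at hk
    have ht : Layout w t := hs.agree (rs := [Reg.column]) (as := [a]) hst (by decide)
      fun b hb hba => ha (List.mem_singleton.1 hba ▸ hb)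
    have hyt : (Expr.reg r).eval t = y := by
      rw [Expr.eval_reg, hst.reg r (List.mem_singleton.not.2 hr), hy]
    rw [run_store, ht.eval_index hyt, Expr.eval_zero, zero_add, Expr.eval_reg, hkt,
      he t hst hother (hkt ▸ hk), hkt]
    simp only [State.setArr_arr_self]
    refine ⟨fun z hz => ?_, fun y' hy' z hz => ?_⟩
    · obtain rfl | hzk := eq_or_ne z k
      · rw [Function.update_self]
      · rw [Function.update_of_ne (by omega), hdone z (by omega)]
    · rw [Function.update_of_ne fun h => hy' (Fin.ext ((row_index_inj hz hk).1 h).1),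
        hother y' hy' z hz]

end Cmd

open SimpleGraph Steiner Cmd

/-- A pair of arrays for the labels of a shortest path computation: a vector of distances and a
matrix of paths. -/
structure PathArrays where
  dist : ℕ
  path : ℕ
  dist_ne_path : dist ≠ path
  dist_notMem : dist ∉ fixedArrs
  path_notMem : path ∉ fixedArrs

variable {n : ℕ} {w : Fin n → ℕ} {F : SimpleGraph (Fin n)} {src y : Fin n} {cond : Expr}
  {A : PathArrays} {s t : State}

namespace PathArrays

/-- The labels stored in a pair of arrays. -/
def labels (A : PathArrays) (n : ℕ) (s : State) : Labelling (Fin n) where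
  dist x := s.arr A.dist x
  path x := rowMask n s A.path x

/-- The states differ at most in the memory that a shortest path computation writes. -/
abbrev Agree (A : PathArrays) : State → State → Prop :=
  State.Agree [Reg.pass, Reg.tail, Reg.head, Reg.column] [A.dist, A.path]

theorem Agree.layout (h : A.Agree s t) (hs : Layout w s) : Layout w t := by
  refine hs.agree h (by decide) fun a ha h => ?_
  rcases List.mem_cons.1 h with rfl | h
  · exact A.dist_notMem ha
  · exact A.path_notMem (List.mem_singleton.1 h ▸ ha)

/-- In all states of a shortest path computation that starts in `s`, the expression `cond` decides
whether the vertices in the registers `tail` and `head` are adjacent. -/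
def Decides (A : PathArrays) (F : SimpleGraph (Fin n)) (cond : Expr) (s : State) : Prop :=
  ∀ t, A.Agree s t → ∀ a x : Fin n, t.reg Reg.tail = a → t.reg Reg.head = x →
    (cond.eval t ≠ 0 ↔ F.Adj a x)

end PathArrays

namespace Cmd

/-- Replace the path to the vertex `y` in the register `r` by `y` and the vertices where `e` is
nonzero. -/
def setPath (A : PathArrays) (r : ℕ) (e : Expr) : Cmd :=
  fillRow A.path r e ;; store A.path (.index 0 (.reg r) (.reg r)) 1

/-- The test whether relaxing the vertices in the registers `tail` and `head` changes a label. -/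
def improves (cond : Expr) (A : PathArrays) : Expr :=
  .and (.get A.dist (.reg Reg.tail)) (.and cond (.or (.not (.get A.dist (.reg Reg.head)))
    (.lt (.get A.dist (.reg Reg.tail) + .get Arr.weight (.reg Reg.head))
      (.get A.dist (.reg Reg.head)))))

/-- Relax the pair of vertices in the registers `tail` and `head`. -/
def relax (cond : Expr) (A : PathArrays) : Cmd :=
  ite (improves cond A)
    (store A.dist (.reg Reg.head)
        (.get A.dist (.reg Reg.tail) + .get Arr.weight (.reg Reg.head)) ;;
      setPath A Reg.head (.entry A.path 0 (.reg Reg.tail) (.reg Reg.column)))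
    skip

/-- Only the source is reached. -/
def initLabels (A : PathArrays) : Cmd :=
  fillArr A.dist 0 ;;
  store A.dist (.reg Reg.source) 1 ;;
  setPath A Reg.source 0

/-- Shortest paths with node weights from the vertex in the register `source`, where `cond` decides
whether the vertices in the registers `tail` and `head` are adjacent. -/
def bellmanFord (cond : Expr) (A : PathArrays) : Cmd :=
  initLabels A ;;
  loopTo Reg.pass Reg.n (loopTo Reg.tail Reg.n (loopTo Reg.head Reg.n (relax cond A)))

theorem bellmanFord_agree (cond : Expr) (A : PathArrays) (s : State) :
    A.Agree s ((bellmanFord cond A).run s) :=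
  (agree_run (bellmanFord cond A) s).mono
    (by simp [bellmanFord, initLabels, fillArr, relax, setPath, fillRow, regs])
    (by simp [bellmanFord, initLabels, fillArr, relax, setPath, fillRow, arrs])

theorem labels_run_setPath (hs : Layout w s) {r : ℕ} (hr : r ≠ Reg.column) (hy : s.reg r = y)
    {e : Expr} (f : ℕ → ℕ)
    (he : ∀ t, State.Agree [Reg.column] [A.path] s t →
      (∀ y' : Fin n, y' ≠ y → ∀ z < n, t.arr A.path (y' * n + z) = s.arr A.path (y' * n + z)) →
      t.reg Reg.column < n → e.eval t = f (t.reg Reg.column)) :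
    A.labels n ((setPath A r e).run s) = ⟨(A.labels n s).dist,
      Function.update (A.labels n s).path y (insert y (univ.filter fun z : Fin n => f z ≠ 0))⟩ := by
  have hrow := fillRow_arr hs A.path_notMem hr hy f he
  have hst : State.Agree [Reg.column] [A.path] s ((fillRow A.path r e).run s) :=
    agree_run (fillRow A.path r e) s
  have ht := hs.agree hst (by decide) fun b hb hba => A.path_notMem (List.mem_singleton.1 hba ▸ hb)
  rw [setPath, run_seq]
  generalize (fillRow A.path r e).run s = t at *
  have hyt : (Expr.reg r).eval t = y := (hst.reg r (List.mem_singleton.not.2 hr)).trans hy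
  rw [run_store, ht.eval_index hyt, hyt, Expr.eval_zero, Expr.eval_one, zero_add]
  simp only [PathArrays.labels, State.setArr_arr_of_ne t A.dist_ne_path,
    hst.arr A.dist (List.mem_singleton.not.2 A.dist_ne_path), Labelling.mk.injEq, true_and]
  ext y' z
  simp only [mem_rowMask, State.setArr_arr_self, Function.update_apply,
    row_index_inj z.is_lt y.is_lt, hrow y' z z.is_lt, Fin.val_inj]
  by_cases hyy : y' = y
  · simp only [hyy, true_and, if_true, mem_insert, mem_filter_univ]
    by_cases hz : z = y <;> simp [hz]
  · simp only [hyy, false_and, if_false, mem_rowMask]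

theorem eval_improves_ne_zero (hs : Layout w s) {a x : Fin n} (ha : s.reg Reg.tail = a)
    (hx : s.reg Reg.head = x) (hcond : cond.eval s ≠ 0 ↔ F.Adj a x) :
    (improves cond A).eval s ≠ 0 ↔ (A.labels n s).dist a ≠ 0 ∧ F.Adj a x ∧
      (¬ (A.labels n s).dist x ≠ 0 ∨
        (A.labels n s).dist a + w x < (A.labels n s).dist x) := by
  simp only [improves, Expr.eval_and_ne_zero, Expr.eval_or_ne_zero, Expr.eval_not_ne_zero,
    Expr.eval_lt_ne_zero, hcond, Expr.eval_get, Expr.eval_add, Expr.eval_reg, ha, hx, hs.weight,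
    PathArrays.labels]

theorem labels_run_relax (hs : Layout w s) {a x : Fin n} (ha : s.reg Reg.tail = a)
    (hx : s.reg Reg.head = x) (hcond : cond.eval s ≠ 0 ↔ F.Adj a x) :
    A.labels n ((relax cond A).run s) = (A.labels n s).relax F w a x := by
  have htest := eval_improves_ne_zero (A := A) hs ha hx hcond
  rw [relax, Labelling.relax]
  split_ifs with h
  swap
  · rw [run_ite_neg (htest.not.2 h), run_skip]
  have hax := h.2.1.ne
  rw [run_ite_pos (htest.2 h), run_seq, run_store]
  simp only [Expr.eval_add, Expr.eval_get, Expr.eval_reg, ha, hx, hs.weight]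
  have hst : A.Agree s (s.setArr A.dist x (s.arr A.dist a + w x)) :=
    (State.agree_setArr s _ _ _).mono (List.nil_subset _) (by simp)
  have hpath := State.setArr_arr_of_ne s (i := x) (v := s.arr A.dist a + w x) A.dist_ne_path.symm
  rw [labels_run_setPath (hst.layout hs) (by decide) hx fun z => s.arr A.path (a * n + z)]
  · simp only [PathArrays.labels, rowMask, hpath, State.setArr_arr_self, Labelling.mk.injEq]
    exact ⟨funext fun z => by simp only [Function.update_apply, Fin.val_inj], trivial⟩
  · intro t ht hrow hcolumn
    have hta : (Expr.reg Reg.tail).eval t = a := (ht.reg Reg.tail).trans ha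
    have htl := (hst.layout hs).agree ht (by decide) fun b hb hba =>
      A.path_notMem (List.mem_singleton.1 hba ▸ hb)
    rw [Expr.entry, Expr.eval_get, htl.eval_index hta, Expr.eval_zero, zero_add, Expr.eval_reg,
      hrow a hax _ hcolumn, hpath]

theorem relaxedOn_run_relax_row (hs : Layout w s) (hcond : A.Decides F cond s) {a : Fin n}
    (ha : s.reg Reg.tail = a) :
    Labelling.RelaxedOn F w src (fun a' _ => a' = a) (A.labels n s)
      (A.labels n ((loopTo Reg.head Reg.n (relax cond A)).run s)) := by
  have hloop := loopTo_induction (s := s) (r := Reg.head) (b := Reg.n) (p := relax cond A)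
    (fun k t => Labelling.RelaxedOn F w src (fun a' x => a' = a ∧ (x : ℕ) < k) (A.labels n s)
      (A.labels n t)) (fun _ _ _ h => h) ((Labelling.RelaxedOn.refl _).mono (by simp)) ?_
  · rw [hs.reg_n] at hloop
    exact hloop.mono fun a' x h => ⟨h, x.is_lt⟩
  · intro k hk t hst hkt hrel
    rw [hs.reg_n] at hk
    have hst' : A.Agree s t := hst.mono (by simp [relax, setPath, fillRow, regs])
      (by simp [relax, setPath, fillRow, arrs])
    have hta : t.reg Reg.tail = a :=
      (hst.reg Reg.tail (by simp [relax, setPath, fillRow, regs])).trans ha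
    rw [labels_run_relax (x := ⟨k, hk⟩) (hst'.layout hs) hta hkt (hcond t hst' a _ hta hkt)]
    refine (hrel.trans (Labelling.relaxedOn_relax _ _ _)).mono ?_
    rintro a' x ⟨rfl, hx⟩
    exact (Nat.lt_succ_iff_lt_or_eq.1 hx).imp (⟨rfl, ·⟩) (⟨rfl, Fin.ext ·⟩)

theorem relaxedOn_run_relax_round (hs : Layout w s) (hcond : A.Decides F cond s) :
    Labelling.RelaxedOn F w src (fun _ _ => True) (A.labels n s)
      (A.labels n ((loopTo Reg.tail Reg.n (loopTo Reg.head Reg.n (relax cond A))).run s)) := by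
  have hloop := loopTo_induction (s := s) (r := Reg.tail) (b := Reg.n)
    (p := loopTo Reg.head Reg.n (relax cond A))
    (fun k t => Labelling.RelaxedOn F w src (fun a' _ => (a' : ℕ) < k) (A.labels n s)
      (A.labels n t)) (fun _ _ _ h => h) ((Labelling.RelaxedOn.refl _).mono (by simp)) ?_
  · rw [hs.reg_n] at hloop
    exact hloop.mono fun a' _ _ => a'.is_lt
  · intro k hk t hst hkt hrel
    rw [hs.reg_n] at hk
    have hst' : A.Agree s t := hst.mono (by simp [relax, setPath, fillRow, regs])
      (by simp [relax, setPath, fillRow, arrs])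
    refine (hrel.trans (relaxedOn_run_relax_row (a := ⟨k, hk⟩) (hst'.layout hs)
      (fun u hu => hcond u (hst'.trans hu)) hkt)).mono fun a' _ h => ?_
    exact (Nat.lt_succ_iff_lt_or_eq.1 h).imp id (Fin.ext ·)

theorem isInitial_run_initLabels (hs : Layout w s) (hsrc : s.reg Reg.source = src) :
    Labelling.IsInitial src (A.labels n ((initLabels A).run s)) := by
  have hclear (x : Fin n) : ((fillArr A.dist 0).run s).arr A.dist x = 0 :=
    fillArr_arr (fun _ => 0) (fun _ _ _ => Expr.eval_zero) (hs.reg_n ▸ x.is_lt)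
  have hst : A.Agree s ((fillArr A.dist 0).run s) :=
    (agree_run (fillArr A.dist 0) s).mono
      (rs := [Reg.column]) (as := [A.dist]) (by decide) (by simp)
  rw [initLabels, run_seq, run_seq]
  generalize (fillArr A.dist 0).run s = t at *
  have hsrc' : t.reg Reg.source = src := (hst.reg Reg.source).trans hsrc
  have hst' : A.Agree t (t.setArr A.dist src 1) :=
    (State.agree_setArr t _ _ _).mono (List.nil_subset _) (by simp)
  rw [run_store, Expr.eval_reg, hsrc', Expr.eval_one,
    labels_run_setPath (hst'.layout (hst.layout hs)) (by decide) hsrc' (fun _ => 0)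
      fun _ _ _ _ => Expr.eval_zero]
  refine ⟨fun x => ?_, ?_⟩
  · simp only [PathArrays.labels, State.setArr_arr_self, Function.update_apply, Fin.val_inj, hclear]
  · simp

theorem isShortest_run_bellmanFord (hs : Layout w s) (hsrc : s.reg Reg.source = src)
    (hcond : A.Decides F cond s) :
    Labelling.IsShortest F w src (A.labels n ((bellmanFord cond A).run s)) := by
  have hinit := isInitial_run_initLabels (A := A) hs hsrc
  have hst : A.Agree s ((initLabels A).run s) :=
    (agree_run (initLabels A) s).mono (by simp [initLabels, fillArr, setPath, fillRow, regs])
      (by simp [initLabels, fillArr, setPath, fillRow, arrs])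
  rw [bellmanFord, run_seq]
  generalize (initLabels A).run s = t at *
  have hloop := loopTo_induction (s := t) (r := Reg.pass) (b := Reg.n)
    (p := loopTo Reg.tail Reg.n (loopTo Reg.head Reg.n (relax cond A)))
    (fun k t => Labelling.Sound F w src (A.labels n t) ∧
      ∀ x (p : F.Walk x src), p.length ≤ k →
        (A.labels n t).dist x ≠ 0 ∧ w src + (A.labels n t).dist x ≤ (p.support.map w).sum + 1)
    (fun _ _ _ h => h) ⟨hinit.sound, hinit.le_walk⟩ ?_
  · rw [(hst.layout hs).reg_n] at hloop
    exact hloop.1.isShortest (by simpa using hloop.2)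
  · intro k _ u htu _ ⟨hsound, hwalk⟩
    have hsu : A.Agree s u := hst.trans (htu.mono (by simp [relax, setPath, fillRow, regs])
      (by simp [relax, setPath, fillRow, arrs]))
    have hround := relaxedOn_run_relax_round (src := src) (hsu.layout hs)
      fun v hv => hcond v (hsu.trans hv)
    exact ⟨hround.sound hsound, hround.le_walk hwalk⟩

end Cmd

namespace Reg

abbrev factor : ℕ := 10
abbrev multiplier : ℕ := 11
abbrev product : ℕ := 12
abbrev bit : ℕ := 13
abbrev edgeTail : ℕ := 30
abbrev edgeHead : ℕ := 31
abbrev count : ℕ := 32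

end Reg

namespace Expr

/-- The entry `(i, j)` of the adjacency matrix of the graph. -/
def adj (i j : Expr) : Expr := entry Arr.input 1 i j

/-- The entry `(i, j)` of the adjacency matrix of the tree. -/
def treeAdj (i j : Expr) : Expr := entry Arr.input (1 + .reg Reg.square) i j

/-- The indicator of the terminals. -/
def terminal (i : Expr) : Expr := .get Arr.input (1 + .reg Reg.square + .reg Reg.square + i)

end Expr

/-- The memory holds the instance `I`. The register `bits` contains the number `B` of rounds of the
algorithm, which is also the number of rounds of a multiplication. -/
structure Input (I : NWSTAP) (B : ℕ) (s : State) : Prop where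
  reg_n : s.reg Reg.n = I.n
  reg_bits : s.reg Reg.bits = B
  adj (u v : Fin I.n) : s.arr Arr.input (1 + u * I.n + v) ≠ 0 ↔ I.G.Adj u v
  tree (u v : Fin I.n) : s.arr Arr.input (1 + I.n * I.n + u * I.n + v) ≠ 0 ↔ I.T.Adj u v
  terminal (v : Fin I.n) : s.arr Arr.input (1 + I.n * I.n + I.n * I.n + v) ≠ 0 ↔ v ∈ I.R
  num (v : Fin I.n) : s.arr Arr.input (1 + I.n * I.n + I.n * I.n + I.n + (v + v)) = (I.c v).num
  den (v : Fin I.n) : s.arr Arr.input (1 + I.n * I.n + I.n * I.n + I.n + (v + v) + 1) = (I.c v).den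

/-- The memory holds the instance `I` and the data derived from it. -/
structure Loaded (I : NWSTAP) (w : Fin I.n → ℕ) (B : ℕ) (s : State) : Prop
    extends Layout w s, Input I B s where
  reg_square : s.reg Reg.square = I.n * I.n

variable {I : NWSTAP} {w : Fin I.n → ℕ} {B q : ℕ} {s t : State} {i j : Expr} {a b : Fin I.n}

theorem Input.agree {rs as : List ℕ} (h : Input I B s) (hst : s.Agree rs as t)
    (hr : ∀ r ∈ [Reg.n, Reg.bits], r ∉ rs := by decide) (ha : Arr.input ∉ as := by decide) :
    Input I B t where
  reg_n := (hst.reg _ (hr _ (by decide))).trans h.reg_n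
  reg_bits := (hst.reg _ (hr _ (by decide))).trans h.reg_bits
  adj := by rw [hst.arr _ ha]; exact h.adj
  tree := by rw [hst.arr _ ha]; exact h.tree
  terminal := by rw [hst.arr _ ha]; exact h.terminal
  num := by rw [hst.arr _ ha]; exact h.num
  den := by rw [hst.arr _ ha]; exact h.den

namespace Loaded

theorem agree {rs as : List ℕ} (h : Loaded I w B s) (hst : s.Agree rs as t)
    (hr : ∀ r ∈ fixedRegs, r ∉ rs := by decide) (ha : ∀ a ∈ fixedArrs, a ∉ as := by decide) :
    Loaded I w B t where
  __ := h.toLayout.agree hst hr ha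
  __ := h.toInput.agree hst (fun r hrs => hr r (List.mem_append_left [Reg.square] hrs))
    (ha _ (by decide))
  reg_square := (hst.reg _ (hr _ (by decide))).trans h.reg_square

theorem eval_adj (h : Loaded I w B s) (ha : i.eval s = a) (hb : j.eval s = b) :
    (Expr.adj i j).eval s ≠ 0 ↔ I.G.Adj a b := by
  rw [Expr.adj, Expr.entry, Expr.eval_get, h.eval_index ha, hb, Expr.eval_one, h.adj]

theorem eval_treeAdj (h : Loaded I w B s) (ha : i.eval s = a) (hb : j.eval s = b) :
    (Expr.treeAdj i j).eval s ≠ 0 ↔ I.T.Adj a b := by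
  rw [Expr.treeAdj, Expr.entry, Expr.eval_get, h.eval_index ha, hb, Expr.eval_add, Expr.eval_one,
    Expr.eval_reg, h.reg_square, h.tree]

theorem eval_terminal (h : Loaded I w B s) (ha : i.eval s = a) :
    (Expr.terminal i).eval s ≠ 0 ↔ a ∈ I.R := by
  simp only [Expr.terminal, Expr.eval_get, Expr.eval_add, Expr.eval_one, Expr.eval_reg, ha,
    h.reg_square, h.terminal]

end Loaded

namespace Cmd

/-- One round of the binary multiplication. -/
def mulStep : Cmd :=
  ite (.reg Reg.multiplier - (.half (.reg Reg.multiplier) + .half (.reg Reg.multiplier)))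
    (assign Reg.product (.reg Reg.product + .reg Reg.factor)) skip ;;
  assign Reg.factor (.reg Reg.factor + .reg Reg.factor) ;;
  assign Reg.multiplier (.half (.reg Reg.multiplier))

/-- Multiply the registers `factor` and `multiplier` bit by bit. -/
def mul : Cmd :=
  assign Reg.product 0 ;; loopTo Reg.bit Reg.bits mulStep

theorem mulStep_run (s : State) :
    (mulStep.run s).reg Reg.factor = s.reg Reg.factor + s.reg Reg.factor ∧
      (mulStep.run s).reg Reg.multiplier = s.reg Reg.multiplier / 2 ∧
      (mulStep.run s).reg Reg.product =
        s.reg Reg.product + s.reg Reg.factor * (s.reg Reg.multiplier % 2) := by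
  rw [mulStep, run_seq]
  by_cases hodd : Expr.eval s (.reg Reg.multiplier -
      (.half (.reg Reg.multiplier) + .half (.reg Reg.multiplier))) ≠ 0
  · have hmod : s.reg Reg.multiplier % 2 = 1 := by
      simp only [Expr.eval_sub, Expr.eval_add, Expr.eval_half, Expr.eval_reg] at hodd
      omega
    rw [run_ite_pos hodd]
    simp [hmod]
  · have hmod : s.reg Reg.multiplier % 2 = 0 := by
      simp only [Expr.eval_sub, Expr.eval_add, Expr.eval_half, Expr.eval_reg] at hodd
      omega
    rw [run_ite_neg hodd]
    simp [hmod]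

theorem mul_run (hs : s.reg Reg.multiplier < 2 ^ s.reg Reg.bits) :
    (mul.run s).reg Reg.product = s.reg Reg.factor * s.reg Reg.multiplier := by
  have hloop := loopTo_induction (s := s.setReg Reg.product 0) (r := Reg.bit) (b := Reg.bits)
    (p := mulStep)
    (fun k t => t.reg Reg.multiplier = s.reg Reg.multiplier / 2 ^ k ∧
      t.reg Reg.product + t.reg Reg.factor * t.reg Reg.multiplier =
        s.reg Reg.factor * s.reg Reg.multiplier)
    (fun k t v h => by simpa using h) (by simp) ?_
  · obtain ⟨hzero, hprod⟩ := hloop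
    rw [show (s.setReg Reg.product 0).reg Reg.bits = s.reg Reg.bits by simp,
      Nat.div_eq_of_lt hs] at hzero
    rw [hzero, mul_zero, add_zero] at hprod
    exact hprod
  · intro k _ t _ _ ⟨hdiv, hprod⟩
    obtain ⟨hfactor, hmultiplier, hproduct⟩ := mulStep_run t
    refine ⟨by rw [hmultiplier, hdiv, Nat.div_div_eq_div_mul, pow_succ], ?_⟩
    rw [hfactor, hmultiplier, hproduct, ← hprod]
    conv_rhs => rw [← Nat.div_add_mod (t.reg Reg.multiplier) 2]
    ring

theorem reg_run_loopTo_eq_add_sum {n c r b : ℕ} {p : Cmd} (f : Fin n → ℕ)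
    (hb : s.reg b = n) (hc : c ≠ r)
    (hstep : ∀ x : Fin n, ∀ t, State.Agree (r :: p.regs) p.arrs s t → t.reg r = x →
      (p.run t).reg c = t.reg c + f x) :
    ((loopTo r b p).run s).reg c = s.reg c + ∑ x, f x := by
  refine loopTo_induction_univ (p := p) (r := r) hb (fun K t => t.reg c = s.reg c + ∑ x ∈ K, f x)
    (fun K t v h => by rwa [State.setReg_reg, if_neg hc]) (by simp) fun x K t hx hst hxt h => ?_
  rw [hstep x t hst hxt, h, sum_insert hx, add_assoc, add_comm (f x)]

/-- The arrays for the shortest paths in the current subgraph without one tree edge. -/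
def reachPaths : PathArrays := ⟨6, 7, by decide, by decide, by decide⟩

/-- The vertices in the registers `tail` and `head` are adjacent in the subgraph induced by the set
in the array `q`, and the edge between them is not the one between `edgeTail` and `edgeHead`. -/
def reachCond (q : ℕ) : Expr :=
  .and (.adj (.reg Reg.tail) (.reg Reg.head)) (.and (.get q (.reg Reg.tail))
    (.and (.get q (.reg Reg.head)) (.not (.or
      (.and (.eq (.reg Reg.tail) (.reg Reg.edgeTail)) (.eq (.reg Reg.head) (.reg Reg.edgeHead)))
      (.and (.eq (.reg Reg.tail) (.reg Reg.edgeHead))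
        (.eq (.reg Reg.head) (.reg Reg.edgeTail)))))))

/-- Count the tree edge between `edgeTail` and `edgeHead` if the set in the array `q` covers it. -/
def countEdge (q : ℕ) : Cmd :=
  assign Reg.source (.reg Reg.edgeTail) ;;
  bellmanFord (reachCond q) reachPaths ;;
  ite (.and (.treeAdj (.reg Reg.edgeTail) (.reg Reg.edgeHead))
      (.get reachPaths.dist (.reg Reg.edgeHead)))
    (assign Reg.count (.reg Reg.count + 1)) skip

/-- Count the tree edges that are covered by the set in the array `q`. -/
def countCovered (q : ℕ) : Cmd :=
  assign Reg.count 0 ;; loopTo Reg.edgeTail Reg.n (loopTo Reg.edgeHead Reg.n (countEdge q))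

/-- The states differ at most in the memory that `countCovered` writes. -/
abbrev CountAgree : State → State → Prop :=
  State.Agree [Reg.source, Reg.pass, Reg.tail, Reg.head, Reg.column, Reg.edgeTail, Reg.edgeHead,
    Reg.count] [reachPaths.dist, reachPaths.path]

theorem countCovered_agree (q : ℕ) (s : State) : CountAgree s ((countCovered q).run s) :=
  (agree_run (countCovered q) s).mono
    (by simp [countCovered, countEdge, bellmanFord, initLabels, fillArr, relax, setPath, fillRow,
      regs])
    (by simp [countCovered, countEdge, bellmanFord, initLabels, fillArr, relax, setPath, fillRow,
      arrs])

theorem reachCond_decides (hs : Loaded I w B s) (hq : q ∉ [reachPaths.dist, reachPaths.path])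
    (ha : s.reg Reg.edgeTail = a) (hb : s.reg Reg.edgeHead = b) :
    reachPaths.Decides (within (I.G.deleteEdges {s(a, b)}) (mask I.n s q)) (reachCond q) s := by
  intro t hst u x hu hx
  have ht := hs.agree hst
  simp only [reachCond, Expr.eval_and_ne_zero, Expr.eval_not_ne_zero, Expr.eval_or_ne_zero,
    Expr.eval_eq_ne_zero, ht.eval_adj (i := .reg Reg.tail) (j := .reg Reg.head) hu hx,
    Expr.eval_get, Expr.eval_reg, hu, hx, (hst.reg Reg.edgeTail).trans ha,
    (hst.reg Reg.edgeHead).trans hb, hst.arr q hq, ← mem_mask (n := I.n), Fin.val_inj]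
  simp only [within, deleteEdges_adj, Set.mem_singleton_iff, Sym2.eq_iff]
  tauto

open Classical in
theorem count_run_countEdge (hs : Loaded I w B s)
    (hq : q ∉ [reachPaths.dist, reachPaths.path]) (ha : s.reg Reg.edgeTail = a)
    (hb : s.reg Reg.edgeHead = b) :
    ((countEdge q).run s).reg Reg.count =
      s.reg Reg.count + if (a, b) ∈ I.covered (mask I.n s q) then 1 else 0 := by
  rw [countEdge, run_seq, run_seq, run_assign, Expr.eval_reg, ha]
  have hst : State.Agree [Reg.source] [] s (s.setReg Reg.source a) := State.agree_setReg _ _ _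
  have ha' := (hst.reg Reg.edgeTail).trans ha
  have hb' := (hst.reg Reg.edgeHead).trans hb
  have hshort := isShortest_run_bellmanFord (src := a) (hs.agree hst).toLayout (by simp)
    (reachCond_decides (hs.agree hst) hq ha' hb')
  rw [mask_congr (hst.arr q (by simp))] at hshort
  have hfu : reachPaths.Agree (s.setReg Reg.source a)
      ((bellmanFord (reachCond q) reachPaths).run (s.setReg Reg.source a)) :=
    bellmanFord_agree _ _ _
  have hsu : CountAgree s ((bellmanFord (reachCond q) reachPaths).run (s.setReg Reg.source a)) :=
    hst.mono.trans hfu.mono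
  generalize (bellmanFord (reachCond q) reachPaths).run (s.setReg Reg.source a) = u at *
  have hcount : u.reg Reg.count = s.reg Reg.count := (hfu.reg Reg.count).trans (by simp)
  have hcov : Expr.eval u (.and (.treeAdj (.reg Reg.edgeTail) (.reg Reg.edgeHead))
      (.get reachPaths.dist (.reg Reg.edgeHead))) ≠ 0 ↔ (a, b) ∈ I.covered (mask I.n s q) := by
    have hu := hs.agree hsu
    rw [Expr.eval_and_ne_zero,
      hu.eval_treeAdj (i := .reg Reg.edgeTail) (j := .reg Reg.edgeHead)
        ((hfu.reg Reg.edgeTail).trans ha') ((hfu.reg Reg.edgeHead).trans hb'),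
      Expr.eval_get, Expr.eval_reg, (hfu.reg Reg.edgeHead).trans hb', NWSTAP.mem_covered]
    exact and_congr_right fun _ => hshort.dist_ne_zero_iff b
  split_ifs with h
  · rw [run_ite_pos (hcov.2 h), run_assign, State.setReg_reg, if_pos rfl, Expr.eval_add,
      Expr.eval_reg, Expr.eval_one, hcount]
  · rw [run_ite_neg (hcov.not.2 h), run_skip, hcount, add_zero]

theorem count_run_countCovered (hs : Loaded I w B s)
    (hq : q ∉ [reachPaths.dist, reachPaths.path]) :
    ((countCovered q).run s).reg Reg.count = #(I.covered (mask I.n s q)) := by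
  classical
  have hzero : CountAgree s (s.setReg Reg.count 0) := (State.agree_setReg _ _ _).mono
  have hrows := reg_run_loopTo_eq_add_sum (s := s.setReg Reg.count 0) (c := Reg.count)
    (r := Reg.edgeTail) (b := Reg.n) (p := loopTo Reg.edgeHead Reg.n (countEdge q))
    (fun a : Fin I.n => ∑ b, if (a, b) ∈ I.covered (mask I.n s q) then 1 else 0)
    (hs.agree hzero).reg_n (by decide) ?_
  · rw [countCovered, run_seq, run_assign, Expr.eval_zero, hrows, State.setReg_reg, if_pos rfl,
      zero_add, ← Fintype.sum_prod_type', sum_boole, filter_mem_eq_inter, univ_inter, Nat.cast_id]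
  · intro a t hst hat
    have hst' : CountAgree s t := hzero.trans (hst.mono
      (by simp [countEdge, bellmanFord, initLabels, fillArr, relax, setPath, fillRow, regs])
      (by simp [countEdge, bellmanFord, initLabels, fillArr, relax, setPath, fillRow, arrs]))
    refine reg_run_loopTo_eq_add_sum _ (hs.agree hst').reg_n (by decide) fun b u htu hbu => ?_
    have hsu : CountAgree s u := hst'.trans (htu.mono
      (by simp [countEdge, bellmanFord, initLabels, fillArr, relax, setPath, fillRow, regs])
      (by simp [countEdge, bellmanFord, initLabels, fillArr, relax, setPath, fillRow, arrs]))
    have hau : u.reg Reg.edgeTail = a := (htu.reg Reg.edgeTail (by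
      simp [countEdge, bellmanFord, initLabels, fillArr, relax, setPath, fillRow, regs])).trans hat
    rw [count_run_countEdge (hs.agree hsu) hq hau hbu, mask_congr (hsu.arr q hq)]

end Cmd

end RAM

/-! ### Greedy spiders -/

namespace NWSTAP

open Finset SimpleGraph Steiner

section Spiders

variable (I : NWSTAP) (w : Fin I.n → ℕ) (lam : ℕ)

/-- The construction of a spider with center `v` and first foot `r` on top of `M`, after the feet
below `k` have been tried: `Q` is the current set and `c` its additional cost. Every foot has paid
at most `lam` for each edge it covered, and the feet that were left out would not have. -/
structure PartialSpider (v r : Fin I.n) (M : Finset (Fin I.n)) (k : ℕ) (Q : Finset (Fin I.n))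
    (c : ℕ) : Prop where
  subset : M ⊆ Q
  center_mem : v ∈ Q
  reachable : (within I.links Q).Reachable v r
  weight_le : ∑ x ∈ Q, w x ≤ ∑ x ∈ M, w x + c
  cost_le : c ≤ w v + nodeDist I.links w v r + lam * (#(I.covered Q) - #(I.covered M))
  crossed_le : ∀ y ∈ I.R, (y : ℕ) < k → I.links.Reachable v y →
    lam * #(I.crossed Q {r, y}) ≤ nodeDist I.links w v y

/-- The set `M'` contains `M` and has paid at most `2 * lam` for each newly covered edge. -/
def Grows (M M' : Finset (Fin I.n)) : Prop :=
  M ⊆ M' ∧ ∑ x ∈ M', w x ≤ ∑ x ∈ M, w x + 2 * lam * (#(I.covered M') - #(I.covered M))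

/-- No spider with center `v` and a foot `r` covers edges that `M` leaves uncovered at a cost of
less than `lam` per edge. -/
def Saturated (v r : Fin I.n) (M : Finset (Fin I.n)) : Prop :=
  ∀ Y ⊆ I.R, r ∈ Y → (∀ y ∈ Y, I.links.Reachable v y) →
    lam * #(I.crossed M Y) ≤ w v + ∑ y ∈ Y, nodeDist I.links w v y

variable {I w lam} {M M' M'' P Q Y : Finset (Fin I.n)} {v r y : Fin I.n} {k c : ℕ}

theorem card_covered_le (M : Finset (Fin I.n)) : #(I.covered M) ≤ I.n * I.n := by
  have hcover := card_covered_add_card_uncovered M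
  have hle := card_uncovered_le (I := I) ∅
  have hR : #I.R ^ 2 ≤ I.n ^ 2 := Nat.pow_le_pow_left (by simpa using card_le_univ I.R) 2
  rw [← sq]
  omega

theorem card_covered_sub_add_sub (hMQ : M ⊆ M') (hQ : M' ⊆ M'') :
    #(I.covered M'') - #(I.covered M) =
      (#(I.covered M') - #(I.covered M)) + (#(I.covered M'') - #(I.covered M')) := by
  have hle := card_le_card (covered_mono hMQ)
  have hle' := card_le_card (covered_mono hQ)
  omega

theorem Grows.refl (M : Finset (Fin I.n)) : I.Grows w lam M M := ⟨subset_rfl, by omega⟩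

theorem Grows.trans (h : I.Grows w lam M M') (h' : I.Grows w lam M' M'') :
    I.Grows w lam M M'' := by
  refine ⟨h.1.trans h'.1, ?_⟩
  rw [card_covered_sub_add_sub h.1 h'.1, mul_add, ← add_assoc]
  exact h'.2.trans (Nat.add_le_add_right h.2 _)

theorem Saturated.mono (h : I.Saturated w lam v r M) (hM : M ⊆ M') : I.Saturated w lam v r M' :=
  fun Y hY hr hreach => (Nat.mul_le_mul_left _ (card_le_card (crossed_anti hM))).trans
    (h Y hY hr hreach)

theorem Grows.round (h : I.Grows w lam M M') (hsat : ∀ v r, I.Saturated w lam v r M') :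
    I.Round w lam M M' where
  subset := h.1
  weight_le := h.2
  spider_le := fun v Y hY ⟨r, hr⟩ hreach => hsat v r Y hY hr hreach

theorem weight_union_le (hv : v ∈ Q) (hvP : v ∈ P) (hP : ∑ x ∈ P, w x ≤ w v + c) :
    ∑ x ∈ Q ∪ P, w x ≤ ∑ x ∈ Q, w x + c := by
  have hinter : w v ≤ ∑ x ∈ Q ∩ P, w x :=
    single_le_sum (f := w) (fun _ _ => Nat.zero_le _) (mem_inter.2 ⟨hv, hvP⟩)
  have hsum := sum_union_inter (s₁ := Q) (s₂ := P) (f := w)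
  omega

namespace PartialSpider

theorem init (hP : ConnectedOn I.links P) (hv : v ∈ P) (hr : r ∈ P)
    (hPw : ∑ x ∈ P, w x ≤ w v + nodeDist I.links w v r) :
    I.PartialSpider w lam v r M 0 (M ∪ P) (w v + nodeDist I.links w v r) where
  subset := subset_union_left
  center_mem := mem_union_right _ hv
  reachable := (hP v hv r hr).mono (within_mono le_rfl subset_union_right)
  weight_le := by
    have hsum := sum_union_inter (s₁ := M) (s₂ := P) (f := w)
    omega
  cost_le := Nat.le_add_right _ _
  crossed_le := fun _ _ h => absurd h (Nat.not_lt_zero _)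

theorem advance (h : I.PartialSpider w lam v r M y Q c)
    (hy : y ∈ I.R → I.links.Reachable v y →
      lam * #(I.crossed Q {r, y}) ≤ nodeDist I.links w v y) :
    I.PartialSpider w lam v r M (y + 1) Q c where
  __ := h
  crossed_le := fun z hz hzk hzr => by
    rcases eq_or_ne z y with rfl | hne
    · exact hy hz hzr
    · exact h.crossed_le z hz (by have := Fin.val_ne_of_ne hne; omega) hzr

theorem reachable_foot (h : I.PartialSpider w lam v r M k Q c) (hP : ConnectedOn I.links P)
    (hv : v ∈ P) (hy : y ∈ P) : (within I.links (Q ∪ P)).Reachable r y :=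
  (h.reachable.mono (within_mono le_rfl subset_union_left)).symm.trans
    ((hP v hv y hy).mono (within_mono le_rfl subset_union_right))

theorem addFoot (h : I.PartialSpider w lam v r M k Q c) (hv : v ∈ P)
    (hPw : ∑ x ∈ P, w x ≤ w v + nodeDist I.links w v y)
    (hacc : nodeDist I.links w v y ≤ lam * (#(I.covered (Q ∪ P)) - #(I.covered Q))) :
    I.PartialSpider w lam v r M k (Q ∪ P) (c + nodeDist I.links w v y) where
  subset := h.subset.trans subset_union_left
  center_mem := mem_union_left _ h.center_mem
  reachable := h.reachable.mono (within_mono le_rfl subset_union_left)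
  weight_le := by
    rw [← add_assoc]
    exact (weight_union_le h.center_mem hv hPw).trans (Nat.add_le_add_right h.weight_le _)
  cost_le := by
    rw [card_covered_sub_add_sub h.subset subset_union_left, mul_add, ← add_assoc]
    exact Nat.add_le_add h.cost_le hacc
  crossed_le := fun z hz hzk hzr =>
    (Nat.mul_le_mul_left _ (card_le_card (crossed_anti subset_union_left))).trans
      (h.crossed_le z hz hzk hzr)

theorem accept (h : I.PartialSpider w lam v r M y Q c) (hM : I.R ⊆ M) (hr : r ∈ I.R)
    (hP : ConnectedOn I.links P) (hv : v ∈ P) (hy : y ∈ P)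
    (hPw : ∑ x ∈ P, w x ≤ w v + nodeDist I.links w v y)
    (hacc : nodeDist I.links w v y ≤ lam * (#(I.covered (Q ∪ P)) - #(I.covered Q))) :
    I.PartialSpider w lam v r M (y + 1) (Q ∪ P) (c + nodeDist I.links w v y) :=
  (h.addFoot hv hPw hacc).advance fun hyR _ => by
    rw [crossed_pair_eq_empty (hM.trans (h.subset.trans subset_union_left)) hr hyR
      (h.reachable_foot hP hv hy), card_empty, mul_zero]
    exact Nat.zero_le _

theorem reject (h : I.PartialSpider w lam v r M y Q c) (hM : I.R ⊆ M) (hr : r ∈ I.R)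
    (hP : ConnectedOn I.links P) (hv : v ∈ P) (hy : y ∈ P)
    (hrej : ¬ nodeDist I.links w v y ≤ lam * (#(I.covered (Q ∪ P)) - #(I.covered Q))) :
    I.PartialSpider w lam v r M (y + 1) Q c :=
  h.advance fun hyR _ => (Nat.mul_le_mul_left lam (card_crossed_pair_le subset_union_left
    (hM.trans h.subset) hr hyR (h.reachable_foot hP hv hy))).trans (not_le.1 hrej).le

theorem mul_card_crossed_le (h : I.PartialSpider w lam v r M I.n Q c) (hY : Y ⊆ I.R)
    (hreach : ∀ y ∈ Y, I.links.Reachable v y) :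
    lam * #(I.crossed Q Y) ≤ ∑ y ∈ Y.erase r, nodeDist I.links w v y := by
  refine (Nat.mul_le_mul_left _ (card_crossed_le_sum Q Y r)).trans ?_
  rw [mul_sum]
  exact sum_le_sum fun y hy =>
    h.crossed_le y (hY (mem_of_mem_erase hy)) y.2 (hreach y (mem_of_mem_erase hy))

theorem grows (h : I.PartialSpider w lam v r M k Q c)
    (hacc : c ≤ 2 * lam * (#(I.covered Q) - #(I.covered M))) : I.Grows w lam M Q :=
  ⟨h.subset, h.weight_le.trans (Nat.add_le_add_left hacc _)⟩

theorem saturated (h : I.PartialSpider w lam v r M I.n Q c) : I.Saturated w lam v r Q :=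
  fun _ hY _ hreach => (h.mul_card_crossed_le hY hreach).trans
    ((sum_le_sum_of_subset (erase_subset _ _)).trans (Nat.le_add_left _ _))

/-- A complete spider that costs more than `2 * lam` per covered edge has a center and a first foot
that cost more than `lam` per covered edge, so `M` was saturated before it was built. -/
theorem saturated_of_lt (h : I.PartialSpider w lam v r M I.n Q c)
    (hrej : ¬ c ≤ 2 * lam * (#(I.covered Q) - #(I.covered M))) : I.Saturated w lam v r M := by
  intro Y hY hr hreach
  have hQ := h.mul_card_crossed_le hY hreach
  have hsum := add_sum_erase Y (fun y => nodeDist I.links w v y) hr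
  have hM := Nat.mul_le_mul_left lam (card_crossed_le_add (Y := Y) h.subset)
  have hcost := h.cost_le
  rw [mul_add] at hM
  rw [mul_assoc, two_mul] at hrej
  omega

end PartialSpider

end Spiders

end NWSTAP

namespace RAM

open Finset SimpleGraph Steiner Cmd

namespace Reg

abbrev threshold : ℕ := 40
abbrev round : ℕ := 41
abbrev center : ℕ := 42
abbrev root : ℕ := 43
abbrev foot : ℕ := 44
abbrev baseCount : ℕ := 45
abbrev spiderCount : ℕ := 46
abbrev spiderCost : ℕ := 47

end Reg

namespace Arr

abbrev current : ℕ := 3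
abbrev spider : ℕ := 8
abbrev candidate : ℕ := 9

end Arr

/-- The arrays for the shortest paths from the center of a spider in the graph of links. -/
def linkPaths : PathArrays := ⟨4, 5, by decide, by decide, by decide⟩

namespace Expr

/-- The vertices in the registers `tail` and `head` are joined by a link. -/
def linkCond : Expr :=
  .and (.adj (.reg Reg.tail) (.reg Reg.head)) (.not (.treeAdj (.reg Reg.tail) (.reg Reg.head)))

/-- The vertex in the register `r` is a terminal and can be reached from the center. -/
def isFoot (r : ℕ) : Expr := .and (.get linkPaths.dist (.reg r)) (.terminal (.reg r))

/-- The distance from the center to the vertex in the register `r`. -/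
def linkDist (r : ℕ) : Expr := .get linkPaths.dist (.reg r) - 1

end Expr

namespace Cmd

/-- Copy the array `src` to the array `dst`. -/
def copyArr (dst src : ℕ) : Cmd := fillArr dst (.get src (.reg Reg.column))

/-- Store in the array `dst` the union of the set in the array `src` and the path to the vertex in
the register `y`, and count the tree edges that this union covers. -/
def joinPath (dst src y : ℕ) : Cmd :=
  fillArr dst (.get src (.reg Reg.column) +
    .entry linkPaths.path 0 (.reg y) (.reg Reg.column)) ;;
  countCovered dst

/-- Multiply `e` by the difference of the registers `c` and `d`. -/
def price (e : Expr) (c d : ℕ) : Cmd :=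
  assign Reg.factor e ;; assign Reg.multiplier (.reg c - .reg d) ;; mul

/-- Replace the spider by the candidate. -/
def acceptFoot : Cmd :=
  copyArr Arr.spider Arr.candidate ;;
  assign Reg.spiderCount (.reg Reg.count) ;;
  assign Reg.spiderCost (.reg Reg.spiderCost + .linkDist Reg.foot)

/-- Store the spider with the path to the vertex in the register `foot` as the candidate, and
compute how much this path may cost. -/
def evaluateFoot : Cmd :=
  joinPath Arr.candidate Arr.spider Reg.foot ;;
  price (.reg Reg.threshold) Reg.count Reg.spiderCount

/-- Add the path to the vertex in the register `foot` to the spider if it pays off at the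
threshold. -/
def tryFoot : Cmd :=
  ite (.isFoot Reg.foot)
    (evaluateFoot ;; ite (.le (.linkDist Reg.foot) (.reg Reg.product)) acceptFoot skip)
    skip

/-- Store the number of tree edges that the current set covers. -/
def setBaseCount : Cmd :=
  countCovered Arr.current ;; assign Reg.baseCount (.reg Reg.count)

/-- Start a spider with the path from the center to the vertex in the register `root`. -/
def initSpider : Cmd :=
  joinPath Arr.spider Arr.current Reg.root ;;
  assign Reg.spiderCount (.reg Reg.count) ;;
  assign Reg.spiderCost (.get Arr.weight (.reg Reg.center) + .linkDist Reg.root)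

/-- Add the spider to the current set if it pays off at twice the threshold. -/
def addSpider : Cmd :=
  price (.reg Reg.threshold + .reg Reg.threshold) Reg.spiderCount Reg.baseCount ;;
  ite (.le (.reg Reg.spiderCost) (.reg Reg.product)) (copyArr Arr.current Arr.spider) skip

/-- Try the spider whose first foot is in the register `root`. -/
def tryRoot : Cmd :=
  ite (.isFoot Reg.root)
    (setBaseCount ;; initSpider ;; loopTo Reg.foot Reg.n tryFoot ;; addSpider) skip

end Cmd

variable {I : NWSTAP} {w : Fin I.n → ℕ} {B lam : ℕ} {v r y : Fin I.n} {M : Finset (Fin I.n)}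
  {s t : State}

theorem mask_run_copyArr (hs : Layout w s) {dst src : ℕ} (h : src ≠ dst) :
    mask I.n ((copyArr dst src).run s) dst = mask I.n s src := by
  have hfill (x : Fin I.n) : ((copyArr dst src).run s).arr dst x = s.arr src x :=
    fillArr_arr (s.arr src) (fun t hst _ => by
      rw [Expr.eval_get, Expr.eval_reg, hst.arr src (List.mem_singleton.not.2 h)])
      (x.is_lt.trans_eq hs.reg_n.symm)
  ext x
  rw [mem_mask, mem_mask, hfill]

theorem run_joinPath (hs : Loaded I w B s) {dst src r : ℕ}
    (hdst : dst ∉ src :: linkPaths.path :: reachPaths.dist :: reachPaths.path :: fixedArrs)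
    (hr : r ≠ Reg.column) (hy : s.reg r = y) :
    mask I.n ((joinPath dst src r).run s) dst = mask I.n s src ∪ rowMask I.n s linkPaths.path y ∧
      ((joinPath dst src r).run s).reg Reg.count =
        #(I.covered (mask I.n s src ∪ rowMask I.n s linkPaths.path y)) := by
  simp only [List.mem_cons, not_or] at hdst
  obtain ⟨hsrc, hpath, hreach, hreach', hinput, hoffset, hweight, -⟩ := hdst
  set e : Expr := .get src (.reg Reg.column) + .entry linkPaths.path 0 (.reg r) (.reg Reg.column)
  have hfixed {t : State} (hst : State.Agree [Reg.column] [dst] s t) : Loaded I w B t :=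
    hs.agree hst (by decide) (by simp [Ne.symm hinput, Ne.symm hoffset, Ne.symm hweight])
  have hst : State.Agree [Reg.column] [dst] s ((fillArr dst e).run s) :=
    agree_run (fillArr dst e) s
  have hmask : mask I.n ((fillArr dst e).run s) dst =
      mask I.n s src ∪ rowMask I.n s linkPaths.path y := by
    ext x
    rw [mem_union, mem_mask, mem_mask, mem_rowMask,
      fillArr_arr (fun z => s.arr src z + s.arr linkPaths.path (y * I.n + z))
        (fun t hst _ => ?_) (x.is_lt.trans_eq hs.reg_n.symm)]
    · omega
    · have hyt : (Expr.reg r).eval t = y := (hst.reg r (by simpa using hr)).trans hy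
      rw [Expr.eval_add, Expr.entry, Expr.eval_get, Expr.eval_get, (hfixed hst).eval_index hyt,
        Expr.eval_zero, zero_add, Expr.eval_reg, hst.arr src (by simpa using Ne.symm hsrc),
        hst.arr _ (by simpa using Ne.symm hpath)]
  have hloaded := hfixed hst
  rw [joinPath, run_seq]
  generalize (fillArr dst e).run s = t at *
  have htu := countCovered_agree dst t
  refine ⟨(mask_congr (htu.arr dst (by simp [hreach, hreach']))).trans hmask, ?_⟩
  rw [count_run_countCovered hloaded (by simp [hreach, hreach']), hmask]

theorem price_run {e : Expr} {c d : ℕ} (hc : c ≠ Reg.factor) (hd : d ≠ Reg.factor)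
    (h : s.reg c < 2 ^ s.reg Reg.bits) :
    ((price e c d).run s).reg Reg.product = e.eval s * (s.reg c - s.reg d) := by
  rw [price, run_seq, run_seq, mul_run]
  · simp [hc, hd]
  · simpa [hc, hd] using (Nat.sub_le _ _).trans_lt h

/-- The state while the spiders with center `v` are tried. -/
structure AtCenter (I : NWSTAP) (w : Fin I.n → ℕ) (B lam : ℕ) (v : Fin I.n) (s : State) : Prop
    extends Loaded I w B s where
  sq_lt : I.n * I.n < 2 ^ B
  reg_threshold : s.reg Reg.threshold = lam
  reg_center : s.reg Reg.center = v
  isShortest : Labelling.IsShortest I.links w v (linkPaths.labels I.n s)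

namespace AtCenter

theorem agree {rs as : List ℕ} (h : AtCenter I w B lam v s) (hst : s.Agree rs as t)
    (hr : ∀ r ∈ Reg.threshold :: Reg.center :: fixedRegs, r ∉ rs := by decide)
    (ha : ∀ a ∈ linkPaths.dist :: linkPaths.path :: fixedArrs, a ∉ as := by decide) :
    AtCenter I w B lam v t where
  toLoaded := h.toLoaded.agree hst (fun r hmem => hr r (by simp_all))
    (fun a hmem => ha a (by simp_all))
  sq_lt := h.sq_lt
  reg_threshold := (hst.reg _ (hr _ (by simp))).trans h.reg_threshold
  reg_center := (hst.reg _ (hr _ (by simp))).trans h.reg_center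
  isShortest := by
    rw [show linkPaths.labels I.n t = linkPaths.labels I.n s by
      simp only [PathArrays.labels, rowMask, hst.arr _ (ha linkPaths.dist (by simp)),
        hst.arr _ (ha linkPaths.path (by simp))]]
    exact h.isShortest

theorem eval_isFoot_ne_zero (h : AtCenter I w B lam v s) {r : ℕ} (hy : s.reg r = y) :
    (Expr.isFoot r).eval s ≠ 0 ↔ I.links.Reachable v y ∧ y ∈ I.R := by
  rw [Expr.isFoot, Expr.eval_and_ne_zero, h.eval_terminal (i := .reg r) hy,
    ← h.isShortest.dist_ne_zero_iff, Expr.eval_get, Expr.eval_reg, hy]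
  rfl

theorem eval_linkDist (h : AtCenter I w B lam v s) {r : ℕ} (hy : s.reg r = y)
    (hvy : I.links.Reachable v y) : (Expr.linkDist r).eval s = nodeDist I.links w v y := by
  rw [← h.isShortest.dist_sub_one y ((h.isShortest.dist_ne_zero_iff y).2 hvy), Expr.linkDist,
    Expr.eval_sub, Expr.eval_get, Expr.eval_reg, hy]
  rfl

theorem path_spec (h : AtCenter I w B lam v s) (hvy : I.links.Reachable v y) :
    ConnectedOn I.links (rowMask I.n s linkPaths.path y) ∧
      v ∈ rowMask I.n s linkPaths.path y ∧ y ∈ rowMask I.n s linkPaths.path y ∧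
      ∑ x ∈ rowMask I.n s linkPaths.path y, w x ≤ w v + nodeDist I.links w v y := by
  have hy := (h.isShortest.dist_ne_zero_iff y).2 hvy
  refine ⟨h.isShortest.connectedOn y hy, h.isShortest.src_mem y hy, h.isShortest.self_mem y hy, ?_⟩
  rw [← h.isShortest.dist_sub_one y hy]
  have hle := h.isShortest.weight_le y hy
  have hpos := Nat.pos_of_ne_zero hy
  exact Nat.le_sub_of_add_le hle |>.trans (by omega)

theorem product_run_price (h : AtCenter I w B lam v s) {e : Expr} {c d : ℕ}
    (hc : c ≠ Reg.factor) (hd : d ≠ Reg.factor) {M Q : Finset (Fin I.n)}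
    (hQ : s.reg c = #(I.covered Q)) (hM : s.reg d = #(I.covered M)) :
    ((price e c d).run s).reg Reg.product = e.eval s * (#(I.covered Q) - #(I.covered M)) := by
  rw [price_run hc hd, hQ, hM]
  rw [hQ, h.reg_bits]
  exact (NWSTAP.card_covered_le Q).trans_lt h.sq_lt

end AtCenter

/-- The states differ at most in the memory that is written while a candidate is evaluated. -/
abbrev CandidateAgree : State → State → Prop :=
  State.Agree [Reg.factor, Reg.multiplier, Reg.product, Reg.bit, Reg.source, Reg.pass, Reg.tail,
    Reg.head, Reg.column, Reg.edgeTail, Reg.edgeHead, Reg.count]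
    [reachPaths.dist, reachPaths.path, Arr.candidate]

theorem run_evaluateFoot (h : AtCenter I w B lam v s) (hy : s.reg Reg.foot = y)
    (hcount : s.reg Reg.spiderCount = #(I.covered (mask I.n s Arr.spider)))
    {Q' : Finset (Fin I.n)} (hQ' : Q' = mask I.n s Arr.spider ∪ rowMask I.n s linkPaths.path y) :
    mask I.n (evaluateFoot.run s) Arr.candidate = Q' ∧
      (evaluateFoot.run s).reg Reg.count = #(I.covered Q') ∧
      (evaluateFoot.run s).reg Reg.product =
        lam * (#(I.covered Q') - #(I.covered (mask I.n s Arr.spider))) := by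
  obtain ⟨hmask, hcov⟩ := run_joinPath h.toLoaded (dst := Arr.candidate) (src := Arr.spider)
    (by decide) (by decide) hy
  rw [← hQ'] at hmask hcov
  have hst : CandidateAgree s ((joinPath Arr.candidate Arr.spider Reg.foot).run s) :=
    (agree_run _ _).mono
  rw [evaluateFoot, run_seq]
  generalize (joinPath Arr.candidate Arr.spider Reg.foot).run s = t at *
  have htu : State.Agree [Reg.factor, Reg.multiplier, Reg.product, Reg.bit] [] t
      ((price (.reg Reg.threshold) Reg.count Reg.spiderCount).run t) := (agree_run _ _).mono
  refine ⟨(mask_congr (htu.arr _)).trans hmask, (htu.reg _).trans hcov, ?_⟩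
  rw [(h.agree hst).product_run_price (by decide) (by decide) hcov
    ((hst.reg Reg.spiderCount).trans hcount), Expr.eval_reg, (h.agree hst).reg_threshold]

/-- The memory holds a partial spider. -/
structure HoldsSpider (I : NWSTAP) (w : Fin I.n → ℕ) (lam : ℕ) (v r : Fin I.n)
    (M : Finset (Fin I.n)) (k : ℕ) (s : State) : Prop where
  count : s.reg Reg.spiderCount = #(I.covered (mask I.n s Arr.spider))
  partialSpider : I.PartialSpider w lam v r M k (mask I.n s Arr.spider) (s.reg Reg.spiderCost)

theorem run_acceptFoot (h : AtCenter I w B lam v s) (hy : s.reg Reg.foot = y)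
    (hvy : I.links.Reachable v y) :
    mask I.n (acceptFoot.run s) Arr.spider = mask I.n s Arr.candidate ∧
      (acceptFoot.run s).reg Reg.spiderCount = s.reg Reg.count ∧
      (acceptFoot.run s).reg Reg.spiderCost =
        s.reg Reg.spiderCost + nodeDist I.links w v y := by
  have hcopy : mask I.n ((copyArr Arr.spider Arr.candidate).run s) Arr.spider =
      mask I.n s Arr.candidate := mask_run_copyArr h.toLayout (by decide)
  have hst : State.Agree [Reg.column] [Arr.spider] s
      ((copyArr Arr.spider Arr.candidate).run s) := (agree_run _ _).mono
  rw [acceptFoot, run_seq, run_seq, run_assign, run_assign]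
  generalize (copyArr Arr.spider Arr.candidate).run s = t at *
  refine ⟨hcopy, hst.reg _, ?_⟩
  rw [← (h.agree hst).eval_linkDist ((hst.reg Reg.foot).trans hy) hvy, ← hst.reg Reg.spiderCost]
  rfl

theorem HoldsSpider.tryFoot (hs : HoldsSpider I w lam v r M y s) (h : AtCenter I w B lam v s)
    (hy : s.reg Reg.foot = y) (hM : I.R ⊆ M) (hr : r ∈ I.R) :
    HoldsSpider I w lam v r M (y + 1) (Cmd.tryFoot.run s) := by
  have htest := h.eval_isFoot_ne_zero hy
  rw [Cmd.tryFoot]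
  by_cases hfoot : I.links.Reachable v y ∧ y ∈ I.R
  swap
  · rw [run_ite_neg (htest.not.2 hfoot), run_skip]
    exact ⟨hs.count, hs.partialSpider.advance fun hyR hvy => absurd ⟨hvy, hyR⟩ hfoot⟩
  rw [run_ite_pos (htest.2 hfoot), run_seq]
  obtain ⟨hP, hvP, hyP, hPw⟩ := h.path_spec hfoot.1
  obtain ⟨hmask, hcov, hproduct⟩ := run_evaluateFoot h hy hs.count rfl
  have hst : CandidateAgree s (evaluateFoot.run s) := (agree_run _ _).mono
  generalize evaluateFoot.run s = t at *
  have ht := h.agree hst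
  have hyt := (hst.reg Reg.foot).trans hy
  by_cases hle : (Expr.le (.linkDist Reg.foot) (.reg Reg.product)).eval t ≠ 0
  · rw [run_ite_pos hle]
    rw [Expr.eval_le_ne_zero, ht.eval_linkDist hyt hfoot.1, Expr.eval_reg, hproduct] at hle
    obtain ⟨hspider, hcount, hcost⟩ := run_acceptFoot ht hyt hfoot.1
    rw [hmask] at hspider
    refine ⟨by rw [hcount, hcov, hspider], ?_⟩
    rw [hspider, hcost, hst.reg Reg.spiderCost]
    exact hs.partialSpider.accept hM hr hP hvP hyP hPw hle
  · rw [run_ite_neg hle, run_skip]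
    rw [Expr.eval_le_ne_zero, ht.eval_linkDist hyt hfoot.1, Expr.eval_reg, hproduct] at hle
    have hspider : mask I.n t Arr.spider = mask I.n s Arr.spider := mask_congr (hst.arr _)
    refine ⟨by rw [hst.reg Reg.spiderCount, hspider, hs.count], ?_⟩
    rw [hst.reg Reg.spiderCost, hspider]
    exact hs.partialSpider.reject hM hr hP hvP hyP hle

theorem HoldsSpider.loopTo_tryFoot (hs : HoldsSpider I w lam v r M 0 s)
    (h : AtCenter I w B lam v s) (hM : I.R ⊆ M) (hr : r ∈ I.R) :
    HoldsSpider I w lam v r M I.n ((loopTo Reg.foot Reg.n Cmd.tryFoot).run s) := by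
  rw [← h.reg_n]
  refine loopTo_induction (HoldsSpider I w lam v r M) (fun _ _ _ h => ⟨h.1, h.2⟩) hs
    fun k hk t hst hkt ht => ?_
  rw [h.reg_n] at hk
  exact HoldsSpider.tryFoot (y := ⟨k, hk⟩) ht (h.agree hst) hkt hM hr

theorem run_initSpider (h : AtCenter I w B lam v s) (hr : s.reg Reg.root = r)
    (hvr : I.links.Reachable v r) :
    HoldsSpider I w lam v r (mask I.n s Arr.current) 0 (initSpider.run s) := by
  obtain ⟨hP, hvP, hrP, hPw⟩ := h.path_spec hvr
  obtain ⟨hmask, hcov⟩ := run_joinPath h.toLoaded (dst := Arr.spider) (src := Arr.current)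
    (by decide) (by decide) hr
  have hst := agree_run (joinPath Arr.spider Arr.current Reg.root) s
  rw [initSpider, run_seq, run_seq, run_assign, run_assign]
  have hr' : ((joinPath Arr.spider Arr.current Reg.root).run s).reg Reg.root = r :=
    (hst.reg _).trans hr
  have ht : AtCenter I w B lam v ((joinPath Arr.spider Arr.current Reg.root).run s) := h.agree hst
  generalize (joinPath Arr.spider Arr.current Reg.root).run s = t at *
  have hcost : t.arr Arr.weight (t.reg Reg.center) + (Expr.linkDist Reg.root).eval t =
      w v + nodeDist I.links w v r := by
    rw [ht.reg_center, ht.weight, ht.eval_linkDist hr' hvr]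
  have hinit := NWSTAP.PartialSpider.init (lam := lam)
    (M := mask I.n s Arr.current) hP hvP hrP hPw
  rw [← hmask] at hinit hcov
  rw [← hcost] at hinit
  exact ⟨hcov, hinit⟩

theorem run_addSpider (hs : HoldsSpider I w lam v r M I.n s) (h : AtCenter I w B lam v s)
    (hbase : s.reg Reg.baseCount = #(I.covered M)) (hM : mask I.n s Arr.current = M) :
    I.Grows w lam M (mask I.n (addSpider.run s) Arr.current) ∧
      I.Saturated w lam v r (mask I.n (addSpider.run s) Arr.current) := by
  rw [addSpider, run_seq]
  set e : Expr := .reg Reg.threshold + .reg Reg.threshold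
  have hproduct := h.product_run_price (e := e) (by decide) (by decide) hs.count hbase
  rw [show e.eval s = 2 * lam by rw [two_mul, ← h.reg_threshold]; rfl] at hproduct
  have hst : State.Agree [Reg.factor, Reg.multiplier, Reg.product, Reg.bit] [] s
      ((price e Reg.spiderCount Reg.baseCount).run s) := (agree_run _ _).mono
  generalize (price e Reg.spiderCount Reg.baseCount).run s = t at *
  have ht := h.agree hst
  have hspider : mask I.n t Arr.spider = mask I.n s Arr.spider := mask_congr (hst.arr _)
  have hcost : t.reg Reg.spiderCost = s.reg Reg.spiderCost := hst.reg _
  by_cases hle : (Expr.le (.reg Reg.spiderCost) (.reg Reg.product)).eval t ≠ 0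
  · rw [run_ite_pos hle, mask_run_copyArr ht.toLayout (by decide), hspider]
    rw [Expr.eval_le_ne_zero, Expr.eval_reg, Expr.eval_reg, hcost, hproduct] at hle
    exact ⟨hs.partialSpider.grows hle, hs.partialSpider.saturated⟩
  · rw [run_ite_neg hle, run_skip, mask_congr (hst.arr Arr.current), hM]
    rw [Expr.eval_le_ne_zero, Expr.eval_reg, Expr.eval_reg, hcost, hproduct] at hle
    exact ⟨.refl M, hs.partialSpider.saturated_of_lt hle⟩

theorem run_tryRoot (h : AtCenter I w B lam v s) (hr : s.reg Reg.root = r)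
    (hM : I.R ⊆ mask I.n s Arr.current) :
    I.Grows w lam (mask I.n s Arr.current) (mask I.n (tryRoot.run s) Arr.current) ∧
      I.Saturated w lam v r (mask I.n (tryRoot.run s) Arr.current) := by
  have htest := h.eval_isFoot_ne_zero hr
  rw [tryRoot]
  by_cases hfoot : I.links.Reachable v r ∧ r ∈ I.R
  swap
  · rw [run_ite_neg (htest.not.2 hfoot), run_skip]
    exact ⟨.refl _, fun Y hY hrY hreach => absurd ⟨hreach r hrY, hY hrY⟩ hfoot⟩
  rw [run_ite_pos (htest.2 hfoot), run_seq, run_seq]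
  have hbase : (setBaseCount.run s).reg Reg.baseCount = #(I.covered (mask I.n s Arr.current)) :=
    count_run_countCovered h.toLoaded (by decide)
  have ht : AtCenter I w B lam v (setBaseCount.run s) := h.agree (agree_run _ s)
  have hrt := (run_reg setBaseCount s Reg.root).trans hr
  have hcurrent : mask I.n (setBaseCount.run s) Arr.current = mask I.n s Arr.current :=
    mask_congr (run_arr _ s _)
  rw [← hcurrent] at hM hbase ⊢
  generalize setBaseCount.run s = t at *
  have hinit := run_initSpider ht hrt hfoot.1
  have hu : AtCenter I w B lam v (initSpider.run t) := ht.agree (agree_run _ t)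
  have htu := agree_run (initSpider ;; loopTo Reg.foot Reg.n tryFoot) t
  exact run_addSpider (hinit.loopTo_tryFoot hu hM hfoot.2) (hu.agree (agree_run _ _))
    ((htu.reg _).trans hbase) (mask_congr (htu.arr _))

namespace Cmd

/-- Try all spiders whose center is in the register `center`. -/
def tryCenter : Cmd :=
  assign Reg.source (.reg Reg.center) ;;
  bellmanFord .linkCond linkPaths ;;
  loopTo Reg.root Reg.n tryRoot

/-- One round with the threshold doubled at its end. -/
def doublingRound : Cmd :=
  loopTo Reg.center Reg.n tryCenter ;;
  assign Reg.threshold (.reg Reg.threshold + .reg Reg.threshold)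

/-- All rounds. -/
def allRounds : Cmd := loopTo Reg.round Reg.bits doublingRound

end Cmd

variable {I : NWSTAP} {w : Fin I.n → ℕ} {B lam : ℕ} {v : Fin I.n} {s : State}

theorem linkCond_decides (hs : Loaded I w B s) : linkPaths.Decides I.links .linkCond s := by
  intro t hst u x hu hx
  have ht := hs.agree hst
  rw [Expr.linkCond, Expr.eval_and_ne_zero, Expr.eval_not_ne_zero,
    ht.eval_adj (i := .reg Reg.tail) (j := .reg Reg.head) hu hx,
    ht.eval_treeAdj (i := .reg Reg.tail) (j := .reg Reg.head) hu hx]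
  exact I.links_adj.symm

theorem atCenter_run_bellmanFord (hs : Loaded I w B s) (hB : I.n * I.n < 2 ^ B)
    (hlam : s.reg Reg.threshold = lam) (hv : s.reg Reg.center = v)
    (hsrc : s.reg Reg.source = v) :
    AtCenter I w B lam v ((bellmanFord .linkCond linkPaths).run s) where
  toLoaded := hs.agree (agree_run _ s)
  sq_lt := hB
  reg_threshold := (run_reg _ s _).trans hlam
  reg_center := (run_reg _ s _).trans hv
  isShortest := isShortest_run_bellmanFord hs.toLayout hsrc (linkCond_decides hs)

theorem grows_run_loopTo {P : Fin I.n → Finset (Fin I.n) → Prop} {r : ℕ} {p : Cmd}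
    (hn : s.reg Reg.n = I.n) (hP : ∀ x M M', M ⊆ M' → P x M → P x M')
    (hstep : ∀ x : Fin I.n, ∀ t, State.Agree (r :: p.regs) p.arrs s t → t.reg r = x →
      mask I.n s Arr.current ⊆ mask I.n t Arr.current →
      I.Grows w lam (mask I.n t Arr.current) (mask I.n (p.run t) Arr.current) ∧
        P x (mask I.n (p.run t) Arr.current)) :
    I.Grows w lam (mask I.n s Arr.current) (mask I.n ((loopTo r Reg.n p).run s) Arr.current) ∧
      ∀ x, P x (mask I.n ((loopTo r Reg.n p).run s) Arr.current) := by
  have hloop := loopTo_induction_univ (p := p) (r := r) hn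
    (fun K t => I.Grows w lam (mask I.n s Arr.current) (mask I.n t Arr.current) ∧
      ∀ x ∈ K, P x (mask I.n t Arr.current))
    (fun _ _ _ h => h) ⟨.refl _, fun _ hx => absurd hx (notMem_empty _)⟩ ?_
  · exact ⟨hloop.1, fun x => hloop.2 x (mem_univ x)⟩
  · intro x K t _ hst hxt ⟨hgrows, hdone⟩
    obtain ⟨hgrows', hnew⟩ := hstep x t hst hxt hgrows.1
    refine ⟨hgrows.trans hgrows', fun y hy => ?_⟩
    obtain rfl | hyK := mem_insert.1 hy
    · exact hnew
    · exact hP y _ _ hgrows'.1 (hdone y hyK)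

theorem run_tryCenter (hs : Loaded I w B s) (hB : I.n * I.n < 2 ^ B)
    (hlam : s.reg Reg.threshold = lam) (hv : s.reg Reg.center = v)
    (hM : I.R ⊆ mask I.n s Arr.current) :
    I.Grows w lam (mask I.n s Arr.current) (mask I.n (tryCenter.run s) Arr.current) ∧
      ∀ r, I.Saturated w lam v r (mask I.n (tryCenter.run s) Arr.current) := by
  have hst := agree_run (assign Reg.source (.reg Reg.center) ;; bellmanFord .linkCond linkPaths) s
  have ht : AtCenter I w B lam v ((bellmanFord .linkCond linkPaths).run
      (s.setReg Reg.source (s.reg Reg.center))) :=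
    atCenter_run_bellmanFord (hs.agree (State.agree_setReg _ _ _)) hB (by simpa) (by simpa)
      (by simpa)
  have hcurrent := mask_congr (n := I.n) (hst.arr Arr.current)
  rw [tryCenter, run_seq, run_seq]
  simp only [run_seq, run_assign, Expr.eval_reg] at hcurrent
  rw [run_assign, Expr.eval_reg]
  generalize (bellmanFord .linkCond linkPaths).run _ = t at *
  rw [← hcurrent] at hM ⊢
  exact grows_run_loopTo ht.reg_n (fun _ _ _ hMM' h => h.mono hMM')
    fun r u htu hr hMu => run_tryRoot (ht.agree htu) hr (hM.trans hMu)

theorem round_run_loopTo_tryCenter (hs : Loaded I w B s) (hB : I.n * I.n < 2 ^ B)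
    (hlam : s.reg Reg.threshold = lam) (hM : I.R ⊆ mask I.n s Arr.current) :
    I.Round w lam (mask I.n s Arr.current)
      (mask I.n ((loopTo Reg.center Reg.n tryCenter).run s) Arr.current) := by
  obtain ⟨hgrows, hsat⟩ := grows_run_loopTo (w := w) (lam := lam) hs.reg_n
    (P := fun v M => ∀ r, I.Saturated w lam v r M)
    (fun v M M' hMM' h r => (h r).mono hMM') fun v t hst hv hMt =>
      run_tryCenter (hs.agree hst) hB ((hst.reg _).trans hlam) hv (hM.trans hMt)
  exact hgrows.round hsat

theorem exists_rounds_run_allRounds (hs : Loaded I w B s) (hB : I.n * I.n < 2 ^ B)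
    (hlam : s.reg Reg.threshold = 1) (hM : mask I.n s Arr.current = I.R) :
    ∃ Ms : ℕ → Finset (Fin I.n), Ms 0 = I.R ∧
      (∀ k < B, I.Round w (2 ^ k) (Ms k) (Ms (k + 1))) ∧
      mask I.n (allRounds.run s) Arr.current = Ms B := by
  have hloop := loopTo_induction (s := s) (r := Reg.round) (b := Reg.bits) (p := doublingRound)
    (fun k t => t.reg Reg.threshold = 2 ^ k ∧ I.R ⊆ mask I.n t Arr.current ∧
      ∃ Ms : ℕ → Finset (Fin I.n), Ms 0 = I.R ∧
        (∀ j < k, I.Round w (2 ^ j) (Ms j) (Ms (j + 1))) ∧ mask I.n t Arr.current = Ms k)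
    (fun _ _ _ h => ⟨by simpa using h.1, h.2⟩)
    ⟨hlam, hM.ge, fun _ => I.R, rfl, fun _ hj => absurd hj (Nat.not_lt_zero _), hM⟩ ?_
  · rw [hs.reg_bits] at hloop
    exact hloop.2.2
  · intro k _ t hst _ ⟨hk, hMt, Ms, hzero, hrounds, hMs⟩
    have hround := round_run_loopTo_tryCenter (hs.agree hst) hB hk hMt
    have hthreshold := (run_reg (loopTo Reg.center Reg.n tryCenter) t Reg.threshold).trans hk
    rw [doublingRound, run_seq, run_assign]
    generalize (loopTo Reg.center Reg.n tryCenter).run t = u at *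
    refine ⟨by simp [hthreshold, pow_succ, mul_two], hMt.trans hround.subset,
      Function.update Ms (k + 1) (mask I.n u Arr.current), ?_, fun j hj => ?_, ?_⟩
    · rw [Function.update_of_ne (Nat.succ_ne_zero k).symm, hzero]
    · rw [Function.update_of_ne (by omega)]
      rcases Nat.lt_succ_iff_lt_or_eq.1 hj with hjk | rfl
      · rw [Function.update_of_ne (by omega)]
        exact hrounds j hjk
      · rw [Function.update_self, ← hMs]
        exact hround
    · exact (Function.update_self (k + 1) _ Ms).symm

end RAM

/-! ### Integral weights and pruning -/

namespace NWSTAP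

open Finset

variable (I : NWSTAP) {v : Fin I.n}

/-- The factor of the vertex `u` in the weight of the vertex `v`. -/
def weightFactor (v u : Fin I.n) : ℕ := if u = v then (I.c u).num else (I.c u).den

/-- The ratio of the integral weights to the costs. The factor `4 * n ^ 2` makes all weights
multiples of a number that exceeds `2 * #R ^ 2`, as `covers_and_weight_le_of_rounds` needs. -/
def costScale : ℕ := 4 * (I.n * I.n) * ∏ u, (I.c u).den

/-- The integral weights: the costs times `costScale`. -/
def weight (v : Fin I.n) : ℕ := 4 * (I.n * I.n) * ∏ u, I.weightFactor v u

theorem weightFactor_lt {m : ℕ} (hc : ∀ v, (I.c v).num < m ∧ (I.c v).den < m) (v u : Fin I.n) :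
    I.weightFactor v u < m := by
  rw [weightFactor]
  split_ifs
  exacts [(hc u).1, (hc u).2]

theorem n_pos : 0 < I.n := by
  obtain ⟨r, -⟩ := I.R_nonempty
  exact r.pos

theorem card_R_le : #I.R ≤ I.n := I.R.card_le_univ.trans_eq (Fintype.card_fin _)

theorem two_mul_card_sq_lt : 2 * #I.R ^ 2 < 4 * (I.n * I.n) := by
  have hsq := Nat.pow_le_pow_left I.card_R_le 2
  have hpos := I.n_pos
  nlinarith

theorem weight_eq_zero (hv : v ∈ I.R) : I.weight v = 0 := by
  rw [weight, prod_eq_zero (mem_univ v) (by simp [weightFactor, I.c_terminal v hv]), mul_zero]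

theorem weight_eq_mul_cost (v : Fin I.n) : (I.weight v : ℝ) = I.costScale * (I.c v : ℝ) := by
  have hden : ((I.c v).den : ℝ) ≠ 0 := by exact_mod_cast (I.c v).den_ne_zero
  have hprod : ∏ u, I.weightFactor v u = (I.c v).num * ∏ u ∈ univ.erase v, (I.c u).den := by
    rw [← mul_prod_erase _ _ (mem_univ v), weightFactor, if_pos rfl]
    exact congrArg _ (prod_congr rfl fun u hu => if_neg (ne_of_mem_erase hu))
  rw [weight, costScale, hprod, ← mul_prod_erase univ (fun u => (I.c u).den) (mem_univ v),
    NNRat.cast_def (I.c v)]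
  push_cast
  field_simp

theorem sum_weight_eq_mul_cost (S : Finset (Fin I.n)) :
    ((∑ v ∈ S, I.weight v : ℕ) : ℝ) = I.costScale * (I.cost S : ℝ) := by
  rw [cost, NNRat.cast_sum, mul_sum, Nat.cast_sum]
  exact sum_congr rfl fun v _ => I.weight_eq_mul_cost v

theorem costScale_pos : 0 < I.costScale := by
  have hn := I.n_pos
  exact mul_pos (by positivity) (prod_pos fun u _ => (I.c u).den_pos)

end NWSTAP

namespace RAM

open Finset SimpleGraph Steiner Cmd

namespace Reg

abbrev vertex : ℕ := 50
abbrev other : ℕ := 51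
abbrev terminal : ℕ := 52

end Reg

namespace Arr

abbrev result : ℕ := 10

end Arr

namespace Expr

/-- The numerator of the cost of the vertex `i`. -/
def num (i : Expr) : Expr :=
  .get Arr.input (1 + .reg Reg.square + .reg Reg.square + .reg Reg.n + (i + i))

/-- The denominator of the cost of the vertex `i`. -/
def den (i : Expr) : Expr :=
  .get Arr.input (1 + .reg Reg.square + .reg Reg.square + .reg Reg.n + (i + i) + 1)

end Expr

namespace Cmd

/-- Compute the offsets of the rows and the square of the number of vertices. -/
def setOffsets : Cmd :=
  assign Reg.square 0 ;; loopTo Reg.vertex Reg.n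
    (store Arr.offset (.reg Reg.vertex) (.reg Reg.square) ;;
      assign Reg.square (.reg Reg.square + .reg Reg.n))

/-- Multiply `product` by the factor of the vertex `other` in the weight of the vertex `vertex`. -/
def scaleWeight : Cmd :=
  assign Reg.factor (.reg Reg.product) ;;
  ite (.eq (.reg Reg.other) (.reg Reg.vertex))
    (assign Reg.multiplier (.num (.reg Reg.other)))
    (assign Reg.multiplier (.den (.reg Reg.other))) ;;
  mul

/-- Compute the weight of the vertex `vertex`. -/
def setWeight : Cmd :=
  assign Reg.product
    (.reg Reg.square + .reg Reg.square + (.reg Reg.square + .reg Reg.square)) ;;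
  loopTo Reg.other Reg.n scaleWeight ;;
  store Arr.weight (.reg Reg.vertex) (.reg Reg.product)

/-- Compute the integral weights. -/
def setWeights : Cmd := loopTo Reg.vertex Reg.n setWeight

/-- Start with the set of terminals and the threshold `1`. -/
def setStart : Cmd :=
  fillArr Arr.current (.terminal (.reg Reg.column)) ;; assign Reg.threshold 1

/-- Remove the vertex `column` from `result` if it was not reached. -/
def removeUnreached : Cmd :=
  ite (.get reachPaths.dist (.reg Reg.column)) skip (store Arr.result (.reg Reg.column) 0)

/-- Remove from `result` the vertices that cannot be reached from `terminal` in the current subgraph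
without the edge between `edgeTail` and `edgeHead`. -/
def pruneStep : Cmd :=
  ite (.terminal (.reg Reg.terminal))
    (assign Reg.source (.reg Reg.terminal) ;;
      bellmanFord (reachCond Arr.current) reachPaths ;;
      loopTo Reg.column Reg.n removeUnreached)
    skip

/-- Compute in `result` the Steiner nodes that no single edge separates from a terminal in the
current subgraph. -/
def prune : Cmd :=
  fillArr Arr.result (.not (.terminal (.reg Reg.column))) ;;
  loopTo Reg.edgeTail Reg.n (loopTo Reg.edgeHead Reg.n (loopTo Reg.terminal Reg.n pruneStep))

/-- Output the set in `result`. The double negation turns the cells into indicator bits. -/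
def writeOut : Cmd :=
  fillArr Arr.input (.not (.not (.get Arr.result (.reg Reg.column)))) ;;
  assign Reg.outputLength (.reg Reg.n)

/-- The approximation algorithm, after the input has been read. -/
def main : Cmd :=
  setOffsets ;; setWeights ;; setStart ;; allRounds ;; prune ;; writeOut

theorem main_wf : main.WF [Reg.n, Reg.bits] := by decide

variable {I : NWSTAP} {w : Fin I.n → ℕ} {B n : ℕ} {s : State}

theorem run_setOffsets (hn : s.reg Reg.n = n) :
    (setOffsets.run s).reg Reg.square = n * n ∧
      ∀ u : Fin n, (setOffsets.run s).arr Arr.offset u = u * n := by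
  have hn' : (s.setReg Reg.square 0).reg Reg.n = n := by simp [hn]
  have hloop := loopTo_induction (s := s.setReg Reg.square 0) (r := Reg.vertex) (b := Reg.n)
    (p := store Arr.offset (.reg Reg.vertex) (.reg Reg.square) ;;
      assign Reg.square (.reg Reg.square + .reg Reg.n))
    (fun k t => t.reg Reg.square = k * n ∧ ∀ u < k, t.arr Arr.offset u = u * n)
    (fun _ _ _ h => ⟨by simpa using h.1, h.2⟩) ⟨by simp, fun _ h => absurd h (Nat.not_lt_zero _)⟩ ?_
  · rw [hn'] at hloop
    exact ⟨hloop.1, fun u => hloop.2 u u.is_lt⟩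
  · intro k _ t hst hkt ⟨hsquare, hoffset⟩
    refine ⟨by simp [hsquare, (hst.reg Reg.n).trans hn', Nat.succ_mul], fun u hu => ?_⟩
    simp only [run_seq, run_store, run_assign, Expr.eval_reg, State.setReg_arr,
      State.setArr_arr_self, hkt, hsquare, Function.update_apply]
    split_ifs with huk
    · rw [huk]
    · exact hoffset u (by omega)

theorem product_run_scaleWeight (hs : Input I B s) (hsq : s.reg Reg.square = I.n * I.n)
    (hc : ∀ v, (I.c v).num < 2 ^ B ∧ (I.c v).den < 2 ^ B) {v u : Fin I.n}
    (hv : s.reg Reg.vertex = v) (hu : s.reg Reg.other = u) :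
    (scaleWeight.run s).reg Reg.product = s.reg Reg.product * I.weightFactor v u := by
  have hfactor : (ite (.eq (.reg Reg.other) (.reg Reg.vertex))
      (assign Reg.multiplier (.num (.reg Reg.other)))
      (assign Reg.multiplier (.den (.reg Reg.other)))).run
        (s.setReg Reg.factor (s.reg Reg.product)) =
      (s.setReg Reg.factor (s.reg Reg.product)).setReg Reg.multiplier (I.weightFactor v u) := by
    by_cases huv : u = v
    · rw [run_ite_pos (by simp [hu, hv, huv]), run_assign]
      simp [Expr.num, hsq, hs.reg_n, hu, hs.num, NWSTAP.weightFactor, huv]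
    · rw [run_ite_neg (by simp [hu, hv, Fin.val_inj, huv]), run_assign]
      simp [Expr.den, hsq, hs.reg_n, hu, hs.den, NWSTAP.weightFactor, huv]
  rw [scaleWeight, run_seq, run_seq, run_assign, Expr.eval_reg, hfactor, mul_run]
  · simp
  · simpa [hs.reg_bits] using I.weightFactor_lt hc v u

theorem product_run_scaleWeights (hs : Input I B s) (hsq : s.reg Reg.square = I.n * I.n)
    (hc : ∀ v, (I.c v).num < 2 ^ B ∧ (I.c v).den < 2 ^ B) {v : Fin I.n}
    (hv : s.reg Reg.vertex = v) :
    ((loopTo Reg.other Reg.n scaleWeight).run s).reg Reg.product =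
      s.reg Reg.product * ∏ u, I.weightFactor v u := by
  refine loopTo_induction_univ (p := scaleWeight) (r := Reg.other) hs.reg_n
    (fun K t => t.reg Reg.product = s.reg Reg.product * ∏ u ∈ K, I.weightFactor v u)
    (fun _ _ _ h => by simpa using h) (by simp) fun u K t hu hst hut h => ?_
  rw [product_run_scaleWeight (hs.agree hst) ((hst.reg Reg.square).trans hsq) hc
    ((hst.reg Reg.vertex).trans hv) hut, h, prod_insert hu, mul_assoc,
    mul_comm (I.weightFactor v u)]

theorem weight_run_setWeight (hs : Input I B s) (hsq : s.reg Reg.square = I.n * I.n)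
    (hc : ∀ v, (I.c v).num < 2 ^ B ∧ (I.c v).den < 2 ^ B) {v : Fin I.n}
    (hv : s.reg Reg.vertex = v) :
    (setWeight.run s).arr Arr.weight = Function.update (s.arr Arr.weight) v (I.weight v) := by
  have hinit : Expr.eval s (.reg Reg.square + .reg Reg.square +
      (.reg Reg.square + .reg Reg.square)) = 4 * (I.n * I.n) := by
    simp only [Expr.eval_add, Expr.eval_reg, hsq]
    ring
  have hst := State.agree_setReg s Reg.product (4 * (I.n * I.n))
  have hproduct := product_run_scaleWeights (hs.agree hst) ((hst.reg Reg.square).trans hsq) hc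
    ((hst.reg Reg.vertex).trans hv)
  rw [State.setReg_reg, if_pos rfl] at hproduct
  rw [setWeight, run_seq, run_seq, run_assign, hinit, run_store, State.setArr_arr_self,
    Expr.eval_reg, Expr.eval_reg, hproduct, run_reg _ _ Reg.vertex, hst.reg Reg.vertex, hv,
    run_arr _ _ Arr.weight, hst.arr Arr.weight, NWSTAP.weight]

theorem weight_run_setWeights (hs : Input I B s) (hsq : s.reg Reg.square = I.n * I.n)
    (hc : ∀ v, (I.c v).num < 2 ^ B ∧ (I.c v).den < 2 ^ B) (v : Fin I.n) :
    (setWeights.run s).arr Arr.weight v = I.weight v := by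
  refine loopTo_induction_univ (p := setWeight) (r := Reg.vertex) hs.reg_n
    (fun K t => ∀ v ∈ K, t.arr Arr.weight v = I.weight v) (fun _ _ _ h => h)
    (fun _ hv => absurd hv (notMem_empty _)) (fun x K t _ hst hxt h v hv => ?_) v (mem_univ v)
  rw [weight_run_setWeight (hs.agree hst) ((hst.reg Reg.square).trans hsq) hc hxt,
    Function.update_apply]
  split_ifs with hvx
  · rw [Fin.ext hvx]
  · exact h v ((mem_insert.1 hv).resolve_left fun hvx' => hvx (congrArg Fin.val hvx'))

theorem loaded_run_setWeights (hs : Input I B s)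
    (hc : ∀ v, (I.c v).num < 2 ^ B ∧ (I.c v).den < 2 ^ B) :
    Loaded I I.weight B (setWeights.run (setOffsets.run s)) := by
  obtain ⟨hsquare, hoffset⟩ := run_setOffsets hs.reg_n
  have hs' := hs.agree (agree_run setOffsets s)
  have hst := agree_run setWeights (setOffsets.run s)
  exact {
    __ := hs'.agree hst
    reg_square := (hst.reg Reg.square).trans hsquare
    offset := by rw [hst.arr Arr.offset]; exact hoffset
    weight := weight_run_setWeights hs' hsquare hc }

theorem mem_mask_run_fillArr {a : ℕ} {e : Expr} {C : Fin n → Prop} (hn : s.reg Reg.n = n)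
    (he : ∀ (x : Fin n) t, State.Agree [Reg.column] [a] s t → t.reg Reg.column = x →
      (e.eval t ≠ 0 ↔ C x)) (x : Fin n) :
    x ∈ mask n ((fillArr a e).run s) a ↔ C x := by
  refine loopTo_induction_univ (p := store a (.reg Reg.column) e) (r := Reg.column) hn
    (fun K t => ∀ x ∈ K, x ∈ mask n t a ↔ C x) (fun _ _ _ h => h)
    (fun _ hx => absurd hx (notMem_empty _)) (fun y K t _ hst hyt h x hx => ?_) x (mem_univ x)
  rw [mem_mask, run_store, State.setArr_arr_self, Expr.eval_reg, hyt, Function.update_apply]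
  split_ifs with hxy
  · rw [he y t hst hyt, Fin.ext hxy]
  · exact mem_mask.symm.trans
      (h x ((mem_insert.1 hx).resolve_left fun hxy' => hxy (congrArg Fin.val hxy')))

theorem mem_mask_run_loopTo {a r b : ℕ} {p : Cmd} {C : Fin n → Fin n → Prop} (hb : s.reg b = n)
    (hp : ∀ (k : Fin n) t, State.Agree (r :: p.regs) p.arrs s t → t.reg r = k →
      ∀ x, x ∈ mask n (p.run t) a ↔ x ∈ mask n t a ∧ C k x) (x : Fin n) :
    x ∈ mask n ((loopTo r b p).run s) a ↔ x ∈ mask n s a ∧ ∀ k, C k x := by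
  have hloop := loopTo_induction_univ (p := p) (r := r) hb
    (fun K t => x ∈ mask n t a ↔ x ∈ mask n s a ∧ ∀ k ∈ K, C k x) (fun _ _ _ h => h) (by simp)
    fun k K t _ hst hkt h => by
      rw [hp k t hst hkt, h, forall_mem_insert, and_assoc, and_comm (a := C k x)]
  simpa using hloop

theorem run_setStart (hs : Loaded I w B s) :
    mask I.n (setStart.run s) Arr.current = I.R ∧ (setStart.run s).reg Reg.threshold = 1 :=
  ⟨Finset.ext fun x => mem_mask_run_fillArr hs.reg_n
    (fun _ _ hst hxt => (hs.agree hst).eval_terminal (i := .reg Reg.column) hxt) x,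
    by simp [setStart]⟩

theorem mem_mask_run_removeUnreached {k : Fin n} (hk : s.reg Reg.column = k) (x : Fin n) :
    x ∈ mask n (removeUnreached.run s) Arr.result ↔
      x ∈ mask n s Arr.result ∧ (x = k → s.arr reachPaths.dist x ≠ 0) := by
  rw [removeUnreached]
  by_cases hdist : Expr.eval s (.get reachPaths.dist (.reg Reg.column)) ≠ 0
  · rw [run_ite_pos hdist, run_skip]
    rw [Expr.eval_get, Expr.eval_reg, hk] at hdist
    exact (and_iff_left (by rintro rfl; exact hdist)).symm
  · rw [run_ite_neg hdist, mem_mask, mem_mask, run_store, State.setArr_arr_self, Expr.eval_reg, hk,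
      Function.update_apply]
    rw [Expr.eval_get, Expr.eval_reg, hk] at hdist
    obtain rfl | hxk := eq_or_ne x k
    · simp [hdist]
    · simp [hxk, Fin.val_inj]

theorem mem_mask_run_pruneStep (hs : Loaded I w B s) {a b r : Fin I.n}
    (ha : s.reg Reg.edgeTail = a) (hb : s.reg Reg.edgeHead = b) (hr : s.reg Reg.terminal = r)
    (x : Fin I.n) :
    x ∈ mask I.n (pruneStep.run s) Arr.result ↔ x ∈ mask I.n s Arr.result ∧ (r ∈ I.R →
      (within (I.G.deleteEdges {s(a, b)}) (mask I.n s Arr.current)).Reachable r x) := by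
  have hterminal := hs.eval_terminal (i := .reg Reg.terminal) hr
  rw [pruneStep]
  by_cases hrR : r ∈ I.R
  · rw [run_ite_pos (hterminal.2 hrR), run_seq, run_seq, run_assign, Expr.eval_reg, hr]
    have hst := State.agree_setReg s Reg.source r
    have hshort := isShortest_run_bellmanFord (src := r) (hs.agree hst).toLayout (by simp)
      (reachCond_decides (q := Arr.current) (hs.agree hst) (by decide)
        ((hst.reg Reg.edgeTail).trans ha) ((hst.reg Reg.edgeHead).trans hb))
    rw [mask_congr (hst.arr Arr.current)] at hshort
    have htu := agree_run (bellmanFord (reachCond Arr.current) reachPaths) (s.setReg Reg.source r)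
    generalize (bellmanFord (reachCond Arr.current) reachPaths).run (s.setReg Reg.source r) = u
      at *
    have hn : u.reg Reg.n = I.n := (htu.reg Reg.n).trans ((hst.reg Reg.n).trans hs.reg_n)
    have hloop := mem_mask_run_loopTo (a := Arr.result) (r := Reg.column) (p := removeUnreached)
      (C := fun k x => x = k →
        (within (I.G.deleteEdges {s(a, b)}) (mask I.n s Arr.current)).Reachable r x)
      hn (fun k t hut hkt x => by
        rw [mem_mask_run_removeUnreached hkt, hut.arr reachPaths.dist]
        exact and_congr_right' (imp_congr_right fun _ => hshort.dist_ne_zero_iff x)) x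
    rw [hloop, mask_congr (htu.arr Arr.result), mask_congr (hst.arr Arr.result), forall_eq',
      forall_prop_of_true hrR]
  · rw [run_ite_neg (hterminal.not.2 hrR), run_skip]
    exact (and_iff_left fun h => absurd h hrR).symm

theorem mem_mask_run_prune (hs : Loaded I w B s) (x : Fin I.n) :
    x ∈ mask I.n (prune.run s) Arr.result ↔ x ∉ I.R ∧ ∀ a b, ∀ r ∈ I.R,
      (within (I.G.deleteEdges {s(a, b)}) (mask I.n s Arr.current)).Reachable r x := by
  rw [prune, run_seq]
  have hstart := mem_mask_run_fillArr (a := Arr.result) (e := .not (.terminal (.reg Reg.column)))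
    (C := (· ∉ I.R)) hs.reg_n (fun x t hst hxt => by
      rw [Expr.eval_not_ne_zero, (hs.agree hst).eval_terminal (i := .reg Reg.column) hxt]) x
  have hst := agree_run (fillArr Arr.result (.not (.terminal (.reg Reg.column)))) s
  generalize (fillArr Arr.result (.not (.terminal (.reg Reg.column)))).run s = t at *
  have ht := hs.agree hst
  rw [← hstart, ← mask_congr (hst.arr Arr.current)]
  refine mem_mask_run_loopTo (r := Reg.edgeTail)
    (p := loopTo Reg.edgeHead Reg.n (loopTo Reg.terminal Reg.n pruneStep))
    (C := fun a x => ∀ b, ∀ r ∈ I.R,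
      (within (I.G.deleteEdges {s(a, b)}) (mask I.n t Arr.current)).Reachable r x)
    ht.reg_n (fun a ta hta ha x => ?_) x
  replace ht := ht.agree hta
  refine mem_mask_run_loopTo (r := Reg.edgeHead) (p := loopTo Reg.terminal Reg.n pruneStep)
    (C := fun b x => ∀ r ∈ I.R,
      (within (I.G.deleteEdges {s(a, b)}) (mask I.n t Arr.current)).Reachable r x)
    ht.reg_n (fun b tb htb hb x => ?_) x
  replace ht := ht.agree htb
  refine mem_mask_run_loopTo (r := Reg.terminal) (p := pruneStep)
    (C := fun r x => r ∈ I.R →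
      (within (I.G.deleteEdges {s(a, b)}) (mask I.n t Arr.current)).Reachable r x)
    ht.reg_n (fun r u htu hr x => ?_) x
  rw [mem_mask_run_pruneStep (ht.agree htu)
    ((htu.reg Reg.edgeTail).trans ((htb.reg Reg.edgeTail).trans ha))
    ((htu.reg Reg.edgeHead).trans hb) hr, mask_congr (htu.arr Arr.current),
    mask_congr (htb.arr Arr.current), mask_congr (hta.arr Arr.current)]

theorem output_run_writeOut (hn : s.reg Reg.n = I.n) :
    (writeOut.run s).output = I.encodeSet (mask I.n s Arr.result) := by
  have hfill (x : Fin I.n) : (writeOut.run s).arr Arr.input x = 1 - (1 - s.arr Arr.result x) :=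
    fillArr_arr (a := Arr.input) (s := s) (e := .not (.not (.get Arr.result (.reg Reg.column))))
      (fun z => 1 - (1 - s.arr Arr.result z))
      (fun t hst _ => by rw [← hst.arr Arr.result]; rfl) (x.is_lt.trans_eq hn.symm)
  have hlen : (writeOut.run s).reg Reg.outputLength = I.n :=
    (run_reg (fillArr Arr.input (.not (.not (.get Arr.result (.reg Reg.column))))) s Reg.n).trans hn
  rw [State.output, hlen, NWSTAP.encodeSet]
  refine List.ext_getElem (by simp) fun i hi _ => ?_
  rw [List.length_map, List.length_range] at hi
  simp only [List.getElem_map, List.getElem_range, List.getElem_ofFn, hfill ⟨i, hi⟩, mem_mask]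
  split_ifs <;> omega

theorem exists_rounds_run_main (hs : Input I B s) (hB : I.n * I.n < 2 ^ B)
    (hc : ∀ v, (I.c v).num < 2 ^ B ∧ (I.c v).den < 2 ^ B) :
    ∃ (A : Finset (Fin I.n)) (Ms : ℕ → Finset (Fin I.n)), (main.run s).output = I.encodeSet A ∧
      Ms 0 = I.R ∧ (∀ k < B, I.Round I.weight (2 ^ k) (Ms k) (Ms (k + 1))) ∧
      ∀ x, x ∈ A ↔ x ∉ I.R ∧ ∀ a b, ∀ r ∈ I.R,
        (within (I.G.deleteEdges {s(a, b)}) (Ms B)).Reachable r x := by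
  have hloaded := loaded_run_setWeights hs hc
  simp only [main, run_seq]
  generalize setWeights.run (setOffsets.run s) = t at *
  obtain ⟨hM, hthreshold⟩ := run_setStart hloaded
  replace hloaded := hloaded.agree (agree_run setStart t)
  obtain ⟨Ms, hMs, hround, hMsB⟩ := exists_rounds_run_allRounds hloaded hB hthreshold hM
  replace hloaded := hloaded.agree (agree_run allRounds _)
  refine ⟨_, Ms, output_run_writeOut (hloaded.agree (agree_run prune _)).reg_n, hMs, hround, ?_⟩
  rw [← hMsB]
  exact mem_mask_run_prune hloaded

end Cmd

end RAM

/-! ### Reading the input -/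

namespace RAM

namespace Reg

abbrev position : ℕ := 4
abbrev entry : ℕ := 5

end Reg

namespace Prog

/-- Add the binary length of the register `entry` to the register `bits`, clearing `entry`. -/
def addSize : Prog :=
  .loop (.reg Reg.entry)
    (.seq (.assign Reg.entry (.half (.reg Reg.entry))) (.assign Reg.bits (.reg Reg.bits + 1)))

/-- Add the size of the input entry at `position`, with its separator, to the register `bits`, and
move to the next position. -/
def addEntry : Prog :=
  .seq (.assign Reg.entry (.get Arr.input (.reg Reg.position)))
    (.seq addSize
      (.seq (.assign Reg.bits (.reg Reg.bits + 1)) (.assign Reg.position (.reg Reg.position + 1))))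

/-- Add up the sizes of the input entries from `position` on. On an input the register
`outputLength` initially holds the number of entries. -/
def addEntries : Prog :=
  .loop (.reg Reg.outputLength - .reg Reg.position) addEntry

/-- Store the first entry of the input in the register `n` and its bit length in `bits`. -/
def readInput : Prog :=
  .seq addEntries (.assign Reg.n (.get Arr.input 0))

end Prog

open Prog

theorem size_eq_size_half_add_one {m : ℕ} (hm : m ≠ 0) : m.size = (m / 2).size + 1 := by
  conv_lhs => rw [← Nat.bit_bodd_div2 m]
  rw [Nat.size_bit (by rwa [Nat.bit_bodd_div2]), Nat.div2_val]

theorem exec_addSize (s : State) : Exec addSize s (9 * (s.reg Reg.entry).size + 2)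
    ((s.setReg Reg.bits (s.reg Reg.bits + (s.reg Reg.entry).size)).setReg Reg.entry 0) := by
  generalize hm : s.reg Reg.entry = m
  induction m using Nat.strong_induction_on generalizing s with
  | _ m ih =>
    by_cases hzero : m = 0
    · subst hzero
      have hdone : Exec addSize s 2 s := .loop_false hm
      convert hdone using 1
      · rw [Nat.size_zero]
      · ext r
        · simp only [Nat.size_zero, State.setReg_reg]
          grind
        · rfl
    · have hsize := size_eq_size_half_add_one hzero
      have hhalf := Exec.assign Reg.entry (.half (.reg Reg.entry)) s
      have hcount := Exec.assign Reg.bits (.reg Reg.bits + 1) (s.setReg Reg.entry (m / 2))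
      rw [Expr.eval_half, Expr.eval_reg, hm] at hhalf
      have hloop : Exec addSize _ _ _ := .loop_true (by rwa [Expr.eval_reg, hm])
        (hhalf.seq hcount) (ih (m / 2) (by omega) _ (by simp))
      convert hloop using 1
      · simp only [Expr.cost, hsize]
        ring
      · ext r
        · simp only [State.setReg_reg, Expr.eval_add, Expr.eval_reg, Expr.eval_one, hsize]
          grind
        · rfl

theorem exec_addEntry (s : State) :
    Exec addEntry s (9 * (s.arr Arr.input (s.reg Reg.position)).size + 13)
      (((s.setReg Reg.entry 0).setReg Reg.bits
        (s.reg Reg.bits + ((s.arr Arr.input (s.reg Reg.position)).size + 1))).setReg Reg.position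
        (s.reg Reg.position + 1)) := by
  have hentry := Exec.assign Reg.entry (.get Arr.input (.reg Reg.position)) s
  have hall : Exec addEntry _ _ _ :=
    hentry.seq ((exec_addSize _).seq ((Exec.assign Reg.bits (.reg Reg.bits + 1) _).seq
      (Exec.assign Reg.position (.reg Reg.position + 1) _)))
  convert hall using 1
  · simp only [Expr.cost, Expr.eval_get, Expr.eval_reg, State.setReg_reg, if_true]
    ring
  · ext r
    · simp only [State.setReg_reg, Expr.eval_add, Expr.eval_reg, Expr.eval_one, Expr.eval_get]
      grind
    · rfl

theorem bitLength_cons (a : ℕ) (x : List ℕ) : bitLength (a :: x) = a.size + 1 + bitLength x := rfl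

theorem exec_addEntries (x : List ℕ) (s : State)
    (hlen : s.reg Reg.position + x.length = s.reg Reg.outputLength)
    (hx : ∀ i < x.length, s.arr Arr.input (s.reg Reg.position + i) = x.getD i 0) :
    ∃ t s', Exec addEntries s t s' ∧ t ≤ 17 * bitLength x + 4 ∧
      s'.reg Reg.bits = s.reg Reg.bits + bitLength x ∧ s'.arr = s.arr := by
  induction x generalizing s with
  | nil =>
    have hdone : (Expr.reg Reg.outputLength - Expr.reg Reg.position).eval s = 0 := by
      simpa [Nat.sub_eq_zero_iff_le] using hlen.ge
    exact ⟨4, s, .loop_false hdone, by simp, rfl, rfl⟩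
  | cons a x ih =>
    rw [List.length_cons] at hlen hx
    have hmore : (Expr.reg Reg.outputLength - Expr.reg Reg.position).eval s ≠ 0 := by
      simp only [Expr.eval_sub, Expr.eval_reg]
      omega
    have ha : s.arr Arr.input (s.reg Reg.position) = a := by simpa using hx 0 (by simp)
    have hfirst := exec_addEntry s
    rw [ha] at hfirst
    obtain ⟨t, s', hexec, ht, hbits, harr⟩ := ih
      (((s.setReg Reg.entry 0).setReg Reg.bits (s.reg Reg.bits + (a.size + 1))).setReg
        Reg.position (s.reg Reg.position + 1)) (by simp; omega) fun i hi => by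
          simpa [add_assoc, add_comm 1] using hx (i + 1) (Nat.succ_lt_succ hi)
    refine ⟨_, s', .loop_true hmore hfirst hexec, ?_, ?_, harr⟩
    · simp only [Expr.cost_sub, Expr.cost_reg, bitLength_cons]
      omega
    · rw [hbits, bitLength_cons]
      simp [add_assoc]

theorem exec_readInput (x : List ℕ) : ∃ t s, Exec readInput (.init x) t s ∧
    t ≤ 17 * bitLength x + 7 ∧ s.reg Reg.n = x.getD 0 0 ∧ s.reg Reg.bits = bitLength x ∧
      s.arr Arr.input = fun i => x.getD i 0 := by
  have hinit : (State.init x).arr Arr.input = fun i => x.getD i 0 := rfl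
  obtain ⟨t, s, hexec, ht, hbits, harr⟩ := exec_addEntries x (.init x) (Nat.zero_add _)
    fun i _ => by simp [State.init]
  refine ⟨_, _, hexec.seq (.assign Reg.n (.get Arr.input 0) s), ?_, ?_, ?_, ?_⟩
  · simp only [Expr.cost]
    omega
  · rw [State.setReg_reg, if_pos rfl, Expr.eval_get, harr, hinit, Expr.eval_zero]
  · simp [hbits, State.init]
  · rw [State.setReg_arr, harr, hinit]

theorem bitLength_append (x y : List ℕ) : bitLength (x ++ y) = bitLength x + bitLength y := by
  simp [bitLength]

theorem length_le_bitLength (x : List ℕ) : x.length ≤ bitLength x := by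
  induction x with
  | nil => exact Nat.zero_le _
  | cons a x ih =>
    rw [bitLength_cons, List.length_cons]
    omega

theorem bitLength_flatMap {α : Type*} (f : α → List ℕ) (l : List α) :
    bitLength (l.flatMap f) = (l.map fun a => bitLength (f a)).sum := by
  induction l with
  | nil => rfl
  | cons a l ih => rw [List.flatMap_cons, bitLength_append, ih, List.map_cons, List.sum_cons]

theorem getD_flatMap_of_length_eq {α β : Type*} {f : α → List β} {m j : ℕ}
    (hf : ∀ a, (f a).length = m) (hj : j < m) (d : β) (l : List α) (i : ℕ) (hi : i < l.length) :
    (l.flatMap f).getD (i * m + j) d = (f l[i]).getD j d := by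
  induction l generalizing i with
  | nil => exact absurd hi (Nat.not_lt_zero i)
  | cons a l ih =>
    rw [List.flatMap_cons]
    cases i with
    | zero =>
      rw [Nat.zero_mul, Nat.zero_add, List.getD_append _ _ _ _ (by rwa [hf])]
      rfl
    | succ i =>
      have hij : (i + 1) * m + j = (f a).length + (i * m + j) := by rw [hf]; ring
      rw [hij, List.getD_append_right _ _ _ _ (Nat.le_add_right _ _), Nat.add_sub_cancel_left,
        ih i (Nat.lt_of_succ_lt_succ hi)]
      rfl

theorem getD_append_add {β : Type*} {x y : List β} {m : ℕ} (hx : x.length = m) (i : ℕ) (d : β) :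
    (x ++ y).getD (m + i) d = y.getD i d := by
  rw [← hx, List.getD_append_right _ _ _ _ (Nat.le_add_right _ _), Nat.add_sub_cancel_left]

end RAM

namespace NWSTAP

open Finset RAM

variable (I : NWSTAP)

theorem length_encodeRel (r : Fin I.n → Fin I.n → Prop) :
    (I.encodeRel r).length = I.n * I.n := by
  simp [encodeRel, List.length_flatMap]

theorem length_encodeSet (S : Finset (Fin I.n)) : (I.encodeSet S).length = I.n :=
  List.length_ofFn

theorem mul_n_add_lt (u v : Fin I.n) : u * I.n + v < I.n * I.n :=
  calc (u * I.n + v : ℕ) < u * I.n + I.n := Nat.add_lt_add_left v.2 _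
    _ = (u + 1) * I.n := (Nat.succ_mul _ _).symm
    _ ≤ I.n * I.n := Nat.mul_le_mul_right _ u.2

theorem getD_encodeRel_ne_zero_iff (r : Fin I.n → Fin I.n → Prop) (u v : Fin I.n) :
    (I.encodeRel r).getD (u * I.n + v) 0 ≠ 0 ↔ r u v := by
  rw [encodeRel, getD_flatMap_of_length_eq (m := I.n) (by simp) v.2 _ _ u (by simp)]
  simp [List.getD_eq_getElem?_getD]

theorem getD_encodeSet_ne_zero_iff (S : Finset (Fin I.n)) (v : Fin I.n) :
    (I.encodeSet S).getD v 0 ≠ 0 ↔ v ∈ S := by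
  simp [encodeSet, List.getD_eq_getElem?_getD]

/-- The part of the encoding that lists the costs. -/
def encodeCosts : List ℕ :=
  (List.finRange I.n).flatMap fun v => [(I.c v).num, (I.c v).den]

theorem getD_encodeCosts (v : Fin I.n) {j : ℕ} (hj : j < 2) :
    I.encodeCosts.getD (v + v + j) 0 = [(I.c v).num, (I.c v).den].getD j 0 := by
  rw [encodeCosts, ← mul_two, getD_flatMap_of_length_eq (m := 2) (fun _ => rfl) hj _ _ v (by simp)]
  simp

theorem encode_eq : I.encode = [I.n] ++ (I.encodeRel I.G.Adj ++ (I.encodeRel I.T.Adj ++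
    (I.encodeSet I.R ++ I.encodeCosts))) := by
  simp only [encode, encodeCosts, List.append_assoc]

theorem input_of_arr {B : ℕ} {s : State} (hn : s.reg Reg.n = I.encode.getD 0 0)
    (hB : s.reg Reg.bits = B) (harr : s.arr Arr.input = fun i => I.encode.getD i 0) :
    Input I B s := by
  have hG := I.length_encodeRel I.G.Adj
  have hT := I.length_encodeRel I.T.Adj
  have hR := I.length_encodeSet I.R
  have htail (i : ℕ) : s.arr Arr.input (1 + i) = (I.encodeRel I.G.Adj ++ (I.encodeRel I.T.Adj ++
      (I.encodeSet I.R ++ I.encodeCosts))).getD i 0 := by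
    rw [harr, encode_eq]
    exact getD_append_add rfl i 0
  refine ⟨by rw [hn, encode]; rfl, hB, fun u v => ?_, fun u v => ?_, fun v => ?_,
    fun v => ?_, fun v => ?_⟩
  · rw [add_assoc, htail, List.getD_append _ _ _ _ ((I.mul_n_add_lt u v).trans_eq hG.symm),
      getD_encodeRel_ne_zero_iff]
  · rw [add_assoc, add_assoc, htail, getD_append_add hG,
      List.getD_append _ _ _ _ ((I.mul_n_add_lt u v).trans_eq hT.symm), getD_encodeRel_ne_zero_iff]
  · rw [add_assoc, add_assoc, htail, getD_append_add hG, getD_append_add hT,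
      List.getD_append _ _ _ _ (v.2.trans_eq hR.symm), getD_encodeSet_ne_zero_iff]
  · simp only [add_assoc, htail, getD_append_add hG, getD_append_add hT, getD_append_add hR]
    exact I.getD_encodeCosts v two_pos
  · simp only [add_assoc, htail, getD_append_add hG, getD_append_add hT, getD_append_add hR]
    exact I.getD_encodeCosts v one_lt_two

/-- The total binary length of the costs. -/
def costSize : ℕ := ∑ v, ((I.c v).num.size + (I.c v).den.size)

theorem bitLength_encodeCosts : bitLength I.encodeCosts = I.costSize + 2 * I.n := by
  have hentry (v : Fin I.n) : bitLength [(I.c v).num, (I.c v).den] =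
      (I.c v).num.size + (I.c v).den.size + 2 := by
    simp only [bitLength, List.map_cons, List.map_nil, List.sum_cons, List.sum_nil]
    ring
  rw [encodeCosts, bitLength_flatMap, ← List.ofFn_eq_map, List.sum_ofFn,
    sum_congr rfl fun v _ => hentry v, sum_add_distrib, costSize, sum_const, card_univ,
    Fintype.card_fin, smul_eq_mul, mul_comm 2]

theorem le_bitLength_encode :
    2 * (I.n * I.n) + 3 * I.n + 2 + I.costSize ≤ bitLength I.encode := by
  have hn : 2 ≤ bitLength [I.n] := by
    have := Nat.size_pos.2 I.n_pos
    rw [bitLength_cons]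
    omega
  have hG := length_le_bitLength (I.encodeRel I.G.Adj)
  have hT := length_le_bitLength (I.encodeRel I.T.Adj)
  have hR := length_le_bitLength (I.encodeSet I.R)
  rw [length_encodeRel] at hG hT
  rw [length_encodeSet] at hR
  simp only [encode_eq, bitLength_append, bitLength_encodeCosts]
  omega

theorem weight_le (v : Fin I.n) : I.weight v ≤ 4 * (I.n * I.n) * 2 ^ I.costSize := by
  have hfactor (u : Fin I.n) :
      I.weightFactor v u ≤ 2 ^ ((I.c u).num.size + (I.c u).den.size) := by
    rw [weightFactor]
    split_ifs
    · exact (Nat.lt_size_self _).le.trans (Nat.pow_le_pow_right two_pos (Nat.le_add_right _ _))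
    · exact (Nat.lt_size_self _).le.trans (Nat.pow_le_pow_right two_pos (Nat.le_add_left _ _))
  rw [weight, costSize, ← prod_pow_eq_pow_sum]
  exact Nat.mul_le_mul_left _ (prod_le_prod' fun u _ => hfactor u)

theorem num_lt_and_den_lt (v : Fin I.n) :
    (I.c v).num < 2 ^ bitLength I.encode ∧ (I.c v).den < 2 ^ bitLength I.encode := by
  have hv : (I.c v).num.size + (I.c v).den.size ≤ I.costSize :=
    single_le_sum (f := fun v => (I.c v).num.size + (I.c v).den.size)
      (fun _ _ => Nat.zero_le _) (mem_univ v)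
  have hsize := I.le_bitLength_encode
  exact ⟨Nat.size_le.1 (by omega), Nat.size_le.1 (by omega)⟩

theorem n_mul_n_lt_two_pow_bitLength : I.n * I.n < 2 ^ bitLength I.encode :=
  Nat.lt_two_pow_self.trans_le (Nat.pow_le_pow_right two_pos (by
    have := I.le_bitLength_encode
    omega))

theorem sum_weight_lt_two_pow_bitLength :
    (Nat.log 2 #I.R + 2) * (∑ x, I.weight x) * 2 < 2 ^ bitLength I.encode := by
  have hn := I.n_pos
  have hlog : Nat.log 2 #I.R + 2 ≤ 3 * I.n := by
    have hle := (Nat.log_le_self 2 #I.R).trans I.card_R_le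
    omega
  have hsum : ∑ x, I.weight x ≤ I.n * (4 * (I.n * I.n) * 2 ^ I.costSize) := by
    simpa using sum_le_card_nsmul univ I.weight _ fun v _ => I.weight_le v
  have hpow : 2 * I.n ≤ 2 ^ I.n := Nat.mul_le_pow (by decide) _
  calc (Nat.log 2 #I.R + 2) * (∑ x, I.weight x) * 2
      ≤ 3 * I.n * (I.n * (4 * (I.n * I.n) * 2 ^ I.costSize)) * 2 :=
        Nat.mul_le_mul_right _ (Nat.mul_le_mul hlog hsum)
    _ = 24 * (I.n ^ 4 * 2 ^ I.costSize) := by ring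
    _ < 32 * (I.n ^ 4 * 2 ^ I.costSize) := Nat.mul_lt_mul_of_pos_right (by decide) (by positivity)
    _ = 2 * ((2 * I.n) ^ 4 * 2 ^ I.costSize) := by ring
    _ ≤ 2 * ((2 ^ I.n) ^ 4 * 2 ^ I.costSize) := by gcongr
    _ = 2 ^ (4 * I.n + 1 + I.costSize) := by ring
    _ ≤ _ := Nat.pow_le_pow_right two_pos (by
        have hsize := I.le_bitLength_encode
        nlinarith)

open Steiner

variable {I : NWSTAP} {A S : Finset (Fin I.n)} {Ms : ℕ → Finset (Fin I.n)}

theorem subset_of_rounds {w : Fin I.n → ℕ} {B : ℕ}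
    (hr : ∀ k < B, I.Round w (2 ^ k) (Ms k) (Ms (k + 1))) : Ms 0 ⊆ Ms B := by
  induction B with
  | zero => exact Subset.rfl
  | succ B ih =>
    exact (ih fun k hk => hr k (Nat.lt_succ_of_lt hk)).trans (hr B B.lt_succ_self).subset

theorem feasible_and_cost_le_of_rounds (h0 : Ms 0 = I.R)
    (hr : ∀ k < bitLength I.encode, I.Round I.weight (2 ^ k) (Ms k) (Ms (k + 1)))
    (hA : ∀ x, x ∈ A ↔ x ∉ I.R ∧ ∀ a b, ∀ r ∈ I.R,
      (within (I.G.deleteEdges {s(a, b)}) (Ms (bitLength I.encode))).Reachable r x)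
    (hS : I.Feasible S) :
    I.Feasible A ∧ (I.cost A : ℝ) ≤ 100 * Real.log #I.R ^ 2 * (I.cost S : ℝ) := by
  have hR : I.R ⊆ Ms (bitLength I.encode) := h0 ▸ subset_of_rounds hr
  obtain ⟨hcov, hweight⟩ := covers_and_weight_le_of_rounds
    (by have := I.le_bitLength_encode; omega) (fun v => weight_eq_zero I) (fun v => Dvd.intro _ rfl)
    I.two_mul_card_sq_lt h0 hr hS I.sum_weight_lt_two_pow_bitLength
  have hAM : A ⊆ Ms (bitLength I.encode) := fun x hx => by
    obtain ⟨r, hr⟩ := I.R_nonempty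
    exact mem_of_reachable_within (((hA x).1 hx).2 r r r hr) (hR hr)
  have hscaled : ((∑ x ∈ A, I.weight x : ℕ) : ℝ) ≤
      100 * Real.log #I.R ^ 2 * ((∑ x ∈ S, I.weight x : ℕ) : ℝ) :=
    (Nat.cast_le.2 (sum_le_sum_of_subset hAM)).trans hweight
  rw [sum_weight_eq_mul_cost, sum_weight_eq_mul_cost, mul_left_comm] at hscaled
  exact ⟨feasible_of_covers hR hcov hA,
    le_of_mul_le_mul_left hscaled (Nat.cast_pos.2 I.costScale_pos)⟩

end NWSTAP

namespace RAM

open Finset Steiner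

/-- The approximation algorithm. -/
def algorithm : Prog := .seq Prog.readInput Cmd.main.compile

/-- A bound for the running time of the algorithm in terms of the bit length of the input. -/
noncomputable def algorithmTime : Polynomial ℕ := 17 * Polynomial.X + 7 + Cmd.main.timeBound

theorem exists_exec_algorithm (I : NWSTAP) : ∃ A : Finset (Fin I.n),
    (∃ t s, Exec algorithm (.init I.encode) t s ∧ t ≤ algorithmTime.eval (bitLength I.encode) ∧
      s.output = I.encodeSet A) ∧
    ∀ S, I.Feasible S →
      I.Feasible A ∧ (I.cost A : ℝ) ≤ 100 * Real.log #I.R ^ 2 * (I.cost S : ℝ) := by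
  obtain ⟨t, s, hread, ht, hn, hbits, harr⟩ := exec_readInput I.encode
  have hinput := I.input_of_arr hn hbits harr
  obtain ⟨A, Ms, hout, h0, hr, hA⟩ := Cmd.exists_rounds_run_main hinput
    I.n_mul_n_lt_two_pow_bitLength I.num_lt_and_den_lt
  have hbound : ∀ b ∈ [Reg.n, Reg.bits], s.reg b ≤ bitLength I.encode := by
    have hsize := I.le_bitLength_encode
    simp only [List.forall_mem_cons, hinput.reg_n, hinput.reg_bits, List.not_mem_nil]
    exact ⟨by omega, le_rfl, by simp⟩
  obtain ⟨t', hmain, ht'⟩ := Cmd.exec_compile Cmd.main_wf hbound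
  refine ⟨A, ⟨t + t', _, hread.seq hmain, ?_, hout⟩, fun S =>
    NWSTAP.feasible_and_cost_le_of_rounds h0 hr hA⟩
  simpa [algorithmTime] using add_le_add ht ht'

end RAM

theorem theorem2 :
    ∃ A : (I : NWSTAP) → Finset (Fin I.n),
      RAM.PolyTimeComputable NWSTAP.encode (fun I => I.encodeSet (A I)) ∧
      ∃ C : ℝ, ∀ I : NWSTAP, (∃ S, I.Feasible S) →
        I.Feasible (A I) ∧
        ∀ S, I.Feasible S →
          (I.cost (A I) : ℝ) ≤ C * Real.log (I.R.card : ℝ) ^ 2 * (I.cost S : ℝ) := by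
  choose A hexec happrox using RAM.exists_exec_algorithm
  refine ⟨A, ⟨RAM.algorithm, RAM.algorithmTime, hexec⟩, 100, fun I ⟨S₀, hS₀⟩ => ?_⟩
  exact ⟨(happrox I S₀ hS₀).1, fun S hS => (happrox I S hS).2⟩
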